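/- Let $a>0$ and let $\mathbb T^2=\mathbb R^2/2\pi\mathcal L_0$, $\mathcal L_0=\mathbb Z(1/a,0)\oplus\mathbb Z(0,a)$, be the flat torus obtained by identifying opposite sides of a rectangle with side lengths $2\pi/a$ and $2\pi a$. Let $\mathcal L=\{(ma,n/a): m,n\in\mathbb Z\}$ be the dual lattice and let $\sigma(-\Delta)=\{|\xi|^2:\xi\in\mathcal L\}$ be the spectrum of the Laplacian on $\mathbb T^2$. Fix $x_0\in\mathbb T^2$. For $z\in\mathbb C\setminus\sigma(-\Delta)$ let $$G_z(x)=G_z(x;x_0)=(\Delta+z)^{-1}\delta_{x_0}=-\frac1{4\pi^2}\sum_{\xi\in\mathcal L}\frac{e^{i\langle\xi,x-x_0\rangle}}{|\xi|^2-z}\in L^2(\mathbb T^2)$$ be the Green's function. For $\varphi\in(-\pi,\pi)$ let $-\Delta_{x_0,\varphi}$ be the operator on $L^2(\mathbb T^2)$ with domain $\{g+cG_i+ce^{i\varphi}G_{-i}: g\in\tilde D_0,\ c\in\mathbb C\}$ and action $$-\Delta_{x_0,\varphi}\,(g+cG_i+ce^{i\varphi}G_{-i})=-\Delta g+ic\,G_i-ice^{i\varphi}G_{-i},$$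 where $\tilde D_0$ is the domain of the closure of $-\Delta$ restricted to the $C^\infty$ functions on $\mathbb T^2$ that vanish in a neighbourhood of $x_0$ (and $-\Delta g$ denotes the action of this closure); these operators are self-adjoint extensions of that restriction. Let $\Lambda_\varphi\subset\mathbb R$ be the set of perturbed (new) eigenvalues, that is, the eigenvalues of $-\Delta_{x_0,\varphi}$ that do not lie in $\sigma(-\Delta)$, and for $\lambda\in\Lambda_\varphi$ put $g_\lambda=G_\lambda/\|G_\lambda\|_{L^2}$. **Theorem.** Fix $\varphi\in(-\pi,\pi)$. There is a subset $\Lambda_{\varphi,\infty}\subset\Lambda_\varphi$ of density one, i.e. $$\lim_{X\to\infty}\frac{\#\{\lambda\in\Lambda_{\varphi,\infty}:\lambda\le X\}}{\#\{\lambda\in\Lambda_\varphi:\lambda\le X\}}=1,$$ such that for every $b\in C^\infty(\mathbb T^2)$ $$\int_{\mathbb T^2}b(x)\,g_\lambda(x)^2\,dx\longrightarrow\frac1{\operatorname{area}(\mathbb T^2)}\int_{\mathbb T^2}b(x)\,dx$$ as $\lambda\to\infty$ along $\Lambda_{\varphi,\infty}$. -/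

import Mathlib

open MeasureTheory Filter Topology
open scoped ContDiff

namespace PointScatterer

noncomputable section

instance factPosWidth (a : ℝ) [h : Fact (0 < a)] : Fact (0 < 2 * Real.pi / a) :=
  ⟨div_pos Real.two_pi_pos h.out⟩

instance factPosHeight (a : ℝ) [h : Fact (0 < a)] : Fact (0 < 2 * Real.pi * a) :=
  ⟨mul_pos Real.two_pi_pos h.out⟩

/-- The flat torus obtained by identifying opposite sides of a rectangle with side lengths
`2π / a` and `2π a`. For `a > 0` its `volume` is Lebesgue measure, of total mass `4π²`. -/
abbrev Torus (a : ℝ) : Type :=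
  AddCircle (2 * Real.pi / a) × AddCircle (2 * Real.pi * a)

/-- `f` is a `C^∞` function on the torus: its periodic lift to the plane is smooth. -/
def IsSmooth {a : ℝ} (f : Torus a → ℂ) : Prop :=
  ContDiff ℝ ∞ (fun v : ℝ × ℝ =>
    f ((v.1 : AddCircle (2 * Real.pi / a)), (v.2 : AddCircle (2 * Real.pi * a))))

/-- The Laplacian `∂²/∂x₁² + ∂²/∂x₂²` of a (smooth) function on the torus. -/
def laplacian {a : ℝ} (f : Torus a → ℂ) (x : Torus a) : ℂ :=
  iteratedDeriv 2 (fun t : ℝ => f (x.1 + (t : AddCircle (2 * Real.pi / a)), x.2)) 0 +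
    iteratedDeriv 2 (fun t : ℝ => f (x.1, x.2 + (t : AddCircle (2 * Real.pi * a)))) 0

/-- The spectrum `σ(-Δ)` of the unperturbed Laplacian: the eigenvalues of `-Δ` on smooth
functions. -/
def unperturbedSpectrum (a : ℝ) : Set ℝ :=
  {t | ∃ f : Torus a → ℂ, IsSmooth f ∧ f ≠ 0 ∧ ∀ x, -laplacian f x = (t : ℂ) * f x}

/-- The squared length `|ξ|²` of the vector `ξ = (m a, n / a)` of the dual lattice. -/
def normSq (a : ℝ) (k : ℤ × ℤ) : ℝ :=
  ((k.1 : ℝ) * a) ^ 2 + ((k.2 : ℝ) / a) ^ 2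

/-- The exponential `x ↦ exp (i ⟨ξ, x⟩)`, for `ξ = (m a, n / a)`. Recall that
`fourier n x = exp (2 π i n x / T)` on `AddCircle T`. -/
def expo (a : ℝ) (k : ℤ × ℤ) : C(Torus a, ℂ) where
  toFun x := fourier k.1 x.1 * fourier k.2 x.2
  continuous_toFun := by fun_prop

/-- The function `x ↦ exp (i ⟨ξ, x - x₀⟩)`. -/
def expoAt (a : ℝ) (x₀ : Torus a) (k : ℤ × ℤ) : C(Torus a, ℂ) where
  toFun x := expo a k (x - x₀)
  continuous_toFun := by fun_prop

/-- The Hilbert space `L²(𝕋²)`. -/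
abbrev L2 (a : ℝ) [Fact (0 < a)] : Type :=
  Lp ℂ 2 (volume : Measure (Torus a))

/-- The Green's function `G_z(·; x₀) = (Δ + z)⁻¹ δ_{x₀}` for `z ∉ σ(-Δ)`, as an element of
`L²(𝕋²)`, through its `L²`-expansion `-(4π²)⁻¹ ∑_ξ exp (i ⟨ξ, x - x₀⟩) / (|ξ|² - z)`. -/
def green (a : ℝ) [Fact (0 < a)] (x₀ : Torus a) (z : ℂ) : L2 a :=
  -(((4 * Real.pi ^ 2 : ℝ) : ℂ)⁻¹ • ∑' k : ℤ × ℤ, ((normSq a k : ℂ) - z)⁻¹ •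
    ContinuousMap.toLp 2 (volume : Measure (Torus a)) ℂ (expoAt a x₀ k))

/-- The graph of `-Δ` restricted to the `C^∞` functions that vanish in a neighbourhood
of `x₀`. -/
def restrictedGraph (a : ℝ) [Fact (0 < a)] (x₀ : Torus a) : Set (L2 a × L2 a) :=
  {p | ∃ f : Torus a → ℂ, IsSmooth f ∧ (∀ᶠ x in 𝓝 x₀, f x = 0) ∧
    p.1 =ᵐ[volume] f ∧ p.2 =ᵐ[volume] fun x => -laplacian f x}

/-- The graph of the point scatterer `-Δ_{x₀,φ}`, the self-adjoint extension with phase `φ` of the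
restricted Laplacian: it maps `g + c G_i + c e^{iφ} G_{-i}` to
`-Δ g + i c G_i - i c e^{iφ} G_{-i}`, for `c ∈ ℂ` and for `g` in the domain of the closure of the
restricted Laplacian (the operator whose graph is the closure of `restrictedGraph`). -/
def scattererGraph (a : ℝ) [Fact (0 < a)] (x₀ : Torus a) (φ : ℝ) : Set (L2 a × L2 a) :=
  {p | ∃ q ∈ closure (restrictedGraph a x₀), ∃ c : ℂ,
    p.1 = q.1 + c • green a x₀ Complex.I +
      (c * Complex.exp (Complex.I * φ)) • green a x₀ (-Complex.I) ∧
    p.2 = q.2 + (Complex.I * c) • green a x₀ Complex.I -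
      (Complex.I * c * Complex.exp (Complex.I * φ)) • green a x₀ (-Complex.I)}

/-- The set `Λ_φ` of perturbed (new) eigenvalues: the eigenvalues of `-Δ_{x₀,φ}` that are not in
the spectrum of the unperturbed Laplacian. -/
def newEigenvalues (a : ℝ) [Fact (0 < a)] (x₀ : Torus a) (φ : ℝ) : Set ℝ :=
  {t | t ∉ unperturbedSpectrum a ∧ ∃ f : L2 a, f ≠ 0 ∧ (f, (t : ℂ) • f) ∈ scattererGraph a x₀ φ}

/-- The `L²`-normalized Green's function `g_t = G_t / ‖G_t‖₂`. -/
def normalizedGreen (a : ℝ) [Fact (0 < a)] (x₀ : Torus a) (t : ℝ) : L2 a :=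
  ((‖green a x₀ (t : ℂ)‖⁻¹ : ℝ) : ℂ) • green a x₀ (t : ℂ)

/-- `S` is a subset of `A` of (relative) density one. -/
def IsDensityOneSubset (S A : Set ℝ) : Prop :=
  S ⊆ A ∧ Tendsto (fun X : ℝ => ((S ∩ Set.Iic X).ncard : ℝ) / ((A ∩ Set.Iic X).ncard : ℝ))
    atTop (𝓝 1)

end

end PointScatterer

/-! Let `e_ζ(x) = exp(i⟨ζ, x - x₀⟩)` and `M(t) = ∑_ξ (|ξ|² - t)⁻²`. The Fourier coefficients of
`g_t` are real, even in `ξ` and proportional to `(|ξ|² - t)⁻¹`, so Parseval gives `∫ e_ζ g_t² =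
M(t)⁻¹ ∑_ξ (|ξ|² - t)⁻¹ (|ξ + ζ|² - t)⁻¹`. This is `1` for `ζ = 0` and at most `1` in modulus
always. A smooth `b` has absolutely summable Fourier coefficients, so by dominated convergence it is
enough that, along a set of density one, each moment with `ζ ≠ 0` tends to `0`.

Put `X = Z ^ 128` and `L = Z ^ 20`, and let `T(t) = ∑_ξ (L² + (|ξ|² - t)²)⁻¹`. If no `ξ` has both
`ξ` and `ξ + ζ` in the annulus `||ξ|² - t| ≤ L`, then each product in the moment has a factor
outside the annulus, and the squares of such factors sum to at most `2 T(t)`; hence the moment is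
small once `T(t)` is small against `M(t)` (`tsum_mul_shift_le`). Three conditions on `t ≤ X`
suffice: the nearest norm below `t` is within `Z ^ 2`, so that `M ≥ Z ^ (-4)`; `T ≤ Z ^ (-6)`; and
no resonance with a shift of squared length at most `Z`. Each fails for only `O(Z ^ 126)` new
eigenvalues (`Interlaces.exists_card_correlated_le`), while at least a constant times `Z ^ 127` of
them lie below `X`.

The arithmetic input is an energy estimate for pairs of norms (`exists_energy_le`), which rests on
the divisor bound. It gives the mean value of `T` and, through Cauchy–Schwarz, the lower bound for
the number of distinct norms. The new eigenvalues are counted through their interlacing with the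
norms.

Interlacing comes from operator theory. The closure of the restricted Laplacian consists of the
pairs `(u, v)` with `v̂ = |ξ|² û` and `∑ û = 0` (`mem_closure_restrictedGraph_iff`). Hence new
eigenvalues are the zeros off the norms of `spectralFn`, which increases from `-∞` to `+∞` between
consecutive norms. -/

namespace PointScatterer

/-! ### The divisor bound -/

theorem exists_succ_pow_le_two_pow (N : ℕ) : ∃ C : ℕ, 0 < C ∧ ∀ e : ℕ, (e + 1) ^ N ≤ C * 2 ^ e := by
  have h := (tendsto_pow_const_div_const_pow_of_one_lt N (one_lt_two : (1 : ℝ) < 2))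
  obtain ⟨B, hB⟩ := h.bddAbove_range
  refine ⟨⌈2 * B⌉₊ + 1, Nat.succ_pos _, fun e => ?_⟩
  have h1 : ((e + 1 : ℕ) : ℝ) ^ N / 2 ^ (e + 1) ≤ B := hB ⟨e + 1, rfl⟩
  rw [div_le_iff₀ (by positivity)] at h1
  have h2 := Nat.le_ceil (2 * B)
  have h3 : (((e + 1) ^ N : ℕ) : ℝ) ≤ (((⌈2 * B⌉₊ + 1) * 2 ^ e : ℕ) : ℝ) := by
    push_cast
    push_cast at h1
    have : (0 : ℝ) < 2 ^ e := by positivity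
    rw [pow_succ] at h1
    nlinarith
  exact_mod_cast h3

/-- This is `d(n) ≪ n^(1/N)`, free of real exponents. A prime `p ≥ 2 ^ N` satisfies `(e + 1) ^ N ≤ p
^ e` at no cost; each of the fewer than `2 ^ N` smaller primes costs one factor `C`. -/
theorem exists_card_divisors_pow_le (N : ℕ) :
    ∃ C : ℕ, 0 < C ∧ ∀ n : ℕ, n ≠ 0 → n.divisors.card ^ N ≤ C * n := by
  obtain ⟨C, hC, h⟩ := exists_succ_pow_le_two_pow N
  refine ⟨C ^ 2 ^ N, by positivity, fun n hn => ?_⟩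
  rw [Nat.card_divisors hn, ← Finset.prod_pow]
  have hterm : ∀ p ∈ n.primeFactors, (n.factorization p + 1) ^ N ≤
      (if p < 2 ^ N then C else 1) * p ^ n.factorization p := by
    intro p hp
    have hp2 : 2 ≤ p := (Nat.prime_of_mem_primeFactors hp).two_le
    split_ifs with hlt
    · exact (h _).trans (Nat.mul_le_mul_left _ (Nat.pow_le_pow_left hp2 _))
    · rw [one_mul]
      calc (n.factorization p + 1) ^ N ≤ (2 ^ n.factorization p) ^ N :=
            Nat.pow_le_pow_left (Nat.lt_two_pow_self) _
        _ = (2 ^ N) ^ n.factorization p := by rw [← pow_mul, ← pow_mul, mul_comm]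
        _ ≤ _ := Nat.pow_le_pow_left (not_lt.mp hlt) _
  refine (Finset.prod_le_prod' hterm).trans ?_
  rw [Finset.prod_mul_distrib]
  have h2 : ∏ p ∈ n.primeFactors, p ^ n.factorization p = n := Nat.prod_factorization_pow_eq_self hn
  rw [h2]
  refine Nat.mul_le_mul_right _ ?_
  rw [Finset.prod_ite, Finset.prod_const, Finset.prod_const_one, mul_one]
  refine Nat.pow_le_pow_right hC ?_
  calc _ ≤ (Finset.range (2 ^ N)).card := Finset.card_le_card (fun p hp => by
        simpa using (Finset.mem_filter.mp hp).2)
    _ = 2 ^ N := Finset.card_range _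

/-! ### Sums of the kernel `(L² + s²)⁻¹` over arithmetic progressions -/

/-- The exponent `1` is split as `1/4 + 3/4`: the first part supplies decay in `W`, the second keeps
summability in `t`. With `L = W²` the sharp decay after summation would be `W⁻²`; the weaker `W⁻¹`
is all that is needed. -/
theorem inv_kernel_le {W : ℝ} (hW : 1 ≤ W) (t : ℝ) :
    ((W ^ 2) ^ 2 + t ^ 2)⁻¹ ≤ W⁻¹ * ((1 + t ^ 2) ^ (3 / 4 : ℝ))⁻¹ := by
  have hW0 : 0 < W := by linarith
  rw [← mul_inv]
  refine inv_anti₀ (by positivity) ?_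
  have h1 : W ≤ ((W ^ 2) ^ 2 + t ^ 2) ^ (1 / 4 : ℝ) := by
    calc W = ((W ^ 4) ^ (1 / 4 : ℝ)) := by
          rw [← Real.rpow_natCast, ← Real.rpow_mul hW0.le]; norm_num
      _ ≤ _ := Real.rpow_le_rpow (by positivity) (by nlinarith [sq_nonneg t]) (by norm_num)
  have h2 : (1 + t ^ 2) ^ (3 / 4 : ℝ) ≤ ((W ^ 2) ^ 2 + t ^ 2) ^ (3 / 4 : ℝ) := by
    refine Real.rpow_le_rpow (by positivity) ?_ (by norm_num)
    have : 1 ≤ (W ^ 2) ^ 2 := one_le_pow₀ (one_le_pow₀ hW)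
    linarith
  calc _ ≤ ((W ^ 2) ^ 2 + t ^ 2) ^ (1 / 4 : ℝ) * ((W ^ 2) ^ 2 + t ^ 2) ^ (3 / 4 : ℝ) := by gcongr
    _ = _ := by
      rw [← Real.rpow_add (by positivity)]; norm_num

theorem summable_int_inv_one_add_sq_rpow {c : ℝ} (hc : 0 < c) :
    Summable fun u : ℤ => ((1 + (c * u) ^ 2) ^ (3 / 4 : ℝ))⁻¹ := by
  have h := (Real.summable_abs_int_rpow (b := 3 / 2) (by norm_num)).mul_left (c ^ (-(3 / 2) : ℝ))
  refine Summable.of_norm_bounded_eventually h ?_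
  have : ∀ᶠ u : ℤ in cofinite, u ≠ 0 := (Set.finite_singleton 0).eventually_cofinite_notMem
  filter_upwards [this] with u hu
  have hu' : 0 < |(u : ℝ)| := by positivity
  rw [Real.norm_of_nonneg (by positivity), ← Real.mul_rpow hc.le hu'.le, Real.rpow_neg (by positivity)]
  refine inv_anti₀ (by positivity) ?_
  calc (c * |(u : ℝ)|) ^ (3 / 2 : ℝ) = ((c * |(u : ℝ)|) ^ 2) ^ (3 / 4 : ℝ) := by
        rw [← Real.rpow_natCast, ← Real.rpow_mul (by positivity)]; norm_num
    _ ≤ _ := by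
      refine Real.rpow_le_rpow (by positivity) ?_ (by norm_num)
      rw [mul_pow, sq_abs, mul_pow]; linarith

theorem exists_sum_kernel_le {c : ℝ} (hc : 0 < c) :
    ∃ C : ℝ, 0 < C ∧ ∀ W : ℝ, 1 ≤ W → ∀ s : ℝ, ∀ U : Finset ℤ,
      ∑ u ∈ U, ((W ^ 2) ^ 2 + (c * u + s) ^ 2)⁻¹ ≤ C / W := by
  have hsum := summable_int_inv_one_add_sq_rpow hc
  set w : ℤ → ℝ := fun u => ((1 + (c * u) ^ 2) ^ (3 / 4 : ℝ))⁻¹ with hw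
  have hw0 : ∀ u, 0 ≤ w u := fun u => by positivity
  set A : ℝ := (2 * (1 + c ^ 2)) ^ (3 / 4 : ℝ) with hA
  have hA0 : 0 < A := by positivity
  refine ⟨A * (∑' u, w u + 1), mul_pos hA0 (by have : 0 ≤ ∑' u, w u := tsum_nonneg hw0; linarith), ?_⟩
  intro W hW s U
  have hW0 : 0 < W := by linarith
  -- Translation by a multiple of `c` reduces `s` to a remainder in `[0, c]`, which changes the
  -- weight by at most the factor `A`, uniformly in `s`.
  set v : ℤ := ⌊s / c⌋ with hv
  have hr1 : 0 ≤ s - c * v := by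
    have := Int.floor_le (s / c)
    rw [le_div_iff₀ hc] at this; linarith
  have hr2 : s - c * v ≤ c := by
    have := (Int.lt_floor_add_one (s / c)).le
    rw [div_le_iff₀ hc] at this; linarith
  have hterm : ∀ u : ℤ, ((W ^ 2) ^ 2 + (c * u + s) ^ 2)⁻¹ ≤ W⁻¹ * (A * w (u + v)) := by
    intro u
    refine (inv_kernel_le hW _).trans ?_
    refine mul_le_mul_of_nonneg_left ?_ (by positivity)
    rw [hw, hA]
    simp only
    rw [← div_eq_mul_inv, inv_eq_one_div, div_le_div_iff₀ (by positivity) (by positivity), one_mul,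
      ← Real.mul_rpow (by positivity) (by positivity)]
    refine Real.rpow_le_rpow (by positivity) ?_ (by norm_num)
    push_cast
    set x := c * u + s
    set r := s - c * v
    have e1 : c * ((u : ℝ) + v) = x - r := by simp only [x, r]; ring
    rw [e1]
    have hr : r ^ 2 ≤ c ^ 2 := by nlinarith
    nlinarith [sq_nonneg (x + r), mul_nonneg (sq_nonneg x) (sq_nonneg c), sq_nonneg x, sq_nonneg c]
  calc _ ≤ ∑ u ∈ U, W⁻¹ * (A * w (u + v)) := Finset.sum_le_sum fun u _ => hterm u
    _ = W⁻¹ * (A * ∑ u ∈ U, w (u + v)) := by rw [Finset.mul_sum, Finset.mul_sum]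
    _ ≤ W⁻¹ * (A * (∑' u, w u + 1)) := by
      refine mul_le_mul_of_nonneg_left (mul_le_mul_of_nonneg_left ?_ hA0.le) (by positivity)
      have h1 : Summable fun u => w (u + v) := (Equiv.addRight v).summable_iff.mpr hsum
      have h2 : ∑' u, w (u + v) = ∑' u, w u := (Equiv.addRight v).tsum_eq w
      have := h1.sum_le_tsum U (fun u _ => hw0 _)
      linarith
    _ = _ := by ring

/-! ### The energy estimate -/

/-- Since `u = (x - z)(x + z)` is nonzero, the signed divisor `x - z` determines the pair. -/
theorem card_sq_sub_sq_eq_le (s : Finset (ℤ × ℤ)) {u : ℤ} (hu : u ≠ 0) :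
    (s.filter fun p => p.1 ^ 2 - p.2 ^ 2 = u).card ≤ 2 * u.natAbs.divisors.card := by
  classical
  set T : Finset ℤ := u.natAbs.divisors.image (fun n : ℕ => (n : ℤ)) ∪
    u.natAbs.divisors.image (fun n : ℕ => -(n : ℤ))
  have hT : T.card ≤ 2 * u.natAbs.divisors.card := by
    refine (Finset.card_union_le _ _).trans ?_
    have h1 := Finset.card_image_le (s := u.natAbs.divisors) (f := fun n : ℕ => (n : ℤ))
    have h2 := Finset.card_image_le (s := u.natAbs.divisors) (f := fun n : ℕ => -(n : ℤ))
    omega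
  refine le_trans (Finset.card_le_card_of_injOn (fun p => p.1 - p.2) ?_ ?_) hT
  · intro p hp
    have hp := (Finset.mem_filter.mp hp).2
    have hd : (p.1 - p.2).natAbs ∈ u.natAbs.divisors := by
      rw [Nat.mem_divisors]
      refine ⟨Int.natAbs_dvd_natAbs.mpr ⟨p.1 + p.2, by rw [← hp]; ring⟩, by simpa using hu⟩
    simp only [T, Finset.coe_union, Finset.coe_image, Set.mem_union, Set.mem_image, Finset.mem_coe]
    rcases Int.natAbs_eq (p.1 - p.2) with h | h
    · exact Or.inl ⟨_, hd, h.symm⟩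
    · exact Or.inr ⟨_, hd, h.symm⟩
  · intro p hp q hq hpq
    have hp := (Finset.mem_filter.mp hp).2
    have hq := (Finset.mem_filter.mp hq).2
    simp only at hpq
    have h0 : p.1 - p.2 ≠ 0 := by
      intro h
      apply hu
      rw [← hp]
      have : p.1 = p.2 := by linarith
      rw [this]; ring
    have h1 : (p.1 - p.2) * (p.1 + p.2) = (p.1 - p.2) * (q.1 + q.2) := by
      have : (q.1 - q.2) * (q.1 + q.2) = u := by rw [← hq]; ring
      rw [← hpq] at this
      rw [this, ← hp]; ring
    have h2 := mul_left_cancel₀ h0 h1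
    ext <;> omega

/-- Pairs are grouped by `u = x² - z²`. Each `u ≠ 0` occurs at most `2 D` times, and the kernel sum
over all `u` runs over an arithmetic progression; `u = 0` forces `x = ±z`, which leaves `O(Y + 1)`
pairs with kernel value at `s` and gives the second term. -/
theorem exists_sum_sq_sub_sq_le {c : ℝ} (hc : 0 < c) :
    ∃ C : ℝ, 0 < C ∧ ∀ W : ℝ, 1 ≤ W → ∀ s D : ℝ, 0 ≤ D → ∀ Y : ℕ,
      (∀ u : ℤ, u ≠ 0 → |u| ≤ (Y : ℤ) ^ 2 → (u.natAbs.divisors.card : ℝ) ≤ D) →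
      ∑ x ∈ Finset.Icc (-(Y : ℤ)) Y, ∑ z ∈ Finset.Icc (-(Y : ℤ)) Y,
        ((W ^ 2) ^ 2 + (c * ((x : ℝ) ^ 2 - (z : ℝ) ^ 2) + s) ^ 2)⁻¹ ≤
      C * (D / W + (Y + 1) * ((W ^ 2) ^ 2 + s ^ 2)⁻¹) := by
  classical
  obtain ⟨C, hC, hK⟩ := exists_sum_kernel_le hc
  refine ⟨2 * C + 4, by positivity, ?_⟩
  intro W hW s D hD Y hdiv
  have hW0 : 0 < W := by linarith
  rw [← Finset.sum_product']
  set B : Finset (ℤ × ℤ) := Finset.Icc (-(Y : ℤ)) Y ×ˢ Finset.Icc (-(Y : ℤ)) Y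
  set K : ℤ → ℝ := fun u => ((W ^ 2) ^ 2 + (c * u + s) ^ 2)⁻¹ with hKdef
  have hK0 : ∀ u, 0 ≤ K u := fun u => by positivity
  have e1 : ∑ p ∈ B, ((W ^ 2) ^ 2 + (c * ((p.1 : ℝ) ^ 2 - (p.2 : ℝ) ^ 2) + s) ^ 2)⁻¹ =
      ∑ p ∈ B, K (p.1 ^ 2 - p.2 ^ 2) := by
    refine Finset.sum_congr rfl fun p _ => ?_
    simp [hKdef]
  rw [e1, ← Finset.sum_filter_add_sum_filter_not B (fun p => p.1 ^ 2 - p.2 ^ 2 = 0)]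
  have hdiag : ∑ p ∈ B with p.1 ^ 2 - p.2 ^ 2 = 0, K (p.1 ^ 2 - p.2 ^ 2) ≤
      4 * (Y + 1) * ((W ^ 2) ^ 2 + s ^ 2)⁻¹ := by
    have h1 : ∑ p ∈ B with p.1 ^ 2 - p.2 ^ 2 = 0, K (p.1 ^ 2 - p.2 ^ 2) =
        ((B.filter fun p => p.1 ^ 2 - p.2 ^ 2 = 0).card : ℝ) * ((W ^ 2) ^ 2 + s ^ 2)⁻¹ := by
      rw [← nsmul_eq_mul, ← Finset.sum_const]
      refine Finset.sum_congr rfl fun p hp => ?_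
      rw [(Finset.mem_filter.mp hp).2]; simp [hKdef]
    rw [h1]
    refine mul_le_mul_of_nonneg_right ?_ (by positivity)
    have h2 : (B.filter fun p => p.1 ^ 2 - p.2 ^ 2 = 0) ⊆
        (Finset.Icc (-(Y : ℤ)) Y).image (fun x => (x, x)) ∪
        (Finset.Icc (-(Y : ℤ)) Y).image (fun x => (x, -x)) := by
      intro p hp
      obtain ⟨hpB, hp⟩ := Finset.mem_filter.mp hp
      have hpB := (Finset.mem_product.mp hpB).1
      rw [sub_eq_zero, sq_eq_sq_iff_eq_or_eq_neg] at hp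
      rw [Finset.mem_union, Finset.mem_image, Finset.mem_image]
      rcases hp with hp | hp
      · exact Or.inl ⟨p.1, hpB, by ext <;> simp [hp]⟩
      · exact Or.inr ⟨p.1, hpB, by ext <;> simp [hp]⟩
    have h3 := (Finset.card_le_card h2).trans (Finset.card_union_le _ _)
    have h4 := Finset.card_image_le (s := Finset.Icc (-(Y : ℤ)) Y) (f := fun x => (x, x))
    have h5 := Finset.card_image_le (s := Finset.Icc (-(Y : ℤ)) Y) (f := fun x => (x, -x))
    have h6 : (Finset.Icc (-(Y : ℤ)) Y).card = 2 * Y + 1 := by rw [Int.card_Icc]; omega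
    have h7 : (B.filter fun p => p.1 ^ 2 - p.2 ^ 2 = 0).card ≤ 4 * (Y + 1) := by omega
    exact_mod_cast h7
  have hoff : ∑ p ∈ B with ¬ p.1 ^ 2 - p.2 ^ 2 = 0, K (p.1 ^ 2 - p.2 ^ 2) ≤ 2 * D * (C / W) := by
    rw [Finset.sum_comp K (fun p : ℤ × ℤ => p.1 ^ 2 - p.2 ^ 2)]
    calc _ ≤ ∑ u ∈ (B.filter fun p => ¬ p.1 ^ 2 - p.2 ^ 2 = 0).image
            (fun p : ℤ × ℤ => p.1 ^ 2 - p.2 ^ 2), 2 * D * K u := by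
          refine Finset.sum_le_sum fun u hu => ?_
          rw [nsmul_eq_mul]
          refine mul_le_mul_of_nonneg_right ?_ (hK0 u)
          obtain ⟨p, hp, rfl⟩ := Finset.mem_image.mp hu
          obtain ⟨hpB, hp⟩ := Finset.mem_filter.mp hp
          have hb : |p.1 ^ 2 - p.2 ^ 2| ≤ (Y : ℤ) ^ 2 := by
            obtain ⟨h1, h2⟩ := Finset.mem_product.mp hpB
            rw [Finset.mem_Icc] at h1 h2
            rw [abs_le]
            constructor <;> nlinarith
          have h1 := card_sq_sub_sq_eq_le (B.filter fun p => ¬ p.1 ^ 2 - p.2 ^ 2 = 0) hp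
          have h2 := hdiv _ hp hb
          calc _ ≤ ((2 * (p.1 ^ 2 - p.2 ^ 2).natAbs.divisors.card : ℕ) : ℝ) := by exact_mod_cast h1
            _ ≤ _ := by push_cast; linarith
      _ = 2 * D * ∑ u ∈ (B.filter fun p => ¬ p.1 ^ 2 - p.2 ^ 2 = 0).image
            (fun p : ℤ × ℤ => p.1 ^ 2 - p.2 ^ 2), K u := by rw [Finset.mul_sum]
      _ ≤ _ := mul_le_mul_of_nonneg_left (hK W hW s _) (by positivity)
  have hpos : 0 ≤ D / W := by positivity
  have hpos2 : 0 ≤ (Y + 1 : ℝ) * ((W ^ 2) ^ 2 + s ^ 2)⁻¹ := by positivity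
  calc _ ≤ 4 * (Y + 1) * ((W ^ 2) ^ 2 + s ^ 2)⁻¹ + 2 * D * (C / W) := add_le_add hdiag hoff
    _ = 4 * ((Y + 1) * ((W ^ 2) ^ 2 + s ^ 2)⁻¹) + 2 * C * (D / W) := by ring
    _ ≤ _ := by nlinarith

/-- The lattice points with both coordinates in `[-Y, Y]`. -/
noncomputable def box (Y : ℕ) : Finset (ℤ × ℤ) := Finset.Icc (-(Y : ℤ)) Y ×ˢ Finset.Icc (-(Y : ℤ)) Y

/-- A difference of norms is `a² (x² - z²) + a⁻² (y² - w²)`. The one-dimensional bound is used for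
`x, z` with `y, w` fixed; its diagonal term still depends on `y, w`, and the same bound with `s = 0`
sums it. -/
theorem exists_energy_le {a : ℝ} (ha : 0 < a) :
    ∃ C : ℝ, 0 < C ∧ ∀ W : ℝ, 1 ≤ W → ∀ D : ℝ, 1 ≤ D → ∀ Y : ℕ,
      (∀ u : ℤ, u ≠ 0 → |u| ≤ (Y : ℤ) ^ 2 → (u.natAbs.divisors.card : ℝ) ≤ D) →
      ∑ k ∈ box Y, ∑ l ∈ box Y, ((W ^ 2) ^ 2 + (normSq a k - normSq a l) ^ 2)⁻¹ ≤
        C * (Y + 1) ^ 2 * D / W := by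
  obtain ⟨C₁, hC₁, h₁⟩ := exists_sum_sq_sub_sq_le (c := a ^ 2) (by positivity)
  obtain ⟨C₂, hC₂, h₂⟩ := exists_sum_sq_sub_sq_le (c := (a ^ 2)⁻¹) (by positivity)
  refine ⟨4 * C₁ + 2 * (C₁ * C₂), by positivity, ?_⟩
  intro W hW D hD Y hdiv
  have hW0 : 0 < W := by linarith
  set I := Finset.Icc (-(Y : ℤ)) Y with hI
  have hIcard : (I.card : ℝ) ≤ 2 * (Y + 1) := by
    have : I.card ≤ 2 * (Y + 1) := by rw [hI, Int.card_Icc]; omega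
    exact_mod_cast this
  have e : ∑ k ∈ box Y, ∑ l ∈ box Y, ((W ^ 2) ^ 2 + (normSq a k - normSq a l) ^ 2)⁻¹ =
      ∑ y ∈ I, ∑ w ∈ I, ∑ x ∈ I, ∑ z ∈ I, ((W ^ 2) ^ 2 + (a ^ 2 * ((x : ℝ) ^ 2 - (z : ℝ) ^ 2) +
        (a ^ 2)⁻¹ * ((y : ℝ) ^ 2 - (w : ℝ) ^ 2)) ^ 2)⁻¹ := by
    simp only [box, ← hI]
    rw [Finset.sum_product_right]
    refine Finset.sum_congr rfl fun y _ => ?_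
    rw [Finset.sum_congr rfl (fun x _ => Finset.sum_product_right _ _ _), Finset.sum_comm]
    refine Finset.sum_congr rfl fun w _ => Finset.sum_congr rfl fun x _ =>
      Finset.sum_congr rfl fun z _ => ?_
    simp only [normSq]
    congr 3
    field_simp
    ring
  rw [e]
  calc _ ≤ ∑ y ∈ I, ∑ w ∈ I, C₁ * (D / W + (Y + 1) *
        ((W ^ 2) ^ 2 + ((a ^ 2)⁻¹ * ((y : ℝ) ^ 2 - (w : ℝ) ^ 2)) ^ 2)⁻¹) :=
        Finset.sum_le_sum fun y _ => Finset.sum_le_sum fun w _ =>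
          h₁ W hW _ D (by linarith) Y hdiv
    _ = C₁ * ((I.card : ℝ) ^ 2 * (D / W) + (Y + 1) * ∑ y ∈ I, ∑ w ∈ I,
        ((W ^ 2) ^ 2 + ((a ^ 2)⁻¹ * ((y : ℝ) ^ 2 - (w : ℝ) ^ 2) + 0) ^ 2)⁻¹) := by
        simp only [← Finset.mul_sum, Finset.sum_add_distrib, Finset.sum_const, nsmul_eq_mul,
          add_zero]
        ring
    _ ≤ C₁ * ((2 * (Y + 1)) ^ 2 * (D / W) + (Y + 1) *
        (C₂ * (D / W + (Y + 1) * ((W ^ 2) ^ 2 + (0 : ℝ) ^ 2)⁻¹))) := by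
        have := h₂ W hW 0 D (by linarith) Y hdiv
        gcongr
    _ ≤ C₁ * ((2 * (Y + 1)) ^ 2 * (D / W) + (Y + 1) *
        (C₂ * ((Y + 1) * (D / W) + (Y + 1) * (D / W)))) := by
        have h3 : ((W ^ 2) ^ 2 + (0 : ℝ) ^ 2)⁻¹ ≤ D / W := by
          rw [inv_eq_one_div]
          refine div_le_div₀ (by linarith) hD hW0 ?_
          nlinarith [one_le_pow₀ (n := 3) hW]
        have h4 : D / W ≤ (Y + 1) * (D / W) := by
          have : 0 ≤ D / W := by positivity
          have hY : (0 : ℝ) ≤ Y := by positivity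
          nlinarith
        gcongr
    _ = _ := by ring

/-! ### Lattice points in discs -/

theorem normSq_nonneg (a : ℝ) (k : ℤ × ℤ) : 0 ≤ normSq a k := by unfold normSq; positivity

@[simp] theorem normSq_zero (a : ℝ) : normSq a 0 = 0 := by simp [normSq]

theorem normSq_neg (a : ℝ) (k : ℤ × ℤ) : normSq a (-k) = normSq a k := by
  simp [normSq, neg_div]

theorem mem_box {Y : ℕ} {k : ℤ × ℤ} : k ∈ box Y ↔ |k.1| ≤ Y ∧ |k.2| ≤ Y := by
  simp [box, abs_le, Finset.mem_product]

theorem card_box_le (Y : ℕ) : ((box Y).card : ℝ) ≤ 4 * (Y + 1) ^ 2 := by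
  have : (box Y).card ≤ 4 * (Y + 1) ^ 2 := by
    rw [box, Finset.card_product, Int.card_Icc]
    have : ((Y : ℤ) + 1 - -Y).toNat = 2 * Y + 1 := by omega
    rw [this]; nlinarith
  exact_mod_cast this

theorem mem_box_of_normSq_le {a : ℝ} (ha : 0 < a) {R : ℝ} (hR : 0 ≤ R) {Y : ℕ}
    (hY : R * (a + a⁻¹) ≤ Y) {k : ℤ × ℤ} (hk : normSq a k ≤ R ^ 2) : k ∈ box Y := by
  have ha' : 0 < a⁻¹ := inv_pos.mpr ha
  unfold normSq at hk
  have h1 : |(k.1 : ℝ) * a| ≤ R := abs_le_of_sq_le_sq (by nlinarith [sq_nonneg ((k.2 : ℝ) / a)]) hR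
  have h2 : |(k.2 : ℝ) / a| ≤ R := abs_le_of_sq_le_sq (by nlinarith [sq_nonneg ((k.1 : ℝ) * a)]) hR
  rw [abs_mul, abs_of_pos ha] at h1
  rw [abs_div, abs_of_pos ha, div_le_iff₀ ha] at h2
  rw [← le_div_iff₀ ha, div_eq_mul_inv] at h1
  have h3 : |(k.1 : ℝ)| ≤ Y := by nlinarith
  have h4 : |(k.2 : ℝ)| ≤ Y := by nlinarith
  rw [mem_box]
  exact ⟨by exact_mod_cast h3, by exact_mod_cast h4⟩

theorem finite_normSq_le {a : ℝ} (ha : 0 < a) (R : ℝ) : {k | normSq a k ≤ R}.Finite := by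
  refine (box ⌈(|R| + 1) * (a + a⁻¹)⌉₊).finite_toSet.subset fun k hk => ?_
  refine mem_box_of_normSq_le ha (by positivity) (Nat.le_ceil _) (le_trans hk ?_)
  have := le_abs_self R
  have := abs_nonneg R
  nlinarith

/-- A box that contains the disc `|ξ|² ≤ 4 Z ^ 128`. -/
noncomputable def scaledBox (a Z : ℝ) : Finset (ℤ × ℤ) := box ⌈2 * Z ^ 64 * (a + a⁻¹)⌉₊

theorem mem_scaledBox {a : ℝ} (ha : 0 < a) {Z : ℝ} (hZ : 1 ≤ Z) {k : ℤ × ℤ}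
    (hk : normSq a k ≤ 4 * Z ^ 128) : k ∈ scaledBox a Z :=
  mem_box_of_normSq_le ha (by positivity) (Nat.le_ceil _) (hk.trans_eq (by ring))

theorem exists_side_le {a : ℝ} (ha : 0 < a) : ∃ C : ℝ, 1 ≤ C ∧ ∀ Z : ℝ, 1 ≤ Z →
    (⌈2 * Z ^ 64 * (a + a⁻¹)⌉₊ : ℝ) + 1 ≤ C * Z ^ 64 := by
  have ha' : 0 < a⁻¹ := inv_pos.mpr ha
  refine ⟨2 * (a + a⁻¹) + 2, by linarith, fun Z hZ => ?_⟩
  have h1 := Nat.ceil_lt_add_one (a := 2 * Z ^ 64 * (a + a⁻¹)) (by positivity)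
  have h2 : 1 ≤ Z ^ 64 := one_le_pow₀ hZ
  nlinarith

theorem exists_card_scaledBox_le {a : ℝ} (ha : 0 < a) : ∃ C : ℝ, 0 < C ∧ ∀ Z : ℝ, 1 ≤ Z →
    ((scaledBox a Z).card : ℝ) ≤ C * Z ^ 128 := by
  obtain ⟨C, hC, h⟩ := exists_side_le ha
  refine ⟨4 * C ^ 2, by positivity, fun Z hZ => (card_box_le _).trans ?_⟩
  calc _ ≤ 4 * (C * Z ^ 64) ^ 2 := by gcongr; exact h Z hZ
    _ = _ := by ring

/-- This fixes the exponent `128`: the differences of squares in the box are `O(Z ^ 128)`, so `d(u)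
^ 128 ≪ |u|` gives `d(u) ≪ Z`. The divisor function therefore costs a single power of `Z`. -/
theorem exists_energy_scaledBox_le {a : ℝ} (ha : 0 < a) :
    ∃ C : ℝ, 0 < C ∧ ∀ Z : ℝ, 1 ≤ Z → ∀ W : ℝ, 1 ≤ W →
      ∑ k ∈ scaledBox a Z, ∑ l ∈ scaledBox a Z,
        ((W ^ 2) ^ 2 + (normSq a k - normSq a l) ^ 2)⁻¹ ≤ C * Z ^ 129 / W := by
  obtain ⟨C₁, hC₁, h₁⟩ := exists_energy_le ha
  obtain ⟨C₂, hC₂, h₂⟩ := exists_side_le ha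
  obtain ⟨C₃, hC₃, h₃⟩ := exists_card_divisors_pow_le 128
  have hC₃' : (1 : ℝ) ≤ C₃ := by exact_mod_cast hC₃
  set B : ℝ := C₃ * C₂ ^ 2 with hB
  have hB1 : 1 ≤ B := by nlinarith
  refine ⟨C₁ * C₂ ^ 2 * B, by positivity, fun Z hZ W hW => ?_⟩
  have hW0 : 0 < W := by linarith
  refine (h₁ W hW (B * Z) (by nlinarith) _ ?_).trans ?_
  · intro u hu huY
    set Y := ⌈2 * Z ^ 64 * (a + a⁻¹)⌉₊
    refine le_of_pow_le_pow_left₀ (n := 128) (by norm_num) (by positivity) ?_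
    have h4 : ((u.natAbs.divisors.card : ℝ)) ^ 128 ≤ C₃ * u.natAbs := by
      exact_mod_cast h₃ u.natAbs (by simpa using hu)
    have h5 : (u.natAbs : ℝ) ≤ (Y : ℝ) ^ 2 := by
      rw [Int.abs_eq_natAbs] at huY; exact_mod_cast huY
    have h6 : (Y : ℝ) ^ 2 ≤ (C₂ * Z ^ 64) ^ 2 := by
      have := h₂ Z hZ
      gcongr; linarith
    calc _ ≤ C₃ * (C₂ * Z ^ 64) ^ 2 := h4.trans (by gcongr; linarith)
      _ = B * Z ^ 128 := by rw [hB]; ring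
      _ ≤ B ^ 128 * Z ^ 128 := by gcongr; exact le_self_pow₀ hB1 (by norm_num)
      _ = _ := by ring
  · have := h₂ Z hZ
    calc _ ≤ C₁ * (C₂ * Z ^ 64) ^ 2 * (B * Z) / W := by gcongr
      _ = _ := by ring

/-- The number of distinct norms `|ξ|² ≤ Z ^ 128` is `≫ Z ^ 127`. -/
theorem exists_le_card_norms {a : ℝ} (ha : 0 < a) : ∃ c : ℝ, 0 < c ∧ ∀ Z : ℝ, 1 ≤ Z →
    ∃ s : Finset ℝ, (∀ n ∈ s, n ≤ Z ^ 128 ∧ ∃ k, normSq a k = n) ∧ c * Z ^ 127 ≤ s.card := by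
  classical
  obtain ⟨C, hC, hE⟩ := exists_energy_scaledBox_le ha
  have ha' : 0 < a⁻¹ := inv_pos.mpr ha
  set c₀ := (a + a⁻¹)⁻¹ with hc₀
  have hc₀pos : 0 < c₀ := by positivity
  refine ⟨c₀ ^ 4 / C, by positivity, fun Z hZ => ?_⟩
  set F := (scaledBox a Z).filter fun k => normSq a k ≤ Z ^ 128 with hF
  refine ⟨F.image (normSq a), ?_, ?_⟩
  · intro n hn
    obtain ⟨k, hk, rfl⟩ := Finset.mem_image.mp hn
    exact ⟨(Finset.mem_filter.mp hk).2, k, rfl⟩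
  -- A square of lattice points with side about `c₀ Z ^ 64` fits in the disc of radius `Z ^ 64`.
  have hFcard : c₀ ^ 2 * Z ^ 128 ≤ F.card := by
    set P := ⌊c₀ * Z ^ 64⌋₊ with hP
    have hPle : (P : ℝ) ≤ c₀ * Z ^ 64 := Nat.floor_le (by positivity)
    have hPge : c₀ * Z ^ 64 ≤ P + 1 := (Nat.lt_floor_add_one _).le
    have hsub : ((Finset.range (P + 1) ×ˢ Finset.range (P + 1)).image
        fun p : ℕ × ℕ => ((p.1 : ℤ), (p.2 : ℤ))) ⊆ F := by
      intro k hk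
      obtain ⟨p, hp, rfl⟩ := Finset.mem_image.mp hk
      rw [Finset.mem_product, Finset.mem_range, Finset.mem_range] at hp
      have h1 : (p.1 : ℝ) ≤ P := by exact_mod_cast Nat.lt_succ_iff.mp hp.1
      have h2 : (p.2 : ℝ) ≤ P := by exact_mod_cast Nat.lt_succ_iff.mp hp.2
      have hk : normSq a ((p.1 : ℤ), (p.2 : ℤ)) ≤ Z ^ 128 := by
        simp only [normSq, Int.cast_natCast, div_eq_mul_inv]
        calc ((p.1 : ℝ) * a) ^ 2 + (p.2 * a⁻¹) ^ 2 ≤ (P * a) ^ 2 + (P * a⁻¹) ^ 2 := by gcongr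
          _ ≤ (P * (a + a⁻¹)) ^ 2 := by
            have : 0 ≤ (P : ℝ) ^ 2 * (a * a⁻¹) := by positivity
            nlinarith
          _ ≤ (c₀ * Z ^ 64 * (a + a⁻¹)) ^ 2 := by gcongr
          _ = (c₀ * (a + a⁻¹)) ^ 2 * Z ^ 128 := by ring
          _ = _ := by rw [hc₀, inv_mul_cancel₀ (by positivity)]; ring
      refine Finset.mem_filter.mpr ⟨mem_scaledBox ha hZ ?_, hk⟩
      have : 0 ≤ Z ^ 128 := by positivity
      linarith
    have hcard := Finset.card_le_card hsub
    rw [Finset.card_image_of_injective _ (by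
      intro p q h
      simp only [Prod.mk.injEq, Nat.cast_inj] at h
      exact Prod.ext h.1 h.2), Finset.card_product, Finset.card_range] at hcard
    have hcard' : ((P : ℝ) + 1) * (P + 1) ≤ F.card := by exact_mod_cast hcard
    calc c₀ ^ 2 * Z ^ 128 = (c₀ * Z ^ 64) * (c₀ * Z ^ 64) := by ring
      _ ≤ ((P : ℝ) + 1) * (P + 1) := by gcongr
      _ ≤ _ := hcard'
  -- Cauchy–Schwarz over the fibres of `normSq a`. The sum of squared fibre sizes counts pairs of
  -- equal norm, and each such pair contributes exactly `1` to the energy with `W = 1`.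
  have hCS : (F.card : ℝ) ^ 2 ≤ (F.image (normSq a)).card * (C * Z ^ 129) := by
    have h1 : (F.card : ℝ) = ∑ n ∈ F.image (normSq a),
        ((F.filter fun l => normSq a l = n).card : ℝ) := by
      exact_mod_cast Finset.card_eq_sum_card_image (normSq a) F
    rw [h1]
    refine sq_sum_le_card_mul_sum_sq.trans ?_
    refine mul_le_mul_of_nonneg_left ?_ (by positivity)
    have h2 := Finset.sum_comp (s := F)
      (fun n => ((F.filter fun l => normSq a l = n).card : ℝ)) (normSq a)
    simp only [nsmul_eq_mul] at h2
    simp only [sq]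
    rw [← h2]
    calc _ ≤ ∑ k ∈ F, ∑ l ∈ F, (((1 : ℝ) ^ 2) ^ 2 + (normSq a k - normSq a l) ^ 2)⁻¹ := by
          refine Finset.sum_le_sum fun k _ => ?_
          rw [Finset.card_filter]
          push_cast
          refine Finset.sum_le_sum fun l _ => ?_
          split_ifs with h
          · rw [h]; norm_num
          · positivity
      _ ≤ ∑ k ∈ scaledBox a Z, ∑ l ∈ scaledBox a Z,
          (((1 : ℝ) ^ 2) ^ 2 + (normSq a k - normSq a l) ^ 2)⁻¹ := by
          refine (Finset.sum_le_sum_of_subset_of_nonneg (Finset.filter_subset _ _)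
            fun _ _ _ => Finset.sum_nonneg fun _ _ => by positivity).trans ?_
          refine Finset.sum_le_sum fun k _ => ?_
          exact Finset.sum_le_sum_of_subset_of_nonneg (Finset.filter_subset _ _)
            fun _ _ _ => by positivity
      _ ≤ _ := by simpa using hE Z hZ 1 le_rfl
  have hZ0 : 0 < Z := by linarith
  have h3 : (c₀ ^ 2 * Z ^ 128) ^ 2 ≤ (F.image (normSq a)).card * (C * Z ^ 129) :=
    le_trans (by gcongr) hCS
  rw [div_mul_eq_mul_div, div_le_iff₀ hC]
  refine le_of_mul_le_mul_right (a := Z ^ 129) ?_ (by positivity)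
  calc _ = (c₀ ^ 2 * Z ^ 128) ^ 2 := by ring
    _ ≤ _ := h3
    _ = _ := by ring

/-! ### Summability over the lattice -/

/-- Each factor of `(1 + |ξ|²)^(3/4) (1 + |ξ|²)^(3/4)` is bounded below using one coordinate alone,
so the sum is dominated by a product of two convergent one-dimensional sums. -/
theorem summable_one_add_normSq_rpow {a : ℝ} (ha : 0 < a) :
    Summable fun k : ℤ × ℤ => ((1 + normSq a k) ^ (3 / 2 : ℝ))⁻¹ := by
  have h1 := summable_int_inv_one_add_sq_rpow ha
  have h2 := summable_int_inv_one_add_sq_rpow (inv_pos.mpr ha)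
  have h := h1.mul_of_nonneg h2 (fun _ => by positivity) (fun _ => by positivity)
  refine Summable.of_nonneg_of_le (fun k => ?_) (fun k => ?_) h
  · have := normSq_nonneg a k
    positivity
  rw [← mul_inv]
  refine inv_anti₀ (by positivity) ?_
  have e : (1 + normSq a k) ^ (3 / 2 : ℝ) =
      (1 + normSq a k) ^ (3 / 4 : ℝ) * (1 + normSq a k) ^ (3 / 4 : ℝ) := by
    rw [← Real.rpow_add (by have := normSq_nonneg a k; positivity)]; norm_num
  rw [e]
  have e1 : 1 + (a * k.1) ^ 2 ≤ 1 + normSq a k := by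
    unfold normSq; nlinarith [sq_nonneg ((k.2 : ℝ) / a)]
  have e2 : 1 + (a⁻¹ * k.2) ^ 2 ≤ 1 + normSq a k := by
    unfold normSq; rw [div_eq_mul_inv]; nlinarith [sq_nonneg ((k.1 : ℝ) * a)]
  have := normSq_nonneg a k
  gcongr

theorem summable_inv_one_add_normSq_sq {a : ℝ} (ha : 0 < a) :
    Summable fun k : ℤ × ℤ => ((1 + normSq a k) ^ 2)⁻¹ := by
  refine Summable.of_nonneg_of_le (fun k => by positivity) (fun k => ?_)
    (summable_one_add_normSq_rpow ha)
  have := normSq_nonneg a k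
  refine inv_anti₀ (by positivity) ?_
  rw [← Real.rpow_natCast]
  exact Real.rpow_le_rpow_of_exponent_le (by linarith) (by norm_num)

theorem eventually_le_normSq {a : ℝ} (ha : 0 < a) (R : ℝ) :
    ∀ᶠ k in cofinite, R < normSq a k := by
  have := (finite_normSq_le ha R).eventually_cofinite_notMem
  filter_upwards [this] with k hk
  simpa using hk

theorem summable_inv_normSq_sub_sq {a : ℝ} (ha : 0 < a) (t : ℝ) :
    Summable fun k : ℤ × ℤ => ((normSq a k - t) ^ 2)⁻¹ := by
  refine Summable.of_norm_bounded_eventually ((summable_inv_one_add_normSq_sq ha).mul_left 16) ?_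
  filter_upwards [eventually_le_normSq ha (2 * |t| + 1)] with k hk
  have h1 := le_abs_self t
  have h2 := abs_nonneg t
  rw [Real.norm_of_nonneg (by positivity), ← div_eq_mul_inv, inv_eq_one_div,
    div_le_div_iff₀ (by nlinarith) (by nlinarith)]
  nlinarith

theorem summable_kernel {a : ℝ} (ha : 0 < a) {L : ℝ} (hL : L ≠ 0) (t : ℝ) :
    Summable fun k : ℤ × ℤ => (L ^ 2 + (normSq a k - t) ^ 2)⁻¹ := by
  refine Summable.of_norm_bounded_eventually (summable_inv_normSq_sub_sq ha t) ?_
  filter_upwards [eventually_le_normSq ha t] with k hk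
  rw [Real.norm_of_nonneg (by positivity)]
  have : 0 < (normSq a k - t) ^ 2 := by nlinarith
  exact inv_anti₀ this (by nlinarith [sq_nonneg L])

/-! ### Sets interlacing with the norms -/

/-- `Λ` avoids the norms `|ξ|²`, has at most one element in each gap between consecutive norms, and
at least one. -/
structure Interlaces (a : ℝ) (Λ : Set ℝ) : Prop where
  normSq_ne : ∀ t ∈ Λ, ∀ k, normSq a k ≠ t
  exists_normSq_between : ∀ t ∈ Λ, ∀ t' ∈ Λ, t < t' → ∃ k, t < normSq a k ∧ normSq a k < t'
  exists_mem_between : ∀ k l, normSq a k < normSq a l → ∃ t ∈ Λ, normSq a k < t ∧ t < normSq a l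

/-- A lattice point with the largest norm below `t`. -/
noncomputable def lowerPoint (a t : ℝ) : ℤ × ℤ :=
  Classical.epsilon fun k => normSq a k < t ∧ ∀ l, normSq a l < t → normSq a l ≤ normSq a k

theorem lowerPoint_spec {a : ℝ} (ha : 0 < a) {t : ℝ} (ht : 0 < t) :
    normSq a (lowerPoint a t) < t ∧
      ∀ l, normSq a l < t → normSq a l ≤ normSq a (lowerPoint a t) := by
  have hfin : {k | normSq a k < t}.Finite :=
    (finite_normSq_le ha t).subset fun k (hk : normSq a k < t) => hk.le
  obtain ⟨k, hk, hmax⟩ := Set.exists_max_image _ (normSq a) hfin ⟨0, by simpa using ht⟩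
  exact Classical.epsilon_spec (p := fun k => normSq a k < t ∧
    ∀ l, normSq a l < t → normSq a l ≤ normSq a k) ⟨k, hk, hmax⟩

namespace Interlaces

variable {a : ℝ} {Λ : Set ℝ}

/-- Two elements of `Λ` are separated by a norm, which lies above the lower point of the smaller one
and is at most that of the larger one. This turns counts and sums over `Λ` into counts and sums over
lattice points. -/
theorem injOn_lowerPoint (hΛ : Interlaces a Λ) (ha : 0 < a) :
    Set.InjOn (lowerPoint a) {t | t ∈ Λ ∧ 0 < t} := by
  have key : ∀ t ∈ {t | t ∈ Λ ∧ 0 < t}, ∀ t' ∈ {t | t ∈ Λ ∧ 0 < t}, t < t' →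
      lowerPoint a t ≠ lowerPoint a t' := by
    rintro t ⟨ht, ht0⟩ t' ⟨ht', ht0'⟩ hlt heq
    obtain ⟨k, hk, hk'⟩ := hΛ.exists_normSq_between t ht t' ht' hlt
    have h1 := (lowerPoint_spec ha ht0').2 k hk'
    have h2 := (lowerPoint_spec ha ht0).1
    rw [heq] at h2
    linarith
  intro t ht t' ht' heq
  rcases lt_trichotomy t t' with h | h | h
  · exact absurd heq (key t ht t' ht' h)
  · exact h
  · exact absurd heq.symm (key t' ht' t ht h)

theorem subsingleton_nonpos (hΛ : Interlaces a Λ) : {t | t ∈ Λ ∧ t ≤ 0}.Subsingleton := by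
  have key : ∀ t ∈ {t | t ∈ Λ ∧ t ≤ 0}, ∀ t' ∈ {t | t ∈ Λ ∧ t ≤ 0}, ¬ t < t' := by
    rintro t ⟨ht, ht0⟩ t' ⟨ht', ht0'⟩ hlt
    obtain ⟨k, hk, hk'⟩ := hΛ.exists_normSq_between t ht t' ht' hlt
    have := normSq_nonneg a k
    linarith
  intro t ht t' ht'
  exact le_antisymm (not_lt.mp (key t' ht' t ht)) (not_lt.mp (key t ht t' ht'))

theorem finite_inter_Iic (hΛ : Interlaces a Λ) (ha : 0 < a) (X : ℝ) : (Λ ∩ Set.Iic X).Finite := by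
  have h1 : {t | t ∈ Λ ∧ 0 < t ∧ t ≤ X}.Finite := by
    refine Set.Finite.of_finite_image ((finite_normSq_le ha X).subset ?_)
      (fun t ht t' ht' h => hΛ.injOn_lowerPoint ha ⟨ht.1, ht.2.1⟩ ⟨ht'.1, ht'.2.1⟩ h)
    rintro _ ⟨t, ht, rfl⟩
    exact ((lowerPoint_spec ha ht.2.1).1.le).trans ht.2.2
  refine (hΛ.subsingleton_nonpos.finite.union h1).subset ?_
  rintro t ⟨ht, htX⟩
  rcases le_or_gt t 0 with h | h
  · exact Or.inl ⟨ht, h⟩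
  · exact Or.inr ⟨ht, h, htX⟩

/-- Bounds `Λ` from below by the number of norms. The loss of one is genuine, since finitely many
norms bound one gap fewer than their number. -/
theorem exists_finset_of_norms (hΛ : Interlaces a Λ) (s : Finset ℝ)
    (hs : ∀ n ∈ s, ∃ k, normSq a k = n) :
    ∃ T : Finset ℝ, (∀ t ∈ T, t ∈ Λ ∧ ∃ n ∈ s, t < n) ∧ s.card ≤ T.card + 1 := by
  classical
  induction s using Finset.induction_on_max with
  | empty => exact ⟨∅, by simp, by simp⟩
  | insert y s hy ih =>
    obtain ⟨T, hT, hcard⟩ := ih fun n hn => hs n (Finset.mem_insert_of_mem hn)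
    have hys : y ∉ s := fun h => lt_irrefl _ (hy y h)
    rcases s.eq_empty_or_nonempty with rfl | hne
    · exact ⟨∅, by simp, by simp⟩
    obtain ⟨k, hk⟩ := hs (s.max' hne) (Finset.mem_insert_of_mem (s.max'_mem hne))
    obtain ⟨l, hl⟩ := hs y (Finset.mem_insert_self _ _)
    obtain ⟨t, htΛ, h1, h2⟩ := hΛ.exists_mem_between k l (by
      rw [hk, hl]; exact hy _ (s.max'_mem hne))
    rw [hk] at h1
    rw [hl] at h2
    have htT : t ∉ T := by
      intro h
      obtain ⟨-, n, hn, htn⟩ := hT t h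
      have := s.le_max' n hn
      linarith
    refine ⟨insert t T, ?_, ?_⟩
    · intro u hu
      rcases Finset.mem_insert.mp hu with rfl | hu
      · exact ⟨htΛ, y, Finset.mem_insert_self _ _, h2⟩
      · obtain ⟨h3, n, hn, h4⟩ := hT u hu
        exact ⟨h3, n, Finset.mem_insert_of_mem hn, h4⟩
    · rw [Finset.card_insert_of_notMem hys, Finset.card_insert_of_notMem htT]
      omega

/-- If `t < t'` both qualify, a norm separates them, so the lower norm of `t'` exceeds `t` and `t' -
t > H`. Thus the integers `⌊t / H⌋` are distinct. -/
theorem card_far_le (hΛ : Interlaces a Λ) (ha : 0 < a) {X H : ℝ} (hX : 0 ≤ X) (hH : 0 < H)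
    (G : Finset ℝ)
    (hG : ∀ t ∈ G, t ∈ Λ ∧ 0 < t ∧ t ≤ X ∧ H < t - normSq a (lowerPoint a t)) :
    (G.card : ℝ) ≤ X / H + 1 := by
  have hsep : ∀ t ∈ G, ∀ t' ∈ G, t < t' → H < t' - t := by
    intro t ht t' ht' hlt
    obtain ⟨k, hk, hk'⟩ := hΛ.exists_normSq_between t (hG t ht).1 t' (hG t' ht').1 hlt
    have h1 := (lowerPoint_spec ha (hG t' ht').2.1).2 k hk'
    have h2 := (hG t' ht').2.2.2
    linarith
  have hne : ∀ t ∈ G, ∀ t' ∈ G, t < t' → ⌊t / H⌋₊ ≠ ⌊t' / H⌋₊ := by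
    intro t ht t' ht' hlt heq
    have h1 := hsep t ht t' ht' hlt
    have h2 := Nat.floor_le (a := t / H) (div_nonneg (hG t ht).2.1.le hH.le)
    have h3 := Nat.lt_floor_add_one (t' / H)
    rw [heq] at h2
    have h4 : t' / H < t / H + 1 := by linarith
    rw [div_lt_iff₀ hH, add_mul, div_mul_cancel₀ _ hH.ne'] at h4
    linarith
  have hcard : G.card ≤ (Finset.range (⌊X / H⌋₊ + 1)).card := by
    refine Finset.card_le_card_of_injOn (fun t => ⌊t / H⌋₊) ?_ ?_
    · intro t ht
      simp only [Finset.coe_range, Set.mem_Iio, Nat.lt_succ_iff]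
      refine Nat.floor_le_floor ?_
      have := (hG t ht).2.2.1
      gcongr
    · intro t ht t' ht' heq
      rcases lt_trichotomy t t' with h | h | h
      · exact absurd heq (hne t ht t' ht' h)
      · exact h
      · exact absurd heq.symm (hne t' ht' t ht h)
  rw [Finset.card_range] at hcard
  have h1 : (G.card : ℝ) ≤ ⌊X / H⌋₊ + 1 := by exact_mod_cast hcard
  have := Nat.floor_le (a := X / H) (by positivity)
  linarith

end Interlaces

/-- `∑_ξ (L² + (|ξ|² - t)²)⁻¹`. -/
noncomputable def latticeKernelSum (a L t : ℝ) : ℝ := ∑' k, (L ^ 2 + (normSq a k - t) ^ 2)⁻¹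

/-- Outside the box `|ξ|² > 4 Z ^ 128 ≥ 4 t`, so the kernel is `O((1 + |ξ|²)⁻²)`. Half a power of `1
+ |ξ|²` is exchanged for `Z ^ 64` and the remaining exponent `3/2` is still summable. -/
theorem exists_latticeKernelSum_le {a : ℝ} (ha : 0 < a) :
    ∃ C : ℝ, 0 < C ∧ ∀ Z : ℝ, 1 ≤ Z → ∀ L t : ℝ, L ≠ 0 → t ≤ Z ^ 128 →
      latticeKernelSum a L t ≤
        ∑ k ∈ scaledBox a Z, (L ^ 2 + (normSq a k - t) ^ 2)⁻¹ + C * (Z ^ 64)⁻¹ := by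
  classical
  have hw := summable_one_add_normSq_rpow ha
  set w : ℤ × ℤ → ℝ := fun k => ((1 + normSq a k) ^ (3 / 2 : ℝ))⁻¹ with hwdef
  have hw0 : ∀ k, 0 ≤ w k := fun k => by
    have := normSq_nonneg a k
    positivity
  refine ⟨8 * ∑' k, w k + 1, by have : 0 ≤ ∑' k, w k := tsum_nonneg hw0; linarith, ?_⟩
  intro Z hZ L t hL htX
  have hZ0 : 0 < Z := by linarith
  set f : ℤ × ℤ → ℝ := fun k => (L ^ 2 + (normSq a k - t) ^ 2)⁻¹
  have hf0 : ∀ k, 0 ≤ f k := fun k => by positivity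
  have hS : HasSum (fun k => if k ∈ scaledBox a Z then f k else 0) (∑ k ∈ scaledBox a Z, f k) := by
    have : HasSum (fun k => if k ∈ scaledBox a Z then f k else 0)
        (∑ k ∈ scaledBox a Z, if k ∈ scaledBox a Z then f k else 0) :=
      hasSum_sum_of_ne_finset_zero (fun k hk => by simp [hk])
    rwa [Finset.sum_congr rfl (fun k hk => by rw [if_pos hk])] at this
  have hpt : ∀ k, f k ≤ (if k ∈ scaledBox a Z then f k else 0) + 8 * (Z ^ 64)⁻¹ * w k := by
    intro k
    split_ifs with hk
    · have := mul_nonneg (by positivity : 0 ≤ 8 * (Z ^ 64)⁻¹) (hw0 k)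
      linarith
    · have hbig : 4 * Z ^ 128 < normSq a k := by
        by_contra h
        exact hk (mem_scaledBox ha hZ (not_lt.mp h))
      have hZ1 : 1 ≤ Z ^ 128 := one_le_pow₀ hZ
      set n := normSq a k
      have hn : 0 < 1 + n := by linarith
      have h1 : (1 + n) ^ 2 ≤ 8 * (L ^ 2 + (n - t) ^ 2) := by
        have : (3 / 4) * n ≤ n - t := by linarith
        nlinarith [sq_nonneg L]
      have h2 : (1 + n) ^ 2 = (1 + n) ^ (1 / 2 : ℝ) * (1 + n) ^ (3 / 2 : ℝ) := by
        rw [← Real.rpow_natCast, ← Real.rpow_add hn]; norm_num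
      have h3 : Z ^ 64 ≤ (1 + n) ^ (1 / 2 : ℝ) := by
        calc Z ^ 64 = (Z ^ 128) ^ (1 / 2 : ℝ) := by
              rw [← Real.rpow_natCast, ← Real.rpow_natCast, ← Real.rpow_mul hZ0.le]; norm_num
          _ ≤ _ := Real.rpow_le_rpow (by positivity) (by linarith) (by norm_num)
      have h4 : Z ^ 64 * (1 + n) ^ (3 / 2 : ℝ) ≤ 8 * (L ^ 2 + (n - t) ^ 2) := by
        refine le_trans ?_ h1
        rw [h2]
        gcongr
      rw [zero_add, mul_assoc, ← mul_inv, ← div_eq_mul_inv]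
      simp only [f]
      rw [inv_eq_one_div, div_le_div_iff₀ (by positivity) (by positivity)]
      linarith
  have hle := (summable_kernel ha hL t).tsum_le_tsum hpt (hS.summable.add (hw.mul_left _))
  rw [hS.summable.tsum_add (hw.mul_left _), hS.tsum_eq, tsum_mul_left] at hle
  have hp : 0 < (Z ^ 64)⁻¹ := by positivity
  unfold latticeKernelSum
  refine hle.trans ?_
  nlinarith

/-- Mean value of `T`. Moving `t` to its lower norm, at distance at most `Z ^ 2 ≤ L`, costs a factor
`3`; by injectivity the sum over `t` is then at most the energy with `W = Z ^ 10`, which is `O(Z ^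
129 / Z ^ 10)`. The tails contribute only `O(Z ^ 128 / Z ^ 64)`. -/
theorem Interlaces.exists_sum_latticeKernelSum_le {a : ℝ} (ha : 0 < a) :
    ∃ C : ℝ, 0 < C ∧ ∀ Λ : Set ℝ, Interlaces a Λ → ∀ Z : ℝ, 1 ≤ Z → ∀ G : Finset ℝ,
      (∀ t ∈ G, t ∈ Λ ∧ 0 < t ∧ t ≤ Z ^ 128 ∧ t - normSq a (lowerPoint a t) ≤ Z ^ 2) →
      ∑ t ∈ G, latticeKernelSum a (Z ^ 20) t ≤ C * Z ^ 119 := by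
  classical
  obtain ⟨C₁, hC₁, h₁⟩ := exists_latticeKernelSum_le ha
  obtain ⟨C₂, hC₂, h₂⟩ := exists_energy_scaledBox_le ha
  obtain ⟨C₃, hC₃, h₃⟩ := exists_card_scaledBox_le ha
  refine ⟨3 * C₂ + C₃ * C₁, by positivity, ?_⟩
  intro Λ hΛ Z hZ G hG
  have hZ0 : 0 < Z := by linarith
  have hinj : Set.InjOn (lowerPoint a) G :=
    fun t ht t' ht' h => hΛ.injOn_lowerPoint ha ⟨(hG t ht).1, (hG t ht).2.1⟩
      ⟨(hG t' ht').1, (hG t' ht').2.1⟩ h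
  have himg : G.image (lowerPoint a) ⊆ scaledBox a Z := by
    intro k hk
    obtain ⟨t, ht, rfl⟩ := Finset.mem_image.mp hk
    obtain ⟨-, h0, hX, -⟩ := hG t ht
    refine mem_scaledBox ha hZ ?_
    have := (lowerPoint_spec ha h0).1
    have : 0 < Z ^ 128 := by positivity
    linarith
  have hcard : (G.card : ℝ) ≤ C₃ * Z ^ 128 := by
    rw [← Finset.card_image_of_injOn hinj]
    exact (Nat.cast_le.mpr (Finset.card_le_card himg)).trans (h₃ Z hZ)
  have hpt : ∀ t ∈ G, latticeKernelSum a (Z ^ 20) t ≤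
      3 * ∑ k ∈ scaledBox a Z,
        (((Z ^ 10) ^ 2) ^ 2 + (normSq a (lowerPoint a t) - normSq a k) ^ 2)⁻¹ +
        C₁ * (Z ^ 64)⁻¹ := by
    intro t ht
    obtain ⟨-, h0, hX, hH⟩ := hG t ht
    refine (h₁ Z hZ (Z ^ 20) t (by positivity) hX).trans ?_
    refine add_le_add_left ?_ _
    rw [Finset.mul_sum]
    refine Finset.sum_le_sum fun k _ => ?_
    have h4 := (lowerPoint_spec ha h0).1
    have e : ((Z ^ 10) ^ 2) ^ 2 = (Z ^ 20) ^ 2 := by ring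
    have h5 : (t - normSq a (lowerPoint a t)) ^ 2 ≤ (Z ^ 20) ^ 2 := by
      have : Z ^ 2 ≤ Z ^ 20 := pow_le_pow_right₀ hZ (by norm_num)
      exact pow_le_pow_left₀ (by linarith) (by linarith) 2
    -- With `n₀` the lower norm, `(n₀ - n)² ≤ 2 (n₀ - t)² + 2 (n - t)² ≤ 2 L² + 2 (n - t)²`, whence
    -- the factor `3`.
    rw [e, ← div_eq_mul_inv, inv_eq_one_div, div_le_div_iff₀ (by positivity) (by positivity)]
    nlinarith [sq_nonneg (normSq a k - t - (t - normSq a (lowerPoint a t)))]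
  calc _ ≤ ∑ t ∈ G, (3 * ∑ k ∈ scaledBox a Z,
        (((Z ^ 10) ^ 2) ^ 2 + (normSq a (lowerPoint a t) - normSq a k) ^ 2)⁻¹ +
        C₁ * (Z ^ 64)⁻¹) := Finset.sum_le_sum hpt
    _ = 3 * ∑ l ∈ G.image (lowerPoint a), ∑ k ∈ scaledBox a Z,
        (((Z ^ 10) ^ 2) ^ 2 + (normSq a l - normSq a k) ^ 2)⁻¹ + G.card * (C₁ * (Z ^ 64)⁻¹) := by
      rw [Finset.sum_add_distrib, Finset.sum_const, nsmul_eq_mul, ← Finset.mul_sum,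
        Finset.sum_image hinj]
    _ ≤ 3 * ∑ l ∈ scaledBox a Z, ∑ k ∈ scaledBox a Z,
        (((Z ^ 10) ^ 2) ^ 2 + (normSq a l - normSq a k) ^ 2)⁻¹ +
        C₃ * Z ^ 128 * (C₁ * (Z ^ 64)⁻¹) := by
      gcongr
    _ ≤ 3 * (C₂ * Z ^ 129 / Z ^ 10) + C₃ * Z ^ 128 * (C₁ * (Z ^ 64)⁻¹) := by
      have := h₂ Z hZ (Z ^ 10) (one_le_pow₀ hZ)
      gcongr
    _ = 3 * C₂ * Z ^ 119 + C₃ * C₁ * Z ^ 64 := by field_simp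
    _ ≤ 3 * C₂ * Z ^ 119 + C₃ * C₁ * Z ^ 119 := by
      have : Z ^ 64 ≤ Z ^ 119 := pow_le_pow_right₀ hZ (by norm_num)
      gcongr
    _ = _ := by ring

/-! ### Lattice points in strips -/

theorem card_int_le {c R σ : ℝ} (hc : 0 < c) (hR : 0 ≤ R) (s : Finset ℤ)
    (hs : ∀ m ∈ s, |c * m + σ| ≤ R) : (s.card : ℝ) ≤ 2 * R / c + 1 := by
  have hsub : s ⊆ Finset.Icc ⌈(-R - σ) / c⌉ ⌊(R - σ) / c⌋ := by
    intro m hm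
    have := abs_le.mp (hs m hm)
    rw [Finset.mem_Icc, Int.ceil_le, Int.le_floor, div_le_iff₀ hc, le_div_iff₀ hc]
    constructor <;> nlinarith
  have h1 := Finset.card_le_card hsub
  rw [Int.card_Icc] at h1
  have h2 : (s.card : ℤ) ≤ max (⌊(R - σ) / c⌋ + 1 - ⌈(-R - σ) / c⌉) 0 := by
    rw [← Int.ofNat_toNat]; exact_mod_cast h1
  have h3 : (s.card : ℝ) ≤ max ((⌊(R - σ) / c⌋ : ℝ) + 1 - ⌈(-R - σ) / c⌉) 0 := by exact_mod_cast h2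
  refine h3.trans (max_le ?_ (by positivity))
  have h4 := Int.floor_le ((R - σ) / c)
  have h5 := Int.le_ceil ((-R - σ) / c)
  have h6 : (R - σ) / c - (-R - σ) / c = 2 * R / c := by field_simp; ring
  linarith

/-- For a fixed second coordinate, the first one ranges over integers in an interval of length `2 R
/ (c |p|) ≤ 2 R / c`. -/
theorem card_strip_le_of_ne {c d R : ℝ} (hc : 0 < c) (hR : 0 ≤ R) {p q : ℤ} (hp : p ≠ 0) {Y : ℕ}
    (s : Finset (ℤ × ℤ)) (hsY : s ⊆ box Y)
    (hs : ∀ k ∈ s, |c * (k.1 * p) + d * (k.2 * q)| ≤ R) :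
    (s.card : ℝ) ≤ (2 * R / c + 1) * (2 * (Y + 1)) := by
  classical
  have hp1 : (1 : ℝ) ≤ |(p : ℝ)| := by exact_mod_cast Int.one_le_abs hp
  have hfib : ∀ n ∈ Finset.Icc (-(Y : ℤ)) Y,
      (s.filter fun k => k.2 = n).card ≤ ⌊2 * R / c + 1⌋₊ := by
    intro n _
    refine Nat.le_floor ?_
    have hinj : Set.InjOn Prod.fst ((s.filter fun k => k.2 = n : Finset (ℤ × ℤ)) : Set (ℤ × ℤ)) := by
      intro k hk l hl h
      have h1 := (Finset.mem_filter.mp hk).2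
      have h2 := (Finset.mem_filter.mp hl).2
      exact Prod.ext h (h1.trans h2.symm)
    rw [← Finset.card_image_of_injOn hinj]
    -- Multiplying the linear form by the sign of `p` makes its leading coefficient `c |p|`
    -- positive.
    refine (card_int_le (c := c * |(p : ℝ)|) (R := R)
      (σ := SignType.sign (p : ℝ) * (d * (n * q))) (by positivity) hR _ ?_).trans ?_
    · intro m hm
      obtain ⟨k, hk, rfl⟩ := Finset.mem_image.mp hm
      obtain ⟨hks, rfl⟩ := Finset.mem_filter.mp hk
      have h1 := hs k hks
      rcases lt_or_gt_of_ne hp with h | h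
      · have h' : (p : ℝ) < 0 := by exact_mod_cast h
        rw [abs_of_neg h', sign_neg h', ← abs_neg]
        refine le_trans (le_of_eq ?_) h1
        congr 1
        simp only [SignType.coe_neg_one]
        ring
      · have h' : (0 : ℝ) < p := by exact_mod_cast h
        rw [abs_of_pos h', sign_pos h']
        refine le_trans (le_of_eq ?_) h1
        congr 1
        simp only [SignType.coe_one]
        ring
    · gcongr
      nlinarith
  have h1 := Finset.card_le_mul_card_image_of_maps_to (f := Prod.snd) (s := s)
    (t := Finset.Icc (-(Y : ℤ)) Y) (fun k hk => (Finset.mem_product.mp (hsY hk)).2) _ hfib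
  have h2 : (Finset.Icc (-(Y : ℤ)) Y).card ≤ 2 * (Y + 1) := by rw [Int.card_Icc]; omega
  have h3 : s.card ≤ ⌊2 * R / c + 1⌋₊ * (2 * (Y + 1)) := h1.trans (Nat.mul_le_mul_left _ h2)
  calc (s.card : ℝ) ≤ ⌊2 * R / c + 1⌋₊ * (2 * (Y + 1)) := by exact_mod_cast h3
    _ ≤ _ := by
      gcongr
      exact Nat.floor_le (by positivity)

/-- Some coordinate of `ζ` is nonzero; if it is only the second, the two coordinates are exchanged.
-/
theorem exists_card_strip_le {a : ℝ} (ha : 0 < a) :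
    ∃ C : ℝ, 0 < C ∧ ∀ R : ℝ, 1 ≤ R → ∀ ζ : ℤ × ℤ, ζ ≠ 0 → ∀ (Y : ℕ) (s : Finset (ℤ × ℤ)),
      s ⊆ box Y → (∀ k ∈ s, |a ^ 2 * (k.1 * ζ.1) + (a ^ 2)⁻¹ * (k.2 * ζ.2)| ≤ R) →
      (s.card : ℝ) ≤ C * (Y + 1) * R := by
  classical
  refine ⟨(2 / a ^ 2 + 2 / (a ^ 2)⁻¹ + 1) * 2, by positivity, ?_⟩
  intro R hR ζ hζ Y s hsY hs
  have key : ∀ c : ℝ, 0 < c → 2 / c ≤ 2 / a ^ 2 + 2 / (a ^ 2)⁻¹ →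
      (2 * R / c + 1) * (2 * ((Y : ℝ) + 1)) ≤
      (2 / a ^ 2 + 2 / (a ^ 2)⁻¹ + 1) * 2 * (Y + 1) * R := by
    intro c hc h
    have h1 : 2 * R / c + 1 ≤ (2 / a ^ 2 + 2 / (a ^ 2)⁻¹ + 1) * R := by
      have : 2 * R / c = 2 / c * R := by ring
      rw [this]; nlinarith
    calc _ ≤ (2 / a ^ 2 + 2 / (a ^ 2)⁻¹ + 1) * R * (2 * ((Y : ℝ) + 1)) := by gcongr
      _ = _ := by ring
  by_cases h1 : ζ.1 = 0
  · have h2 : ζ.2 ≠ 0 := fun h => hζ (Prod.ext h1 h)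
    rw [← Finset.card_image_of_injective s Prod.swap_injective]
    refine (card_strip_le_of_ne (c := (a ^ 2)⁻¹) (d := a ^ 2) (R := R) (p := ζ.2) (q := ζ.1)
      (Y := Y) (by positivity) (by linarith) h2 _ ?_ ?_).trans (key _ (by positivity) ?_)
    · intro k hk
      obtain ⟨l, hl, rfl⟩ := Finset.mem_image.mp hk
      have := mem_box.mp (hsY hl)
      exact mem_box.mpr ⟨this.2, this.1⟩
    · intro k hk
      obtain ⟨l, hl, rfl⟩ := Finset.mem_image.mp hk
      simp only [Prod.fst_swap, Prod.snd_swap]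
      rw [add_comm]
      exact hs l hl
    · have : 0 ≤ 2 / a ^ 2 := by positivity
      linarith
  · refine (card_strip_le_of_ne (by positivity) (by linarith) h1 s hsY hs).trans
      (key _ (by positivity) ?_)
    have : 0 ≤ 2 / (a ^ 2)⁻¹ := by positivity
    linarith

/-! ### The exceptional set -/

theorem normSq_add_sub {a : ℝ} (ha : 0 < a) (k ζ : ℤ × ℤ) :
    normSq a (k + ζ) - normSq a k =
      2 * (a ^ 2 * (k.1 * ζ.1) + (a ^ 2)⁻¹ * (k.2 * ζ.2)) + normSq a ζ := by
  simp only [normSq, Prod.fst_add, Prod.snd_add]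
  push_cast
  field_simp
  ring

/-- Both `ξ` and `ξ + ζ` lie in the annulus `||ξ|² - t| ≤ L`, for some `ξ` and some small `ζ`. -/
def IsResonant (a L Z t : ℝ) : Prop :=
  ∃ ζ : ℤ × ℤ, ζ ≠ 0 ∧ normSq a ζ ≤ Z ∧
    ∃ k, |normSq a k - t| ≤ L ∧ |normSq a (k + ζ) - t| ≤ L

/-- A resonance at `t` gives `|2⟨ξ, ζ⟩ + |ζ|²| ≤ 2 L`, so `ξ` lies in a strip orthogonal to `ζ`.
There are `O(Z ^ 2)` shifts `ζ`, `O(Z ^ 64 · L) = O(Z ^ 84)` points `ξ` in each strip, and `O(L²) =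
O(Z ^ 40)` values `t` for each `ξ`, hence `O(Z ^ 126)` in all. -/
theorem Interlaces.exists_card_resonant_le {a : ℝ} (ha : 0 < a) :
    ∃ C : ℝ, 0 < C ∧ ∀ Λ : Set ℝ, Interlaces a Λ → ∀ Z : ℝ, 1 ≤ Z → ∀ G : Finset ℝ,
      (∀ t ∈ G, t ∈ Λ ∧ 0 < t ∧ t ≤ Z ^ 128 ∧ t - normSq a (lowerPoint a t) ≤ Z ^ 2 ∧
        latticeKernelSum a (Z ^ 20) t ≤ 1 ∧ IsResonant a (Z ^ 20) Z t) →
      (G.card : ℝ) ≤ C * Z ^ 126 := by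
  classical
  obtain ⟨C₁, hC₁, h₁⟩ := exists_card_strip_le ha
  obtain ⟨C₂, hC₂, h₂⟩ := exists_side_le ha
  have ha' : 0 < a⁻¹ := inv_pos.mpr ha
  refine ⟨4 * (a + a⁻¹ + 2) ^ 2 * (C₁ * C₂ * 2) * 10, by positivity, ?_⟩
  intro Λ hΛ Z hZ G hG
  have hZ0 : 0 < Z := by linarith
  have hL1 : 1 ≤ Z ^ 20 := one_le_pow₀ hZ
  have hZL : Z ≤ Z ^ 20 := le_self_pow₀ hZ (by norm_num)
  have hZ2L : Z ^ 2 ≤ Z ^ 20 := pow_le_pow_right₀ hZ (by norm_num)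
  have hLX : Z ^ 20 ≤ Z ^ 128 := pow_le_pow_right₀ hZ (by norm_num)
  set L := Z ^ 20 with hL
  set E := (box ⌈Z * (a + a⁻¹)⌉₊).filter fun ζ => ζ ≠ 0 with hE
  let strip : ℤ × ℤ → Finset (ℤ × ℤ) := fun ζ => (scaledBox a Z).filter fun k =>
    |a ^ 2 * (k.1 * ζ.1) + (a ^ 2)⁻¹ * (k.2 * ζ.2)| ≤ 2 * L
  have hcover : G ⊆ E.biUnion fun ζ => (strip ζ).biUnion fun k =>
      G.filter fun t => |normSq a k - t| ≤ L := by
    intro t ht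
    obtain ⟨-, ht0, htX, -, -, ζ, hζ, hζZ, k, hk, hkζ⟩ := hG t ht
    simp only [Finset.mem_biUnion]
    refine ⟨ζ, ?_, k, ?_, Finset.mem_filter.mpr ⟨ht, hk⟩⟩
    · refine Finset.mem_filter.mpr ⟨mem_box_of_normSq_le ha hZ0.le (Nat.le_ceil _) ?_, hζ⟩
      nlinarith
    · have h1 := abs_le.mp hk
      have h2 := abs_le.mp hkζ
      refine Finset.mem_filter.mpr ⟨mem_scaledBox ha hZ (by linarith), ?_⟩
      have h3 := normSq_add_sub ha k ζ
      have h4 := normSq_nonneg a ζ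
      rw [abs_le]
      constructor <;> linarith
  -- All `t` in the cell are within `2 L` of a fixed `t₀`, so their distinct lower points have norms
  -- within `3 L` of `t₀`. Each contributes at least `(L² + 9 L²)⁻¹` to the kernel sum at `t₀`,
  -- which is at most `1`.
  have hcell : ∀ k, (G.filter fun t => |normSq a k - t| ≤ L).card ≤ ⌊10 * L ^ 2⌋₊ := by
    intro k
    refine Nat.le_floor ?_
    rcases (G.filter fun t => |normSq a k - t| ≤ L).eq_empty_or_nonempty with h | ⟨t₀, ht₀⟩
    · rw [h]; simp; positivity
    obtain ⟨ht₀G, ht₀k⟩ := Finset.mem_filter.mp ht₀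
    obtain ⟨-, -, -, -, hT, -⟩ := hG t₀ ht₀G
    set F := G.filter fun t => |normSq a k - t| ≤ L with hF
    have hinj : Set.InjOn (lowerPoint a) F := fun t ht t' ht' h =>
      hΛ.injOn_lowerPoint ha
        ⟨(hG t (Finset.mem_filter.mp ht).1).1, (hG t (Finset.mem_filter.mp ht).1).2.1⟩
        ⟨(hG t' (Finset.mem_filter.mp ht').1).1, (hG t' (Finset.mem_filter.mp ht').1).2.1⟩ h
    have h3 : ∑ l ∈ F.image (lowerPoint a), (10 * L ^ 2)⁻¹ ≤ 1 := by
      refine le_trans ?_ hT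
      refine le_trans (Finset.sum_le_sum fun l hl => ?_)
        ((summable_kernel ha (by positivity : L ≠ 0) t₀).sum_le_tsum _ fun _ _ => by positivity)
      obtain ⟨t, ht, rfl⟩ := Finset.mem_image.mp hl
      obtain ⟨htG, htk⟩ := Finset.mem_filter.mp ht
      obtain ⟨-, h0, -, hH, -⟩ := hG t htG
      have h4 := (lowerPoint_spec ha h0).1
      have h5 := abs_le.mp htk
      have h6 := abs_le.mp ht₀k
      have h7 : (normSq a (lowerPoint a t) - t₀) ^ 2 ≤ (3 * L) ^ 2 :=
        sq_le_sq' (by linarith) (by linarith)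
      exact inv_anti₀ (by positivity) (by nlinarith)
    rw [Finset.sum_const, Finset.card_image_of_injOn hinj, nsmul_eq_mul, ← div_eq_mul_inv,
      div_le_one (by positivity)] at h3
    exact h3
  have hstrip : ∀ ζ ∈ E, (strip ζ).card ≤ ⌊C₁ * C₂ * 2 * Z ^ 84⌋₊ := by
    intro ζ hζ
    refine Nat.le_floor ?_
    have h3 := h₁ (2 * L) (by linarith) ζ (Finset.mem_filter.mp hζ).2 _ (strip ζ)
      (Finset.filter_subset _ _) (fun k hk => (Finset.mem_filter.mp hk).2)
    have h4 := h₂ Z hZ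
    calc _ ≤ _ := h3
      _ ≤ C₁ * (C₂ * Z ^ 64) * (2 * L) := by gcongr
      _ = _ := by rw [hL]; ring
  have hEcard : (E.card : ℝ) ≤ 4 * (a + a⁻¹ + 2) ^ 2 * Z ^ 2 := by
    have h3 : (E.card : ℝ) ≤ (box ⌈Z * (a + a⁻¹)⌉₊).card := by
      exact_mod_cast Finset.card_le_card (Finset.filter_subset _ _)
    have h4 := card_box_le ⌈Z * (a + a⁻¹)⌉₊
    have h5 := Nat.ceil_lt_add_one (a := Z * (a + a⁻¹)) (by positivity)
    calc _ ≤ _ := h3.trans h4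
      _ ≤ 4 * ((a + a⁻¹ + 2) * Z) ^ 2 := by
        gcongr
        nlinarith
      _ = _ := by ring
  have hcard : G.card ≤ E.card * (⌊C₁ * C₂ * 2 * Z ^ 84⌋₊ * ⌊10 * L ^ 2⌋₊) := by
    refine (Finset.card_le_card hcover).trans (Finset.card_biUnion_le_card_mul _ _ _ fun ζ hζ => ?_)
    refine (Finset.card_biUnion_le_card_mul _ _ _ fun k _ => hcell k).trans ?_
    exact Nat.mul_le_mul_right _ (hstrip ζ hζ)
  calc (G.card : ℝ) ≤ E.card * (⌊C₁ * C₂ * 2 * Z ^ 84⌋₊ * ⌊10 * L ^ 2⌋₊) := by exact_mod_cast hcard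
    _ ≤ (4 * (a + a⁻¹ + 2) ^ 2 * Z ^ 2) * ((C₁ * C₂ * 2 * Z ^ 84) * (10 * L ^ 2)) := by
      gcongr
      · exact Nat.floor_le (by positivity)
      · exact Nat.floor_le (by positivity)
    _ = _ := by rw [hL]; ring

theorem summable_shift {f : ℤ × ℤ → ℝ} (hf : Summable f) (ζ : ℤ × ℤ) :
    Summable fun k => f (k + ζ) :=
  (Equiv.addRight ζ).summable_iff.mpr hf

theorem tsum_shift (f : ℤ × ℤ → ℝ) (ζ : ℤ × ℤ) : ∑' k, f (k + ζ) = ∑' k, f k :=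
  (Equiv.addRight ζ).tsum_eq f

/-- Without resonance one of the two factors is outside the annulus, where `(n - t)⁻² ≤ 2 (L² + (n -
t)²)⁻¹`. Applying `x y ≤ θ y² + θ⁻¹ x²` with `x` the outer factor and summing gives at most `2 θ M +
4 θ⁻¹ T`, and `T ≤ θ² M` turns this into `6 θ M`. -/
theorem tsum_mul_shift_le {a : ℝ} (ha : 0 < a) {t L θ : ℝ} (hL : 0 < L) (hθ : 0 < θ)
    {ζ : ℤ × ℤ}
    (hres : ∀ k, |normSq a k - t| ≤ L → ¬ |normSq a (k + ζ) - t| ≤ L)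
    (hT : latticeKernelSum a L t ≤ θ ^ 2 * ∑' k, ((normSq a k - t) ^ 2)⁻¹) :
    ∑' k, |(normSq a k - t)⁻¹ * (normSq a (k + ζ) - t)⁻¹| ≤
      6 * θ * ∑' k, ((normSq a k - t) ^ 2)⁻¹ := by
  have hs1 := summable_inv_normSq_sub_sq ha t
  have hs2 := summable_kernel ha hL.ne' t
  set U : ℤ × ℤ → ℝ := fun k => ((normSq a k - t) ^ 2)⁻¹ with hU
  set K : ℤ × ℤ → ℝ := fun k => (L ^ 2 + (normSq a k - t) ^ 2)⁻¹ with hK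
  have hU0 : ∀ k, 0 ≤ U k := fun k => by positivity
  have hK0 : ∀ k, 0 ≤ K k := fun k => by positivity
  have hs1' : Summable fun k => U (k + ζ) := summable_shift hs1 ζ
  have hs2' : Summable fun k => K (k + ζ) := summable_shift hs2 ζ
  have e1 : ∑' k, U (k + ζ) = ∑' k, U k := tsum_shift U ζ
  have e2 : ∑' k, K (k + ζ) = ∑' k, K k := tsum_shift K ζ
  have hout : ∀ k, ¬ |normSq a k - t| ≤ L → U k ≤ 2 * K k := by
    intro k hk
    have h1 : L ^ 2 ≤ (normSq a k - t) ^ 2 := by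
      rw [← sq_abs (normSq a k - t)]
      exact pow_le_pow_left₀ hL.le (not_le.mp hk).le 2
    have h2 : 0 < (normSq a k - t) ^ 2 := lt_of_lt_of_le (by positivity) h1
    simp only [U, K]
    rw [← div_eq_mul_inv, inv_eq_one_div, div_le_div_iff₀ h2 (by positivity)]
    linarith
  have hsq : ∀ k, |(normSq a k - t)⁻¹| ^ 2 = U k := fun k => by
    rw [sq_abs, inv_pow]
  have amgm : ∀ x y : ℝ, x * y ≤ θ * y ^ 2 + θ⁻¹ * x ^ 2 := by
    intro x y
    have h : θ * (θ * y ^ 2 + θ⁻¹ * x ^ 2 - x * y) = (θ * y - x / 2) ^ 2 + (3 / 4) * x ^ 2 := by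
      field_simp; ring
    have : 0 ≤ θ * y ^ 2 + θ⁻¹ * x ^ 2 - x * y := by
      by_contra hneg
      have := mul_neg_of_pos_of_neg hθ (not_le.mp hneg)
      nlinarith [sq_nonneg (θ * y - x / 2), sq_nonneg x]
    linarith
  have hpt : ∀ k, |(normSq a k - t)⁻¹ * (normSq a (k + ζ) - t)⁻¹| ≤
      θ * (U k + U (k + ζ)) + 2 * θ⁻¹ * (K k + K (k + ζ)) := by
    intro k
    rw [abs_mul]
    have hθi : 0 < θ⁻¹ := inv_pos.mpr hθ
    have p1 := mul_nonneg hθ.le (hU0 k)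
    have p2 := mul_nonneg hθ.le (hU0 (k + ζ))
    have p3 := mul_nonneg hθi.le (hK0 k)
    have p4 := mul_nonneg hθi.le (hK0 (k + ζ))
    by_cases hk : |normSq a k - t| ≤ L
    · have h1 := mul_le_mul_of_nonneg_left (hout _ (hres k hk)) hθi.le
      have h2 := amgm |(normSq a (k + ζ) - t)⁻¹| |(normSq a k - t)⁻¹|
      rw [hsq, hsq] at h2
      linarith
    · have h1 := mul_le_mul_of_nonneg_left (hout _ hk) hθi.le
      have h2 := amgm |(normSq a k - t)⁻¹| |(normSq a (k + ζ) - t)⁻¹|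
      rw [hsq, hsq] at h2
      linarith
  have hsR : Summable fun k => θ * (U k + U (k + ζ)) + 2 * θ⁻¹ * (K k + K (k + ζ)) :=
    ((hs1.add hs1').mul_left _).add ((hs2.add hs2').mul_left _)
  have hle := (Summable.of_nonneg_of_le (fun _ => abs_nonneg _) hpt hsR).tsum_le_tsum hpt hsR
  rw [((hs1.add hs1').mul_left θ).tsum_add ((hs2.add hs2').mul_left _), tsum_mul_left,
    tsum_mul_left, hs1.tsum_add hs1', hs2.tsum_add hs2', e1, e2] at hle
  refine hle.trans ?_
  have hT' : θ⁻¹ * ∑' k, K k ≤ θ * ∑' k, U k := by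
    rw [inv_mul_le_iff₀ hθ]
    refine hT.trans (le_of_eq ?_)
    ring
  linarith

/-- The elements `t` of `Λ` for which the normalized correlations of `(|ξ|² - t)⁻¹` along small
nonzero shifts `ζ` are at most `6 t ^ (-1 / 128)`. -/
def uncorrelatedSet (a : ℝ) (Λ : Set ℝ) : Set ℝ :=
  {t | t ∈ Λ ∧ 0 < t ∧ ∀ ζ : ℤ × ℤ, ζ ≠ 0 → normSq a ζ ≤ t ^ (1 / 128 : ℝ) →
    ∑' k, |(normSq a k - t)⁻¹ * (normSq a (k + ζ) - t)⁻¹| ≤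
      6 * (t ^ (1 / 128 : ℝ))⁻¹ * ∑' k, ((normSq a k - t) ^ 2)⁻¹}

/-- A correlated `t` is nonpositive (at most one), or far above its lower norm (separation), or has
`T > Z ^ (-6)` (Markov's inequality against the mean value of `T`), or is resonant. -/
theorem Interlaces.exists_card_correlated_le {a : ℝ} (ha : 0 < a) :
    ∃ C : ℝ, 0 < C ∧ ∀ Λ : Set ℝ, Interlaces a Λ → ∀ Z : ℝ, 1 ≤ Z → ∀ G : Finset ℝ,
      (∀ t ∈ G, t ∈ Λ ∧ t ≤ Z ^ 128 ∧ t ∉ uncorrelatedSet a Λ) → (G.card : ℝ) ≤ C * Z ^ 126 := by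
  classical
  obtain ⟨C₁, hC₁, h₁⟩ := Interlaces.exists_sum_latticeKernelSum_le ha
  obtain ⟨C₂, hC₂, h₂⟩ := Interlaces.exists_card_resonant_le ha
  refine ⟨C₁ + C₂ + 3, by positivity, ?_⟩
  intro Λ hΛ Z hZ G hG
  have hZ0 : 0 < Z := by linarith
  have hZ1 : 1 ≤ Z ^ 126 := one_le_pow₀ hZ
  set P₁ : ℝ → Prop := fun t => t ≤ 0
  set P₂ : ℝ → Prop := fun t => Z ^ 2 < t - normSq a (lowerPoint a t)
  set P₃ : ℝ → Prop := fun t => (Z ^ 6)⁻¹ < latticeKernelSum a (Z ^ 20) t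
  set G₁ := G.filter P₁
  set R₁ := G.filter fun t => ¬ P₁ t
  set G₂ := R₁.filter P₂
  set R₂ := R₁.filter fun t => ¬ P₂ t
  set G₃ := R₂.filter P₃
  set R₃ := R₂.filter fun t => ¬ P₃ t
  have hc1 : G₁.card + R₁.card = G.card := Finset.card_filter_add_card_filter_not _
  have hc2 : G₂.card + R₂.card = R₁.card := Finset.card_filter_add_card_filter_not _
  have hc3 : G₃.card + R₃.card = R₂.card := Finset.card_filter_add_card_filter_not _
  have hR₁ : ∀ t ∈ R₁, t ∈ Λ ∧ 0 < t ∧ t ≤ Z ^ 128 ∧ t ∉ uncorrelatedSet a Λ := by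
    intro t ht
    obtain ⟨h, h'⟩ := Finset.mem_filter.mp ht
    exact ⟨(hG t h).1, not_le.mp h', (hG t h).2⟩
  have hR₂ : ∀ t ∈ R₂, t ∈ Λ ∧ 0 < t ∧ t ≤ Z ^ 128 ∧ t - normSq a (lowerPoint a t) ≤ Z ^ 2 := by
    intro t ht
    obtain ⟨h, h'⟩ := Finset.mem_filter.mp ht
    exact ⟨(hR₁ t h).1, (hR₁ t h).2.1, (hR₁ t h).2.2.1, not_lt.mp h'⟩
  have b1 : G₁.card ≤ 1 := by
    rw [Finset.card_le_one]
    intro t ht t' ht'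
    obtain ⟨h, h'⟩ := Finset.mem_filter.mp ht
    obtain ⟨h2, h2'⟩ := Finset.mem_filter.mp ht'
    exact hΛ.subsingleton_nonpos ⟨(hG t h).1, h'⟩ ⟨(hG t' h2).1, h2'⟩
  have b2 : (G₂.card : ℝ) ≤ Z ^ 126 + 1 := by
    have := hΛ.card_far_le ha (X := Z ^ 128) (H := Z ^ 2) (by positivity) (by positivity) G₂
      (fun t ht => by
        obtain ⟨h, h'⟩ := Finset.mem_filter.mp ht
        exact ⟨(hR₁ t h).1, (hR₁ t h).2.1, (hR₁ t h).2.2.1, h'⟩)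
    refine this.trans (le_of_eq ?_)
    field_simp
  have b3 : (G₃.card : ℝ) ≤ C₁ * Z ^ 126 := by
    have h3 := h₁ Λ hΛ Z hZ G₃ (fun t ht => hR₂ t (Finset.mem_filter.mp ht).1)
    have h4 : (G₃.card : ℝ) * (Z ^ 6)⁻¹ ≤ C₁ * Z ^ 119 := by
      rw [← nsmul_eq_mul, ← Finset.sum_const]
      exact (Finset.sum_le_sum fun t ht => (Finset.mem_filter.mp ht).2.le).trans h3
    rw [← div_eq_mul_inv, div_le_iff₀ (by positivity)] at h4
    refine h4.trans ?_
    calc C₁ * Z ^ 119 * Z ^ 6 = C₁ * Z ^ 125 := by ring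
      _ ≤ _ := by gcongr; exacts [by norm_num]
  have b4 : (R₃.card : ℝ) ≤ C₂ * Z ^ 126 := by
    refine h₂ Λ hΛ Z hZ R₃ fun t ht => ?_
    obtain ⟨h, h'⟩ := Finset.mem_filter.mp ht
    obtain ⟨htΛ, ht0, htX, hH⟩ := hR₂ t h
    have hnot := (hR₁ t (Finset.mem_filter.mp h).1).2.2.2
    have hT : latticeKernelSum a (Z ^ 20) t ≤ (Z ^ 6)⁻¹ := not_lt.mp h'
    refine ⟨htΛ, ht0, htX, hH, hT.trans (inv_le_one_of_one_le₀ (one_le_pow₀ hZ)), ?_⟩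
    by_contra hres
    refine hnot ⟨htΛ, ht0, fun ζ hζ hζt => ?_⟩
    have htZ : t ^ (1 / 128 : ℝ) ≤ Z := by
      calc t ^ (1 / 128 : ℝ) ≤ (Z ^ 128) ^ (1 / 128 : ℝ) :=
            Real.rpow_le_rpow ht0.le htX (by norm_num)
        _ = Z := by
          rw [← Real.rpow_natCast, ← Real.rpow_mul hZ0.le]; norm_num
    -- The term of the lower point alone bounds `M` from below. With `θ = Z⁻¹` this gives `θ² M ≥ Z
    -- ^ (-6) ≥ T`, as the correlation bound requires.
    have hM0 : (Z ^ 4)⁻¹ ≤ ∑' k, ((normSq a k - t) ^ 2)⁻¹ := by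
      refine le_trans ?_ ((summable_inv_normSq_sub_sq ha t).le_tsum (lowerPoint a t)
        fun _ _ => by positivity)
      have h5 := (lowerPoint_spec ha ht0).1
      refine inv_anti₀ (by nlinarith) ?_
      calc (normSq a (lowerPoint a t) - t) ^ 2 = (t - normSq a (lowerPoint a t)) ^ 2 := by ring
        _ ≤ (Z ^ 2) ^ 2 := pow_le_pow_left₀ (by linarith) hH 2
        _ = _ := by ring
    refine (tsum_mul_shift_le ha (L := Z ^ 20) (θ := Z⁻¹) (by positivity) (by positivity)
      (fun k hk hk' => hres ⟨ζ, hζ, hζt.trans htZ, k, hk, hk'⟩) ?_).trans ?_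
    · refine hT.trans ?_
      calc (Z ^ 6)⁻¹ = Z⁻¹ ^ 2 * (Z ^ 4)⁻¹ := by field_simp
        _ ≤ _ := by gcongr
    · have : 0 ≤ ∑' k, ((normSq a k - t) ^ 2)⁻¹ := tsum_nonneg fun _ => by positivity
      have : 0 < t ^ (1 / 128 : ℝ) := Real.rpow_pos_of_pos ht0 _
      gcongr
  have b1' : (G₁.card : ℝ) ≤ 1 := by exact_mod_cast b1
  have hsum : (G.card : ℝ) = G₁.card + (G₂.card + (G₃.card + R₃.card)) := by
    rw [← hc1, ← hc2, ← hc3]; push_cast; ring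
  rw [hsum]
  nlinarith

/-- The exceptional set has `O(Z ^ 126)` elements against at least a constant times `Z ^ 127`; their
ratio is `O(X^(-1/128))`. -/
theorem Interlaces.isDensityOneSubset {a : ℝ} (ha : 0 < a) {Λ : Set ℝ} (hΛ : Interlaces a Λ) :
    IsDensityOneSubset (uncorrelatedSet a Λ) Λ := by
  classical
  refine ⟨fun t ht => ht.1, ?_⟩
  obtain ⟨C, hC, hbad⟩ := Interlaces.exists_card_correlated_le ha
  obtain ⟨c, hc, hmany⟩ := exists_le_card_norms ha
  set ρ : ℝ → ℝ := fun X => X ^ (1 / 128 : ℝ) with hρ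
  have hρlim : Tendsto ρ atTop atTop := tendsto_rpow_atTop (by norm_num)
  have hlow : ∀ᶠ X in atTop, 1 - (2 * C / c) * (ρ X)⁻¹ ≤
      ((uncorrelatedSet a Λ ∩ Set.Iic X).ncard : ℝ) / ((Λ ∩ Set.Iic X).ncard : ℝ) ∧
      ((uncorrelatedSet a Λ ∩ Set.Iic X).ncard : ℝ) / ((Λ ∩ Set.Iic X).ncard : ℝ) ≤ 1 := by
    filter_upwards [hρlim.eventually_ge_atTop (max 1 (2 / c)), eventually_ge_atTop 0] with X hX hX0
    set Z := ρ X with hZdef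
    have hZ : 1 ≤ Z := le_trans (le_max_left _ _) hX
    have hZc : 2 / c ≤ Z := le_trans (le_max_right _ _) hX
    have hZ0 : 0 < Z := by linarith
    have hZX : Z ^ 128 = X := by
      simp only [hZdef, hρ]
      rw [← Real.rpow_natCast, ← Real.rpow_mul hX0]; norm_num
    have hfin := hΛ.finite_inter_Iic ha X
    have hfinU : (uncorrelatedSet a Λ ∩ Set.Iic X).Finite :=
      hfin.subset fun t ht => ⟨ht.1.1, ht.2⟩
    have hle : (uncorrelatedSet a Λ ∩ Set.Iic X).ncard ≤ (Λ ∩ Set.Iic X).ncard :=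
      Set.ncard_le_ncard (fun t ht => ⟨ht.1.1, ht.2⟩) hfin
    have hdiff : ((Λ ∩ Set.Iic X).ncard : ℝ) ≤
        (uncorrelatedSet a Λ ∩ Set.Iic X).ncard + C * Z ^ 126 := by
      have h1 := hbad Λ hΛ Z hZ (hfin.toFinset \ hfinU.toFinset) (fun t ht => by
        rw [Finset.mem_sdiff, Set.Finite.mem_toFinset, Set.Finite.mem_toFinset] at ht
        exact ⟨ht.1.1, hZX ▸ ht.1.2, fun h => ht.2 ⟨h, ht.1.2⟩⟩)
      have h2 : hfin.toFinset.card ≤ (hfin.toFinset \ hfinU.toFinset).card +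
          hfinU.toFinset.card := by
        have := Finset.le_card_sdiff hfinU.toFinset hfin.toFinset
        omega
      rw [Set.ncard_eq_toFinset_card _ hfin, Set.ncard_eq_toFinset_card _ hfinU]
      have h3 : (hfin.toFinset.card : ℝ) ≤ (hfin.toFinset \ hfinU.toFinset).card +
          hfinU.toFinset.card := by exact_mod_cast h2
      linarith
    have hbig : c / 2 * Z ^ 127 ≤ (Λ ∩ Set.Iic X).ncard := by
      obtain ⟨s, hs, hcard⟩ := hmany Z hZ
      obtain ⟨T, hT, hTcard⟩ := hΛ.exists_finset_of_norms s fun n hn => (hs n hn).2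
      have h1 : (T : Set ℝ) ⊆ Λ ∩ Set.Iic X := by
        intro t ht
        obtain ⟨h2, n, hn, h3⟩ := hT t ht
        exact ⟨h2, (h3.le.trans (hs n hn).1).trans_eq hZX⟩
      have h2 := Set.ncard_le_ncard h1 hfin
      rw [Set.ncard_coe_finset] at h2
      have h3 : (s.card : ℝ) ≤ (Λ ∩ Set.Iic X).ncard + 1 := by
        exact_mod_cast hTcard.trans (Nat.add_le_add_right h2 1)
      -- Half of the main term absorbs the one element lost between norms and gaps; this is why `Z ≥
      -- 2 / c` is imposed.
      have h4 : 1 ≤ c / 2 * Z ^ 127 := by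
        have h5 : Z ≤ Z ^ 127 := le_self_pow₀ hZ (by norm_num)
        rw [div_le_iff₀ hc] at hZc
        nlinarith
      linarith
    have hpos : (0 : ℝ) < (Λ ∩ Set.Iic X).ncard := lt_of_lt_of_le (by positivity) hbig
    constructor
    · rw [le_div_iff₀ hpos]
      have h6 : C * Z ^ 126 ≤ 2 * C / c * Z⁻¹ * (Λ ∩ Set.Iic X).ncard := by
        calc C * Z ^ 126 = 2 * C / c * Z⁻¹ * (c / 2 * Z ^ 127) := by field_simp
          _ ≤ _ := by gcongr
      linarith
    · rw [div_le_one hpos]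
      exact_mod_cast hle
  refine tendsto_of_tendsto_of_tendsto_of_le_of_le' (g := fun X => 1 - (2 * C / c) * (ρ X)⁻¹)
    (h := fun _ => 1) ?_ tendsto_const_nhds (hlow.mono fun _ h => h.1) (hlow.mono fun _ h => h.2)
  have := (hρlim.inv_tendsto_atTop.const_mul (2 * C / c)).const_sub 1
  simpa using this

/-! ### Fourier series on the torus -/

theorem integral_fourier {T : ℝ} [hT : Fact (0 < T)] {n : ℤ} (hn : n ≠ 0) :
    ∫ x : AddCircle T, fourier n x = 0 :=
  integral_eq_zero_of_add_right_eq_neg (μ := (volume : Measure (AddCircle T)))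
    (fourier_add_half_inv_index hn hT.out)

section Basis

variable {a : ℝ} (x₀ : Torus a)

@[simp] theorem expoAt_apply (k : ℤ × ℤ) (x : Torus a) :
    expoAt a x₀ k x = fourier k.1 (x.1 - x₀.1) * fourier k.2 (x.2 - x₀.2) := rfl

theorem expoAt_zero (x : Torus a) : expoAt a x₀ 0 x = 1 := by simp

theorem expoAt_add (k l : ℤ × ℤ) (x : Torus a) :
    expoAt a x₀ (k + l) x = expoAt a x₀ k x * expoAt a x₀ l x := by
  simp only [expoAt_apply, Prod.fst_add, Prod.snd_add, fourier_add]
  ring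

theorem expoAt_neg (k : ℤ × ℤ) (x : Torus a) :
    expoAt a x₀ (-k) x = (starRingEnd ℂ) (expoAt a x₀ k x) := by
  simp only [expoAt_apply, Prod.fst_neg, Prod.snd_neg, fourier_neg, map_mul]

theorem norm_expoAt_apply (k : ℤ × ℤ) (x : Torus a) : ‖expoAt a x₀ k x‖ = 1 := by
  simp only [expoAt_apply, norm_mul, fourier_apply, Circle.norm_coe, mul_one]

theorem expoAt_self (k : ℤ × ℤ) : expoAt a x₀ k x₀ = 1 := by simp

theorem expoAt_coe (s v : ℝ × ℝ) (k : ℤ × ℤ) :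
    expoAt a ((s.1 : AddCircle (2 * Real.pi / a)), (s.2 : AddCircle (2 * Real.pi * a))) k
      ((v.1 : AddCircle (2 * Real.pi / a)), (v.2 : AddCircle (2 * Real.pi * a))) =
    Complex.exp (Complex.I * ((k.1 * a * (v.1 - s.1) + k.2 / a * (v.2 - s.2) : ℝ) : ℂ)) := by
  rcases eq_or_ne a 0 with rfl | ha
  · simp only [expoAt_apply, ← AddCircle.coe_sub, fourier_coe_apply]
    simp
  · have hpi : (Real.pi : ℂ) ≠ 0 := by exact_mod_cast Real.pi_ne_zero
    have ha' : (a : ℂ) ≠ 0 := by exact_mod_cast ha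
    simp only [expoAt_apply, ← AddCircle.coe_sub, fourier_coe_apply, ← Complex.exp_add]
    congr 1
    push_cast
    field_simp

variable [hFact : Fact (0 < a)]

theorem volume_real_univ : (volume : Measure (Torus a)).real Set.univ = 4 * Real.pi ^ 2 := by
  have ha := hFact.out
  rw [Measure.real, Measure.volume_eq_prod, ← Set.univ_prod_univ, Measure.prod_prod,
    AddCircle.measure_univ, AddCircle.measure_univ, ← ENNReal.ofReal_mul (by positivity),
    ENNReal.toReal_ofReal (by positivity)]
  field_simp
  norm_num

theorem integral_expoAt (k : ℤ × ℤ) :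
    ∫ x, expoAt a x₀ k x = if k = 0 then 4 * (Real.pi : ℂ) ^ 2 else 0 := by
  split_ifs with h
  · subst h
    simp only [expoAt_zero, integral_const, volume_real_univ]
    simp
  · simp only [expoAt_apply]
    rw [Measure.volume_eq_prod,
      integral_prod_mul (fun x : AddCircle (2 * Real.pi / a) => (fourier k.1 (x - x₀.1) : ℂ))
        (fun y : AddCircle (2 * Real.pi * a) => (fourier k.2 (y - x₀.2) : ℂ)),
      integral_sub_right_eq_self (fun x : AddCircle (2 * Real.pi / a) => (fourier k.1 x : ℂ)),
      integral_sub_right_eq_self (fun x : AddCircle (2 * Real.pi * a) => (fourier k.2 x : ℂ))]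
    by_cases h1 : k.1 = 0
    · have h2 : k.2 ≠ 0 := fun h2 => h (Prod.ext h1 h2)
      rw [integral_fourier h2, mul_zero]
    · rw [integral_fourier h1, zero_mul]

/-- The class in `L²` of a continuous function. -/
noncomputable abbrev toL2 : C(Torus a, ℂ) →L[ℂ] L2 a :=
  ContinuousMap.toLp 2 (volume : Measure (Torus a)) ℂ

/-- The normalized exponentials `(2π)⁻¹ exp (i ⟨ξ, x - x₀⟩)`. -/
noncomputable def unitExpo (k : ℤ × ℤ) : L2 a :=
  ((2 * Real.pi : ℝ) : ℂ)⁻¹ • toL2 (expoAt a x₀ k)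

theorem orthonormal_unitExpo : Orthonormal ℂ (unitExpo x₀) := by
  rw [orthonormal_iff_ite]
  intro k l
  have hpi : (Real.pi : ℂ) ≠ 0 := by exact_mod_cast Real.pi_ne_zero
  rw [unitExpo, unitExpo, inner_smul_left, inner_smul_right, ContinuousMap.inner_toLp]
  have : ∀ x, expoAt a x₀ l x * (starRingEnd ℂ) (expoAt a x₀ k x) = expoAt a x₀ (l - k) x := by
    intro x
    rw [← expoAt_neg, ← expoAt_add, sub_eq_add_neg]
  simp only [this]
  rw [integral_expoAt]
  by_cases h : k = l
  · subst h
    simp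
    field_simp
    rw [map_ofNat]
    norm_num
  · rw [if_neg h, if_neg (fun h' => h (sub_eq_zero.mp h').symm)]
    simp

/-- The star subalgebra of `C(𝕋², ℂ)` generated by the exponentials. -/
noncomputable def expoSubalgebra : StarSubalgebra ℂ C(Torus a, ℂ) where
  toSubalgebra := Algebra.adjoin ℂ (Set.range (expoAt a x₀))
  star_mem' := by
    change Algebra.adjoin ℂ (Set.range (expoAt a x₀)) ≤
      star (Algebra.adjoin ℂ (Set.range (expoAt a x₀)))
    refine Algebra.adjoin_le ?_
    rintro _ ⟨k, rfl⟩
    refine Algebra.subset_adjoin ⟨-k, ?_⟩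
    ext1 x
    simp only [expoAt_neg, starRingEnd_apply, ContinuousMap.star_apply]

theorem expoSubalgebra_coe :
    (expoSubalgebra x₀).toSubalgebra.toSubmodule = Submodule.span ℂ (Set.range (expoAt a x₀)) := by
  apply Algebra.adjoin_eq_span_of_subset
  refine .trans (fun x ↦ Submonoid.closure_induction (fun _ ↦ id) ⟨0, ?_⟩ ?_) Submodule.subset_span
  · ext x
    rw [expoAt_zero, ContinuousMap.one_apply]
  · rintro _ _ _ _ ⟨m, rfl⟩ ⟨n, rfl⟩
    refine ⟨m + n, ?_⟩
    ext x
    rw [expoAt_add, ContinuousMap.mul_apply]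

theorem expoSubalgebra_separatesPoints : (expoSubalgebra x₀).SeparatesPoints := by
  intro x y hxy
  have ha := hFact.out
  have h0 : (2 * Real.pi / a) ≠ 0 := by positivity
  have h0' : (2 * Real.pi * a) ≠ 0 := by positivity
  by_cases h : x.1 = y.1
  · have h2 : x.2 ≠ y.2 := fun h2 => hxy (Prod.ext h h2)
    refine ⟨_, ⟨expoAt a x₀ (0, 1), Algebra.subset_adjoin ⟨(0, 1), rfl⟩, rfl⟩, ?_⟩
    simp only [expoAt_apply, fourier_zero, one_mul, fourier_one]
    contrapose h2
    exact sub_left_injective (AddCircle.injective_toCircle h0' (Subtype.coe_inj.mp h2))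
  · refine ⟨_, ⟨expoAt a x₀ (1, 0), Algebra.subset_adjoin ⟨(1, 0), rfl⟩, rfl⟩, ?_⟩
    simp only [expoAt_apply, fourier_zero, mul_one, fourier_one]
    contrapose h
    exact sub_left_injective (AddCircle.injective_toCircle h0 (Subtype.coe_inj.mp h))

/-- Stone–Weierstrass: the span of the exponentials is a star subalgebra, and the two coordinate
characters already separate points. -/
theorem span_expoAt_closure_eq_top :
    (Submodule.span ℂ (Set.range (expoAt a x₀))).topologicalClosure = ⊤ := by
  rw [← expoSubalgebra_coe]
  exact congr_arg (Subalgebra.toSubmodule <| StarSubalgebra.toSubalgebra ·)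
    (ContinuousMap.starSubalgebra_topologicalClosure_eq_top_of_separatesPoints _
      (expoSubalgebra_separatesPoints x₀))

theorem span_unitExpo_closure_eq_top :
    (Submodule.span ℂ (Set.range (unitExpo x₀))).topologicalClosure = ⊤ := by
  have h : (Submodule.span ℂ (Set.range fun k => toL2 (expoAt a x₀ k))).topologicalClosure = ⊤ := by
    simpa only [Submodule.map_span, ContinuousLinearMap.coe_coe, ← Set.range_comp,
      Function.comp_def] using
      (ContinuousMap.toLp_denseRange ℂ volume ℂ (by simp)).topologicalClosure_map_submodule
        (span_expoAt_closure_eq_top x₀)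
  rw [← top_le_iff, ← h]
  refine Submodule.topologicalClosure_mono (Submodule.span_le.mpr ?_)
  rintro _ ⟨k, rfl⟩
  have hpi : ((2 * Real.pi : ℝ) : ℂ) ≠ 0 := by exact_mod_cast Real.two_pi_pos.ne'
  have : toL2 (expoAt a x₀ k) = ((2 * Real.pi : ℝ) : ℂ) • unitExpo x₀ k := by
    rw [unitExpo, smul_smul, mul_inv_cancel₀ hpi, one_smul]
  simp only [this]
  exact Submodule.smul_mem _ _ (Submodule.subset_span ⟨k, rfl⟩)

/-- The Hilbert basis of `L²(𝕋²)` of normalized exponentials. -/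
noncomputable def expoBasis : HilbertBasis (ℤ × ℤ) ℂ (L2 a) :=
  HilbertBasis.mk (orthonormal_unitExpo x₀) (span_unitExpo_closure_eq_top x₀).ge

@[simp] theorem expoBasis_apply (k : ℤ × ℤ) : expoBasis x₀ k = unitExpo x₀ k := by
  rw [expoBasis, HilbertBasis.coe_mk]

/-- The coefficient of `f` in the basis of normalized exponentials, as a linear functional. -/
noncomputable def coeff (k : ℤ × ℤ) : L2 a →L[ℂ] ℂ := innerSL ℂ (unitExpo x₀ k)

theorem coeff_eq_repr (k : ℤ × ℤ) (f : L2 a) : coeff x₀ k f = (expoBasis x₀).repr f k := by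
  rw [HilbertBasis.repr_apply_apply, expoBasis_apply, coeff, innerSL_apply_apply]

theorem hasSum_coeff (f : L2 a) : HasSum (fun k => coeff x₀ k f • unitExpo x₀ k) f := by
  simpa only [coeff_eq_repr, expoBasis_apply] using (expoBasis x₀).hasSum_repr f

theorem ext_coeff {f g : L2 a} (h : ∀ k, coeff x₀ k f = coeff x₀ k g) : f = g := by
  have h1 := hasSum_coeff x₀ f
  simp only [h] at h1
  exact h1.unique (hasSum_coeff x₀ g)

theorem summable_norm_coeff_sq (f : L2 a) : Summable fun k => ‖coeff x₀ k f‖ ^ 2 := by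
  simpa only [coeff, innerSL_apply_apply] using
    (orthonormal_unitExpo x₀).inner_products_summable f

theorem hasSum_norm_coeff_sq (f : L2 a) : HasSum (fun k => ‖coeff x₀ k f‖ ^ 2) (‖f‖ ^ 2) := by
  have h := (expoBasis x₀).hasSum_inner_mul_inner f f
  have h2 : ∀ k, inner ℂ f (expoBasis x₀ k) * inner ℂ (expoBasis x₀ k) f =
      ((‖coeff x₀ k f‖ ^ 2 : ℝ) : ℂ) := by
    intro k
    rw [expoBasis_apply, coeff, innerSL_apply_apply, ← inner_conj_symm, mul_comm, Complex.mul_conj,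
      Complex.normSq_eq_norm_sq]
  simp only [h2] at h
  rw [inner_self_eq_norm_sq_to_K, ← RCLike.ofReal_pow] at h
  exact (RCLike.hasSum_ofReal ℂ).mp h

/-- An element of `L²` with prescribed square-summable coefficients. -/
theorem exists_hasSum_coeff {c : ℤ × ℤ → ℂ} (hc : Summable fun k => ‖c k‖ ^ 2) :
    ∃ f : L2 a, HasSum (fun k => c k • unitExpo x₀ k) f ∧ ∀ k, coeff x₀ k f = c k := by
  have hmem : Memℓp c 2 := by
    rw [memℓp_gen_iff (by norm_num)]
    simpa using hc
  set f := (expoBasis x₀).repr.symm ⟨c, hmem⟩ with hf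
  have hcoef : ∀ k, coeff x₀ k f = c k := by
    intro k
    rw [coeff_eq_repr, hf, LinearIsometryEquiv.apply_symm_apply]
  refine ⟨f, ?_, hcoef⟩
  simpa only [hcoef] using hasSum_coeff x₀ f

theorem coeff_eq_integral (k : ℤ × ℤ) {f : L2 a} {F : Torus a → ℂ} (hf : f =ᵐ[volume] F) :
    coeff x₀ k f = ((2 * Real.pi : ℝ) : ℂ)⁻¹ * ∫ x, expoAt a x₀ (-k) x * F x := by
  rw [coeff, innerSL_apply_apply, unitExpo, inner_smul_left, map_inv₀, Complex.conj_ofReal,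
    MeasureTheory.L2.inner_def]
  congr 1
  refine integral_congr_ae ?_
  filter_upwards [hf, ContinuousMap.coeFn_toLp (𝕜 := ℂ) (p := 2) volume (expoAt a x₀ k)]
    with x hx hx'
  rw [hx, hx', expoAt_neg, RCLike.inner_apply']

end Basis

/-! ### Integration by parts on the torus -/

/-- Two integrations by parts over a period. The first derivative `h₁` is given only on the line, so
its equality at the two endpoints, needed to cancel the boundary terms, has to be derived. -/
theorem integral_fourier_mul_deriv_deriv {T : ℝ} [hT : Fact (0 < T)] {h h₂ : AddCircle T → ℂ}
    {h₁ : ℝ → ℂ} (hd₁ : ∀ t : ℝ, HasDerivAt (fun t : ℝ => h t) (h₁ t) t)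
    (hd₂ : ∀ t : ℝ, HasDerivAt h₁ (h₂ t) t) (hc : Continuous fun t : ℝ => h₂ t)
    (n : ℤ) (s : AddCircle T) :
    ∫ x, fourier n (x - s) * h₂ x =
      -((2 * Real.pi * n / T : ℝ) : ℂ) ^ 2 * ∫ x, fourier n (x - s) * h x := by
  induction s using QuotientAddGroup.induction_on with
  | H σ =>
  set E : ℝ → ℂ := fun t => fourier n ((t : AddCircle T) - (σ : AddCircle T)) with hE
  set c : ℂ := 2 * Real.pi * Complex.I * n / T with hcdef
  have hEd : ∀ t, HasDerivAt E (c * E t) t := fun t =>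
    (hasDerivAt_fourier T n (t - σ)).comp_sub_const t σ
  have hper : (((0 : ℝ) + T : ℝ) : AddCircle T) = ((0 : ℝ) : AddCircle T) := by
    rw [zero_add, AddCircle.coe_period, AddCircle.coe_zero]
  have hEper : E (0 + T) = E 0 := by simp only [hE, hper]
  -- The periodic lift of `h` has both values as its derivative at `0`, so they agree.
  have hh₁per : h₁ (0 + T) = h₁ 0 := by
    have h1 : HasDerivAt (fun t : ℝ => h ((t + T : ℝ) : AddCircle T)) (h₁ (0 + T)) 0 :=
      (hd₁ (0 + T)).comp_add_const 0 T
    have e : (fun t : ℝ => h ((t + T : ℝ) : AddCircle T)) = fun t : ℝ => h (t : AddCircle T) := by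
      funext t
      rw [AddCircle.coe_add_period]
    rw [e] at h1
    exact h1.unique (hd₁ 0)
  have hEc : Continuous E := continuous_iff_continuousAt.mpr fun t => (hEd t).continuousAt
  have hh₁c : Continuous h₁ := continuous_iff_continuousAt.mpr fun t => (hd₂ t).continuousAt
  rw [← AddCircle.intervalIntegral_preimage T 0, ← AddCircle.intervalIntegral_preimage T 0]
  have i1 := intervalIntegral.integral_mul_deriv_eq_deriv_mul (a := 0) (b := 0 + T) (u := E)
    (v := h₁) (fun t _ => hEd t) (fun t _ => hd₂ t)
    ((continuous_const.mul hEc).intervalIntegrable _ _) (hc.intervalIntegrable _ _)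
  have i2 := intervalIntegral.integral_mul_deriv_eq_deriv_mul (a := 0) (b := 0 + T) (u := E)
    (v := fun t : ℝ => h t) (fun t _ => hEd t) (fun t _ => hd₁ t)
    ((continuous_const.mul hEc).intervalIntegrable _ _) (hh₁c.intervalIntegrable _ _)
  simp only [hper, hEper, hh₁per, sub_self, zero_sub, mul_assoc,
    intervalIntegral.integral_const_mul] at i1 i2
  simp only [hE] at i1 i2
  rw [i1, i2, hcdef]
  push_cast
  linear_combination ((2 * Real.pi * n / T) ^ 2 * ∫ t in (0 : ℝ)..0 + T,
    (fourier n ((t : AddCircle T) - (σ : AddCircle T)) : ℂ) * h t) * Complex.I_sq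

/-- The covering map of the torus by the plane. -/
noncomputable def torusMk (a : ℝ) (v : ℝ × ℝ) : Torus a :=
  ((v.1 : AddCircle (2 * Real.pi / a)), (v.2 : AddCircle (2 * Real.pi * a)))

theorem isOpenQuotientMap_torusMk (a : ℝ) : IsOpenQuotientMap (torusMk a) :=
  QuotientAddGroup.isOpenQuotientMap_mk.prodMap QuotientAddGroup.isOpenQuotientMap_mk

theorem exists_torusMk {a : ℝ} (x : Torus a) : ∃ v, torusMk a v = x :=
  (isOpenQuotientMap_torusMk a).surjective x

theorem continuous_of_lift {a : ℝ} {f : Torus a → ℂ} (hf : Continuous fun v => f (torusMk a v)) :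
    Continuous f :=
  (isOpenQuotientMap_torusMk a).continuous_comp_iff.mp hf

theorem torusMk_add_left {a : ℝ} (v : ℝ × ℝ) (t : ℝ) :
    ((torusMk a v).1 + (t : AddCircle (2 * Real.pi / a)), (torusMk a v).2) =
      torusMk a (v + t • ((1 : ℝ), (0 : ℝ))) := by
  simp [torusMk]

theorem torusMk_add_right {a : ℝ} (v : ℝ × ℝ) (t : ℝ) :
    ((torusMk a v).1, (torusMk a v).2 + (t : AddCircle (2 * Real.pi * a))) =
      torusMk a (v + t • ((0 : ℝ), (1 : ℝ))) := by
  simp [torusMk]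

/-- The derivative of `F` in the direction `e`. -/
noncomputable def dirDeriv (F : ℝ × ℝ → ℂ) (e v : ℝ × ℝ) : ℂ := fderiv ℝ F v e

theorem contDiff_dirDeriv {F : ℝ × ℝ → ℂ} (hF : ContDiff ℝ ∞ F) (e : ℝ × ℝ) :
    ContDiff ℝ ∞ (dirDeriv F e) :=
  (hF.fderiv_right (m := ∞) (by simp)).clm_apply contDiff_const

theorem hasDerivAt_line {F : ℝ × ℝ → ℂ} (hF : ContDiff ℝ ∞ F) (v e : ℝ × ℝ) (t : ℝ) :
    HasDerivAt (fun t : ℝ => F (v + t • e)) (dirDeriv F e (v + t • e)) t := by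
  have h1 : HasDerivAt (fun t : ℝ => v + t • e) e t := by
    simpa using ((hasDerivAt_id t).smul_const e).const_add v
  exact ((hF.differentiable (by simp)) (v + t • e)).hasFDerivAt.comp_hasDerivAt t h1

theorem iteratedDeriv_two_line {F : ℝ × ℝ → ℂ} (hF : ContDiff ℝ ∞ F) (v e : ℝ × ℝ) :
    iteratedDeriv 2 (fun t : ℝ => F (v + t • e)) 0 = dirDeriv (dirDeriv F e) e v := by
  rw [iteratedDeriv_succ, iteratedDeriv_one]
  have h1 : deriv (fun t : ℝ => F (v + t • e)) = fun t => dirDeriv F e (v + t • e) :=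
    funext fun t => (hasDerivAt_line hF v e t).deriv
  rw [h1, (hasDerivAt_line (contDiff_dirDeriv hF e) v e 0).deriv]
  simp

section Laplacian

variable {a : ℝ}

theorem IsSmooth.contDiff {f : Torus a → ℂ} (hf : IsSmooth f) :
    ContDiff ℝ ∞ fun v => f (torusMk a v) := hf

theorem IsSmooth.continuous {f : Torus a → ℂ} (hf : IsSmooth f) : Continuous f :=
  continuous_of_lift hf.contDiff.continuous

/-- The second derivative along the first circle. -/
noncomputable def secondDerivLeft (f : Torus a → ℂ) (x : Torus a) : ℂ :=
  iteratedDeriv 2 (fun t : ℝ => f (x.1 + (t : AddCircle (2 * Real.pi / a)), x.2)) 0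

/-- The second derivative along the second circle. -/
noncomputable def secondDerivRight (f : Torus a → ℂ) (x : Torus a) : ℂ :=
  iteratedDeriv 2 (fun t : ℝ => f (x.1, x.2 + (t : AddCircle (2 * Real.pi * a)))) 0

theorem laplacian_eq (f : Torus a → ℂ) (x : Torus a) :
    laplacian f x = secondDerivLeft f x + secondDerivRight f x := rfl

theorem secondDerivLeft_torusMk {f : Torus a → ℂ} (hf : IsSmooth f) (v : ℝ × ℝ) :
    secondDerivLeft f (torusMk a v) =
      dirDeriv (dirDeriv (fun v => f (torusMk a v)) (1, 0)) (1, 0) v := by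
  simp only [secondDerivLeft, torusMk_add_left]
  exact iteratedDeriv_two_line hf.contDiff v (1, 0)

theorem secondDerivRight_torusMk {f : Torus a → ℂ} (hf : IsSmooth f) (v : ℝ × ℝ) :
    secondDerivRight f (torusMk a v) =
      dirDeriv (dirDeriv (fun v => f (torusMk a v)) (0, 1)) (0, 1) v := by
  simp only [secondDerivRight, torusMk_add_right]
  exact iteratedDeriv_two_line hf.contDiff v (0, 1)

theorem IsSmooth.secondDerivLeft {f : Torus a → ℂ} (hf : IsSmooth f) :
    IsSmooth (secondDerivLeft f) := by
  have h := contDiff_dirDeriv (contDiff_dirDeriv hf.contDiff (1, 0)) (1, 0)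
  have e : (fun v => PointScatterer.secondDerivLeft f (torusMk a v)) =
      dirDeriv (dirDeriv (fun v => f (torusMk a v)) (1, 0)) (1, 0) :=
    funext (secondDerivLeft_torusMk hf)
  rw [← e] at h
  exact h

theorem IsSmooth.secondDerivRight {f : Torus a → ℂ} (hf : IsSmooth f) :
    IsSmooth (secondDerivRight f) := by
  have h := contDiff_dirDeriv (contDiff_dirDeriv hf.contDiff (0, 1)) (0, 1)
  have e : (fun v => PointScatterer.secondDerivRight f (torusMk a v)) =
      dirDeriv (dirDeriv (fun v => f (torusMk a v)) (0, 1)) (0, 1) :=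
    funext (secondDerivRight_torusMk hf)
  rw [← e] at h
  exact h

theorem IsSmooth.add {f g : Torus a → ℂ} (hf : IsSmooth f) (hg : IsSmooth g) :
    IsSmooth fun x => f x + g x :=
  ContDiff.add hf hg

theorem IsSmooth.neg {f : Torus a → ℂ} (hf : IsSmooth f) : IsSmooth fun x => -f x :=
  ContDiff.neg hf

theorem IsSmooth.laplacian {f : Torus a → ℂ} (hf : IsSmooth f) : IsSmooth (laplacian f) :=
  hf.secondDerivLeft.add hf.secondDerivRight

variable [hFact : Fact (0 < a)]

theorem integrable_of_continuous {f : Torus a → ℂ} (hf : Continuous f) : Integrable f :=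
  hf.integrable_of_hasCompactSupport (HasCompactSupport.of_compactSpace f)

theorem integral_expoAt_mul_secondDerivLeft (x₀ : Torus a) {f : Torus a → ℂ} (hf : IsSmooth f)
    (k : ℤ × ℤ) : ∫ x, expoAt a x₀ k x * secondDerivLeft f x =
      -((k.1 * a : ℝ) : ℂ) ^ 2 * ∫ x, expoAt a x₀ k x * f x := by
  have ha := hFact.out
  have hc := (expoAt a x₀ k).continuous
  have hint1 : Integrable fun x => expoAt a x₀ k x * secondDerivLeft f x :=
    integrable_of_continuous (hc.mul hf.secondDerivLeft.continuous)
  have hint2 : Integrable fun x => expoAt a x₀ k x * f x :=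
    integrable_of_continuous (hc.mul hf.continuous)
  rw [Measure.volume_eq_prod] at hint1 hint2 ⊢
  rw [integral_prod_symm _ hint1, integral_prod_symm _ hint2, ← integral_const_mul]
  refine integral_congr_ae (Eventually.of_forall fun y => ?_)
  induction y using QuotientAddGroup.induction_on with
  | H w =>
  have key := integral_fourier_mul_deriv_deriv (T := 2 * Real.pi / a)
    (h := fun x => f (x, (w : AddCircle (2 * Real.pi * a))))
    (h₂ := fun x => secondDerivLeft f (x, (w : AddCircle (2 * Real.pi * a))))
    (h₁ := fun t => dirDeriv (fun v => f (torusMk a v)) (1, 0) (t, w))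
    (fun t => by
      have := hasDerivAt_line hf.contDiff (0, w) (1, 0) t
      simpa [torusMk] using this)
    (fun t => by
      have := hasDerivAt_line (contDiff_dirDeriv hf.contDiff (1, 0)) (0, w) (1, 0) t
      have e : secondDerivLeft f ((t : AddCircle (2 * Real.pi / a)), _) = _ :=
        secondDerivLeft_torusMk hf (t, w)
      rw [e]
      simpa using this)
    (hf.secondDerivLeft.continuous.comp
      ((AddCircle.continuous_mk' _).prodMk continuous_const)) k.1 x₀.1
  have e1 : (2 * Real.pi * k.1 / (2 * Real.pi / a) : ℝ) = k.1 * a := by field_simp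
  rw [e1] at key
  simp only [expoAt_apply, mul_right_comm _ (fourier k.2 _ : ℂ)]
  rw [integral_mul_const, integral_mul_const, key, mul_assoc]

theorem integral_expoAt_mul_secondDerivRight (x₀ : Torus a) {f : Torus a → ℂ} (hf : IsSmooth f)
    (k : ℤ × ℤ) : ∫ x, expoAt a x₀ k x * secondDerivRight f x =
      -((k.2 / a : ℝ) : ℂ) ^ 2 * ∫ x, expoAt a x₀ k x * f x := by
  have ha := hFact.out
  have hc := (expoAt a x₀ k).continuous
  have hint1 : Integrable fun x => expoAt a x₀ k x * secondDerivRight f x :=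
    integrable_of_continuous (hc.mul hf.secondDerivRight.continuous)
  have hint2 : Integrable fun x => expoAt a x₀ k x * f x :=
    integrable_of_continuous (hc.mul hf.continuous)
  rw [Measure.volume_eq_prod] at hint1 hint2 ⊢
  rw [integral_prod _ hint1, integral_prod _ hint2, ← integral_const_mul]
  refine integral_congr_ae (Eventually.of_forall fun y => ?_)
  induction y using QuotientAddGroup.induction_on with
  | H w =>
  have key := integral_fourier_mul_deriv_deriv (T := 2 * Real.pi * a)
    (h := fun x => f ((w : AddCircle (2 * Real.pi / a)), x))
    (h₂ := fun x => secondDerivRight f ((w : AddCircle (2 * Real.pi / a)), x))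
    (h₁ := fun t => dirDeriv (fun v => f (torusMk a v)) (0, 1) (w, t))
    (fun t => by
      have := hasDerivAt_line hf.contDiff (w, 0) (0, 1) t
      simpa [torusMk] using this)
    (fun t => by
      have := hasDerivAt_line (contDiff_dirDeriv hf.contDiff (0, 1)) (w, 0) (0, 1) t
      have e : secondDerivRight f (_, (t : AddCircle (2 * Real.pi * a))) = _ :=
        secondDerivRight_torusMk hf (w, t)
      rw [e]
      simpa using this)
    (hf.secondDerivRight.continuous.comp
      (continuous_const.prodMk (AddCircle.continuous_mk' _))) k.2 x₀.2
  have e1 : (2 * Real.pi * k.2 / (2 * Real.pi * a) : ℝ) = k.2 / a := by field_simp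
  rw [e1] at key
  simp only [expoAt_apply, mul_assoc]
  rw [integral_const_mul, integral_const_mul, key]
  ring

theorem integral_expoAt_mul_neg_laplacian (x₀ : Torus a) {f : Torus a → ℂ} (hf : IsSmooth f)
    (k : ℤ × ℤ) : ∫ x, expoAt a x₀ k x * -laplacian f x =
      normSq a k * ∫ x, expoAt a x₀ k x * f x := by
  have hc := (expoAt a x₀ k).continuous
  have e : ∀ x, expoAt a x₀ k x * -laplacian f x =
      -(expoAt a x₀ k x * secondDerivLeft f x + expoAt a x₀ k x * secondDerivRight f x) := by
    intro x
    rw [laplacian_eq]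
    ring
  simp only [e]
  have hint1 : Integrable fun x => expoAt a x₀ k x * secondDerivLeft f x :=
    integrable_of_continuous (hc.mul hf.secondDerivLeft.continuous)
  have hint2 : Integrable fun x => expoAt a x₀ k x * secondDerivRight f x :=
    integrable_of_continuous (hc.mul hf.secondDerivRight.continuous)
  rw [integral_neg, integral_add hint1 hint2,
    integral_expoAt_mul_secondDerivLeft x₀ hf, integral_expoAt_mul_secondDerivRight x₀ hf, normSq]
  push_cast
  ring

theorem coeff_neg_laplacian (x₀ : Torus a) {f : Torus a → ℂ} (hf : IsSmooth f) {u v : L2 a}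
    (hu : u =ᵐ[volume] f) (hv : v =ᵐ[volume] fun x => -laplacian f x) (k : ℤ × ℤ) :
    coeff x₀ k v = normSq a k * coeff x₀ k u := by
  rw [coeff_eq_integral x₀ k hu, coeff_eq_integral x₀ k hv,
    integral_expoAt_mul_neg_laplacian x₀ hf, normSq_neg]
  ring

/-- The class in `L²` of a continuous function given without bundling. -/
noncomputable def classL2 (f : Torus a → ℂ) (hf : Continuous f) : L2 a := toL2 ⟨f, hf⟩

theorem coeFn_classL2 {f : Torus a → ℂ} (hf : Continuous f) : classL2 f hf =ᵐ[volume] f :=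
  ContinuousMap.coeFn_toLp (𝕜 := ℂ) (p := 2) volume ⟨f, hf⟩

/-- Sobolev embedding in dimension two: `û` is the product of `(1 + |ξ|²) û` and `(1 + |ξ|²)⁻¹`,
both square-summable. -/
theorem summable_norm_coeff_of_mul {x₀ : Torus a} {u v : L2 a}
    (h : ∀ k, coeff x₀ k v = normSq a k * coeff x₀ k u) :
    Summable fun k => ‖coeff x₀ k u‖ := by
  have h1 := summable_norm_coeff_sq x₀ (u + v)
  have h2 := summable_inv_one_add_normSq_sq hFact.out
  refine Summable.of_nonneg_of_le (fun k => norm_nonneg _) (fun k => ?_) (h1.add h2)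
  have hn := normSq_nonneg a k
  have e : ‖coeff x₀ k (u + v)‖ = (1 + normSq a k) * ‖coeff x₀ k u‖ := by
    rw [map_add, h, ← one_add_mul, norm_mul]
    congr 1
    rw [← Complex.ofReal_one, ← Complex.ofReal_add, Complex.norm_real,
      Real.norm_of_nonneg (by linarith)]
  rw [e]
  have e2 : ‖coeff x₀ k u‖ = ((1 + normSq a k) * ‖coeff x₀ k u‖) * (1 + normSq a k)⁻¹ := by
    field_simp
  rw [e2, ← inv_pow]
  set X := (1 + normSq a k) * ‖coeff x₀ k u‖
  have e3 : X * (1 + normSq a k)⁻¹ * (1 + normSq a k) = X := by field_simp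
  rw [mul_comm (1 + normSq a k) (X * _), e3]
  nlinarith [sq_nonneg (X - (1 + normSq a k)⁻¹), sq_nonneg X, sq_nonneg (1 + normSq a k)⁻¹]

theorem IsSmooth.summable_norm_coeff {x₀ : Torus a} {f : Torus a → ℂ} (hf : IsSmooth f) {u : L2 a}
    (hu : u =ᵐ[volume] f) : Summable fun k => ‖coeff x₀ k u‖ :=
  summable_norm_coeff_of_mul (coeff_neg_laplacian x₀ hf hu
    (coeFn_classL2 hf.laplacian.neg.continuous))

/-- The series converges uniformly to a continuous function with the same `L²` class as `f`;
continuous functions with equal classes coincide everywhere, in particular at `x₀`. -/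
theorem IsSmooth.hasSum_coeff_mul_expoAt {x₀ : Torus a} {f : Torus a → ℂ} (hf : IsSmooth f)
    {u : L2 a} (hu : u =ᵐ[volume] f) (x : Torus a) :
    HasSum (fun k => ((2 * Real.pi : ℝ) : ℂ)⁻¹ * coeff x₀ k u * expoAt a x₀ k x) (f x) := by
  set G : ℤ × ℤ → C(Torus a, ℂ) := fun k => (((2 * Real.pi : ℝ) : ℂ)⁻¹ * coeff x₀ k u) •
    expoAt a x₀ k with hG
  have hnorm : ∀ k, ‖expoAt a x₀ k‖ ≤ 1 := fun k =>
    (ContinuousMap.norm_le _ zero_le_one).mpr fun y => (norm_expoAt_apply x₀ k y).le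
  have hsum : Summable G := by
    refine Summable.of_norm_bounded
      ((hf.summable_norm_coeff hu (x₀ := x₀)).mul_left ‖((2 * Real.pi : ℝ) : ℂ)⁻¹‖) fun k => ?_
    rw [hG, norm_smul, norm_mul]
    exact mul_le_of_le_one_right (by positivity) (hnorm k)
  have hL2 : toL2 (∑' k, G k) = toL2 ⟨f, hf.continuous⟩ := by
    have h1 := hsum.hasSum.mapL (toL2 (a := a))
    have h2 : toL2 ⟨f, hf.continuous⟩ = u :=
      Lp.ext ((coeFn_classL2 hf.continuous).trans hu.symm)
    rw [h2]
    refine h1.unique ?_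
    convert hasSum_coeff x₀ u using 2 with k
    rw [hG, map_smul, unitExpo, smul_smul, mul_comm (coeff x₀ k u)]
  have heq : ∑' k, G k = ⟨f, hf.continuous⟩ :=
    ContinuousMap.toLp_injective (volume : Measure (Torus a)) hL2
  have h3 := hsum.hasSum.mapL (ContinuousMap.evalCLM ℂ x)
  rw [heq] at h3
  exact h3

end Laplacian

/-! ### The spectrum of the Laplacian -/

section Spectrum

variable {a : ℝ}

theorem expoAt_torusMk (s v : ℝ × ℝ) (k : ℤ × ℤ) : expoAt a (torusMk a s) k (torusMk a v) =
    Complex.exp (Complex.I * ((k.1 * a * (v.1 - s.1) + k.2 / a * (v.2 - s.2) : ℝ) : ℂ)) :=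
  expoAt_coe s v k

theorem isSmooth_expoAt (x₀ : Torus a) (k : ℤ × ℤ) : IsSmooth (expoAt a x₀ k) := by
  obtain ⟨s, rfl⟩ := exists_torusMk x₀
  have h : ContDiff ℝ ∞ fun v : ℝ × ℝ => Complex.exp
      (Complex.I * ((k.1 * a * (v.1 - s.1) + k.2 / a * (v.2 - s.2) : ℝ) : ℂ)) := by
    have h0 : ContDiff ℝ ∞ fun v : ℝ × ℝ => k.1 * a * (v.1 - s.1) + k.2 / a * (v.2 - s.2) := by
      fun_prop
    exact ContDiff.cexp (contDiff_const.mul (Complex.ofRealCLM.contDiff.comp h0))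
  have e : (fun v => expoAt a (torusMk a s) k (torusMk a v)) = fun v : ℝ × ℝ => Complex.exp
      (Complex.I * ((k.1 * a * (v.1 - s.1) + k.2 / a * (v.2 - s.2) : ℝ) : ℂ)) :=
    funext fun v => expoAt_torusMk s v k
  rw [← e] at h
  exact h

theorem iteratedDeriv_two_const_mul_cexp (c κ : ℂ) :
    iteratedDeriv 2 (fun t : ℝ => c * Complex.exp (κ * t)) 0 = κ ^ 2 * c := by
  have h : ∀ (c : ℂ) (t : ℝ), HasDerivAt (fun t : ℝ => c * Complex.exp (κ * t))
      (κ * c * Complex.exp (κ * t)) t := by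
    intro c t
    have h1 : HasDerivAt (fun z : ℂ => c * Complex.exp (κ * z)) (κ * c * Complex.exp (κ * t)) t := by
      refine ((((hasDerivAt_id (t : ℂ)).const_mul κ).cexp).const_mul c).congr_deriv ?_
      simp only [id, mul_one]
      ring
    exact h1.comp_ofReal
  rw [iteratedDeriv_succ, iteratedDeriv_one, funext fun t => (h c t).deriv, (h (κ * c) 0).deriv]
  simp
  ring

theorem laplacian_expoAt (x₀ : Torus a) (k : ℤ × ℤ) (x : Torus a) :
    -laplacian (expoAt a x₀ k) x = normSq a k * expoAt a x₀ k x := by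
  obtain ⟨s, rfl⟩ := exists_torusMk x₀
  obtain ⟨v, rfl⟩ := exists_torusMk x
  have e1 : secondDerivLeft (expoAt a (torusMk a s) k) (torusMk a v) =
      (Complex.I * (k.1 * a)) ^ 2 * expoAt a (torusMk a s) k (torusMk a v) := by
    simp only [secondDerivLeft, torusMk_add_left]
    rw [← iteratedDeriv_two_const_mul_cexp]
    congr 1
    funext t
    rw [expoAt_torusMk, expoAt_torusMk, ← Complex.exp_add]
    congr 1
    simp
    ring
  have e2 : secondDerivRight (expoAt a (torusMk a s) k) (torusMk a v) =
      (Complex.I * (k.2 / a)) ^ 2 * expoAt a (torusMk a s) k (torusMk a v) := by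
    simp only [secondDerivRight, torusMk_add_right]
    rw [← iteratedDeriv_two_const_mul_cexp]
    congr 1
    funext t
    rw [expoAt_torusMk, expoAt_torusMk, ← Complex.exp_add]
    congr 1
    simp
    ring
  rw [laplacian_eq, e1, e2, normSq]
  push_cast
  linear_combination (-((k.1 * a : ℂ) ^ 2 + (k.2 / a : ℂ) ^ 2) *
    expoAt a (torusMk a s) k (torusMk a v)) * Complex.I_sq

/-- If `t` is no norm, `(t - |ξ|²) û = 0` kills every coefficient of an eigenfunction, which then
vanishes by its pointwise Fourier series. Conversely the exponentials are eigenfunctions. -/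
theorem unperturbedSpectrum_eq [hFact : Fact (0 < a)] :
    unperturbedSpectrum a = Set.range (normSq a) := by
  ext t
  constructor
  · rintro ⟨f, hf, hne, heig⟩
    by_contra ht
    apply hne
    set u := classL2 f hf.continuous
    set v := classL2 _ hf.laplacian.neg.continuous
    have hu := coeFn_classL2 hf.continuous
    have hv := coeFn_classL2 hf.laplacian.neg.continuous
    have hvu : v = (t : ℂ) • u := by
      apply Lp.ext
      filter_upwards [hu, hv, Lp.coeFn_smul (t : ℂ) u] with x h1 h2 h3
      rw [h2, h3, Pi.smul_apply, h1, heig, smul_eq_mul]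
    have hzero : ∀ k, coeff (0 : Torus a) k u = 0 := by
      intro k
      have h1 := coeff_neg_laplacian (0 : Torus a) hf hu hv k
      change coeff 0 k v = _ * coeff 0 k u at h1
      rw [hvu, map_smul, smul_eq_mul] at h1
      have h2 : ((t - normSq a k : ℝ) : ℂ) * coeff (0 : Torus a) k u = 0 := by
        push_cast
        linear_combination h1
      rcases mul_eq_zero.mp h2 with h | h
      · exact absurd ⟨k, (sub_eq_zero.mp (by exact_mod_cast h)).symm⟩ ht
      · exact h
    funext x
    have h1 := hf.hasSum_coeff_mul_expoAt (x₀ := 0) hu x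
    have h2 : HasSum (fun k => ((2 * Real.pi : ℝ) : ℂ)⁻¹ * coeff (0 : Torus a) k u *
        expoAt a 0 k x) 0 := by
      simp only [hzero, mul_zero, zero_mul]
      exact hasSum_zero
    exact h1.unique h2
  · rintro ⟨k, rfl⟩
    refine ⟨expoAt a 0 k, isSmooth_expoAt 0 k, fun h => ?_, laplacian_expoAt 0 k⟩
    have := congrFun h (0 : Torus a)
    rw [expoAt_self] at this
    exact one_ne_zero this

end Spectrum

/-! ### Cutoffs near a point of the torus -/

theorem iteratedDeriv_two_mul_comp {χ χ₁ χ₂ : ℝ → ℝ} (hχ : ∀ s, HasDerivAt χ (χ₁ s) s)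
    (hχ₁ : ∀ s, HasDerivAt χ₁ (χ₂ s) s) {f f₁ : ℝ → ℂ} {f₂ : ℂ}
    (hf : ∀ t, HasDerivAt f (f₁ t) t) (hf₁ : HasDerivAt f₁ f₂ 0) {δ δ₁ : ℝ → ℝ} {δ₂ : ℝ}
    (hδ : ∀ t, HasDerivAt δ (δ₁ t) t) (hδ₁ : HasDerivAt δ₁ δ₂ 0) (e : ℝ) :
    iteratedDeriv 2 (fun t => f t * ((χ (δ t * e) : ℝ) : ℂ)) 0 =
      f₂ * ((χ (δ 0 * e) : ℝ) : ℂ) + 2 * f₁ 0 * ((χ₁ (δ 0 * e) * (δ₁ 0 * e) : ℝ) : ℂ) +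
        f 0 * ((χ₂ (δ 0 * e) * (δ₁ 0 * e) ^ 2 + χ₁ (δ 0 * e) * (δ₂ * e) : ℝ) : ℂ) := by
  have h1 : ∀ t, HasDerivAt (fun t => χ (δ t * e)) (χ₁ (δ t * e) * (δ₁ t * e)) t := fun t =>
    (hχ (δ t * e)).comp t ((hδ t).mul_const e)
  have h2 : HasDerivAt (fun t => χ₁ (δ t * e) * (δ₁ t * e))
      (χ₂ (δ 0 * e) * (δ₁ 0 * e) * (δ₁ 0 * e) + χ₁ (δ 0 * e) * (δ₂ * e)) 0 :=
    HasDerivAt.mul (HasDerivAt.comp (0 : ℝ) (hχ₁ (δ 0 * e)) ((hδ 0).mul_const e))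
      (hδ₁.mul_const e)
  have h3 : deriv (fun t => f t * ((χ (δ t * e) : ℝ) : ℂ)) = fun t =>
      f₁ t * ((χ (δ t * e) : ℝ) : ℂ) + f t * ((χ₁ (δ t * e) * (δ₁ t * e) : ℝ) : ℂ) :=
    funext fun t => ((hf t).mul (h1 t).ofReal_comp).deriv
  have h4 := ((hf₁.mul (h1 0).ofReal_comp).add ((hf 0).mul h2.ofReal_comp)).deriv
  rw [iteratedDeriv_succ, iteratedDeriv_one, h3]
  refine h4.trans ?_
  push_cast
  ring

/-- Bookkeeping for the second derivative of `f · χ(δ / r²)` at distance `O(r)` from the centre. The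
cutoff alone would cost `r⁻²`; `f₀ = O(r)` and `δ₁ = O(r)` gain one power and leave `O(r⁻¹)`. -/
theorem norm_two_derivs_le {f₀ f₁ f₂ : ℂ} {x₀ x₁ x₂ δ₁ δ₂ B M r : ℝ} (hM : 0 ≤ M)
    (hr : 0 < r) (hr1 : r ≤ 1) (hx₀ : |x₀| ≤ B) (hx₁ : |x₁| ≤ B) (hx₂ : |x₂| ≤ B)
    (hf₀ : ‖f₀‖ ≤ M * r) (hf₁ : ‖f₁‖ ≤ M) (hf₂ : ‖f₂‖ ≤ M) (hδ₁ : |δ₁| ≤ M * r) (hδ₂ : |δ₂| ≤ M) :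
    ‖f₂ * (x₀ : ℂ) + 2 * f₁ * ((x₁ * (δ₁ * (r ^ 2)⁻¹) : ℝ) : ℂ) +
        f₀ * ((x₂ * (δ₁ * (r ^ 2)⁻¹) ^ 2 + x₁ * (δ₂ * (r ^ 2)⁻¹) : ℝ) : ℂ)‖ ≤
      B * (M + 3 * M ^ 2 + M ^ 3) * r⁻¹ := by
  have hB : 0 ≤ B := (abs_nonneg _).trans hx₀
  have b1 : |δ₁ * (r ^ 2)⁻¹| ≤ M * r⁻¹ := by
    rw [abs_mul, abs_of_pos (by positivity : 0 < (r ^ 2)⁻¹)]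
    calc _ ≤ M * r * (r ^ 2)⁻¹ := by gcongr
      _ = _ := by field_simp
  have b2 : |δ₂ * (r ^ 2)⁻¹| ≤ M * (r ^ 2)⁻¹ := by
    rw [abs_mul, abs_of_pos (by positivity : 0 < (r ^ 2)⁻¹)]
    gcongr
  have b3 : |x₁ * (δ₁ * (r ^ 2)⁻¹)| ≤ B * (M * r⁻¹) := by
    rw [abs_mul]; gcongr
  have b4 : |x₂ * (δ₁ * (r ^ 2)⁻¹) ^ 2 + x₁ * (δ₂ * (r ^ 2)⁻¹)| ≤
      B * (M * r⁻¹) ^ 2 + B * (M * (r ^ 2)⁻¹) := by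
    refine (abs_add_le _ _).trans ?_
    rw [abs_mul, abs_mul x₁, abs_pow]
    gcongr
  refine (norm_add₃_le).trans ?_
  rw [norm_mul f₂, norm_mul (2 * f₁), norm_mul 2, norm_mul f₀, Complex.norm_real, Complex.norm_real,
    Complex.norm_real, Real.norm_eq_abs, Real.norm_eq_abs, Real.norm_eq_abs, Complex.norm_ofNat]
  calc _ ≤ M * B + 2 * M * (B * (M * r⁻¹)) +
        M * r * (B * (M * r⁻¹) ^ 2 + B * (M * (r ^ 2)⁻¹)) := by gcongr
    _ = M * B + B * (3 * M ^ 2 + M ^ 3) * r⁻¹ := by field_simp; ring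
    _ ≤ M * B * r⁻¹ + B * (3 * M ^ 2 + M ^ 3) * r⁻¹ := by
      have : M * B ≤ M * B * r⁻¹ :=
        le_mul_of_one_le_right (by positivity) (one_le_inv_iff₀.mpr ⟨hr, hr1⟩)
      linarith
    _ = _ := by ring

theorem norm_zpow_sub_one_le {z : ℂ} (hz : ‖z‖ = 1) (n : ℤ) : ‖z ^ n - 1‖ ≤ |(n : ℝ)| * ‖z - 1‖ := by
  have hnat : ∀ n : ℕ, ‖z ^ n - 1‖ ≤ n * ‖z - 1‖ := by
    intro n
    induction n with
    | zero => simp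
    | succ n ih =>
      have e : z ^ (n + 1) - 1 = z * (z ^ n - 1) + (z - 1) := by ring
      rw [e]
      refine (norm_add_le _ _).trans ?_
      rw [norm_mul, hz, one_mul]
      push_cast
      linarith
  have hz0 : z ≠ 0 := by
    intro h
    rw [h, norm_zero] at hz
    exact zero_ne_one hz
  obtain ⟨m, rfl | rfl⟩ := n.eq_nat_or_neg
  · simpa using hnat m
  · have e : z ^ (-(m : ℤ)) - 1 = -((z ^ m)⁻¹ * (z ^ m - 1)) := by
      rw [zpow_neg, zpow_natCast]
      have : z ^ m ≠ 0 := pow_ne_zero _ hz0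
      field_simp
      ring
    rw [e, norm_neg, norm_mul, norm_inv, norm_pow, hz, one_pow, inv_one, one_mul]
    simpa using hnat m

theorem norm_cexp_I_mul_sub_one_sq (θ : ℝ) :
    ‖Complex.exp (Complex.I * θ) - 1‖ ^ 2 = 2 * (1 - Real.cos θ) := by
  rw [mul_comm, Complex.exp_mul_I, ← Complex.normSq_eq_norm_sq, Complex.normSq_apply]
  simp
  rw [Complex.cos_ofReal_re, Complex.sin_ofReal_re]
  nlinarith [Real.sin_sq_add_cos_sq θ]

/-- The quantitative vanishing at `x₀`: `|e_ξ - 1|²` is bounded by a multiple of the squared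
distance. -/
theorem norm_cexp_sub_one_sq_le (p q : ℤ) (θ η : ℝ) :
    ‖Complex.exp (Complex.I * ((q * θ + p * η : ℝ) : ℂ)) - 1‖ ^ 2 ≤
      4 * ((q : ℝ) ^ 2 + (p : ℝ) ^ 2) * (2 - Real.cos θ - Real.cos η) := by
  set z := Complex.exp (Complex.I * θ) with hz
  set w := Complex.exp (Complex.I * η) with hw
  have hz1 : ‖z‖ = 1 := by rw [hz, mul_comm]; exact Complex.norm_exp_ofReal_mul_I θ
  have hw1 : ‖w‖ = 1 := by rw [hw, mul_comm]; exact Complex.norm_exp_ofReal_mul_I η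
  have e : Complex.exp (Complex.I * ((q * θ + p * η : ℝ) : ℂ)) - 1 =
      z ^ q * (w ^ p - 1) + (z ^ q - 1) := by
    rw [mul_sub, mul_one, hz, hw, ← Complex.exp_int_mul, ← Complex.exp_int_mul, ← Complex.exp_add]
    push_cast
    ring_nf
  rw [e]
  have h1 := norm_zpow_sub_one_le hz1 q
  have h2 := norm_zpow_sub_one_le hw1 p
  have hz2 := norm_cexp_I_mul_sub_one_sq θ
  have hw2 := norm_cexp_I_mul_sub_one_sq η
  rw [← hz] at hz2
  rw [← hw] at hw2
  have h3 : ‖z ^ q * (w ^ p - 1) + (z ^ q - 1)‖ ≤ |(p : ℝ)| * ‖w - 1‖ + |(q : ℝ)| * ‖z - 1‖ := by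
    refine (norm_add_le _ _).trans (add_le_add ?_ h1)
    rw [norm_mul, norm_zpow, hz1, one_zpow, one_mul]
    exact h2
  have c1 := Real.cos_le_one θ
  have c2 := Real.cos_le_one η
  calc _ ≤ (|(p : ℝ)| * ‖w - 1‖ + |(q : ℝ)| * ‖z - 1‖) ^ 2 := by gcongr
    _ ≤ 2 * ((|(p : ℝ)| * ‖w - 1‖) ^ 2 + (|(q : ℝ)| * ‖z - 1‖) ^ 2) := add_sq_le
    _ = 4 * ((p : ℝ) ^ 2 * (1 - Real.cos η) + (q : ℝ) ^ 2 * (1 - Real.cos θ)) := by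
      rw [mul_pow, mul_pow, sq_abs, sq_abs, hz2, hw2]; ring
    _ ≤ _ := by nlinarith [sq_nonneg (p : ℝ), sq_nonneg (q : ℝ)]

/-- A smooth compactly supported function equal to one on `[-1, 1]` and to zero beyond `2`, with its
first two derivatives. -/
theorem exists_cutoff : ∃ χ χ₁ χ₂ : ℝ → ℝ, ∃ B : ℝ, ContDiff ℝ ∞ χ ∧
    (∀ s, HasDerivAt χ (χ₁ s) s) ∧ (∀ s, HasDerivAt χ₁ (χ₂ s) s) ∧
    (∀ s, |χ s| ≤ B ∧ |χ₁ s| ≤ B ∧ |χ₂ s| ≤ B) ∧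
    (∀ s, 2 < s → χ s = 0 ∧ χ₁ s = 0 ∧ χ₂ s = 0) ∧ ∀ s, |s| ≤ 1 → χ s = 1 := by
  let ψ : ContDiffBump (0 : ℝ) := ⟨1, 2, by norm_num, by norm_num⟩
  have h0 : ContDiff ℝ ∞ ψ := ψ.contDiff
  have h1 : ContDiff ℝ ∞ (deriv ψ) := (contDiff_infty_iff_deriv.mp h0).2
  have h2 : ContDiff ℝ ∞ (deriv (deriv ψ)) := (contDiff_infty_iff_deriv.mp h1).2
  have s0 : HasCompactSupport ψ := ψ.hasCompactSupport
  obtain ⟨B₀, hB₀⟩ := s0.exists_bound_of_continuous h0.continuous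
  obtain ⟨B₁, hB₁⟩ := s0.deriv.exists_bound_of_continuous h1.continuous
  obtain ⟨B₂, hB₂⟩ := s0.deriv.deriv.exists_bound_of_continuous h2.continuous
  have hts : tsupport ψ = Metric.closedBall 0 2 := ψ.tsupport_eq
  have hzero : ∀ s : ℝ, 2 < s → s ∉ tsupport ψ := by
    intro s hs h
    rw [hts, Metric.mem_closedBall, Real.dist_eq, sub_zero] at h
    have := le_abs_self s
    linarith
  refine ⟨ψ, deriv ψ, deriv (deriv ψ), max B₀ (max B₁ B₂), h0,
    fun s => (h0.differentiable (by simp) s).hasDerivAt,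
    fun s => (h1.differentiable (by simp) s).hasDerivAt,
    fun s => ⟨(hB₀ s).trans (le_max_left _ _),
      (hB₁ s).trans ((le_max_left _ _).trans (le_max_right _ _)),
      (hB₂ s).trans ((le_max_right _ _).trans (le_max_right _ _))⟩, fun s hs => ⟨?_, ?_, ?_⟩,
    fun s hs => ψ.one_of_mem_closedBall (by
      rw [Metric.mem_closedBall, Real.dist_eq, sub_zero]; exact hs)⟩
  · exact image_eq_zero_of_notMem_tsupport (hzero s hs)
  · exact Function.notMem_support.mp fun h => hzero s hs (support_deriv_subset h)
  · refine Function.notMem_support.mp fun h => hzero s hs ?_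
    exact closure_minimal support_deriv_subset (isClosed_tsupport _) (support_deriv_subset h)

/-! ### Squared distance to `x₀`, and functions concentrated near it. -/

section Concentration

variable {a : ℝ}

/-- A smooth function on the torus comparable to the squared distance to `x₀`. -/
noncomputable def sqDist (x₀ x : Torus a) : ℝ :=
  2 - (expoAt a x₀ (1, 0) x).re - (expoAt a x₀ (0, 1) x).re

theorem sqDist_torusMk (s v : ℝ × ℝ) : sqDist (torusMk a s) (torusMk a v) =
    2 - Real.cos (a * (v.1 - s.1)) - Real.cos (a⁻¹ * (v.2 - s.2)) := by
  have h : ∀ θ : ℝ, (Complex.exp (Complex.I * (θ : ℂ))).re = Real.cos θ := by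
    intro θ
    rw [mul_comm, Complex.exp_ofReal_mul_I_re]
  rw [sqDist, expoAt_torusMk, expoAt_torusMk, h, h]
  simp [div_eq_inv_mul]

theorem sqDist_self (x₀ : Torus a) : sqDist x₀ x₀ = 0 := by
  rw [sqDist, expoAt_self, expoAt_self]; norm_num

theorem continuous_sqDist (x₀ : Torus a) : Continuous (sqDist x₀) := by
  unfold sqDist
  fun_prop

theorem contDiff_sqDist (x₀ : Torus a) : ContDiff ℝ ∞ fun v => sqDist x₀ (torusMk a v) := by
  obtain ⟨s, rfl⟩ := exists_torusMk x₀
  simp only [sqDist_torusMk]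
  fun_prop

theorem sqDist_nonneg (x₀ x : Torus a) : 0 ≤ sqDist x₀ x := by
  obtain ⟨s, rfl⟩ := exists_torusMk x₀
  obtain ⟨v, rfl⟩ := exists_torusMk x
  rw [sqDist_torusMk]
  have h1 := Real.cos_le_one (a * (v.1 - s.1))
  have h2 := Real.cos_le_one (a⁻¹ * (v.2 - s.2))
  linarith

/-- From `1 - cos θ ≥ 2 θ² / π²` on `[-π, π]`, applied to a representative in the fundamental
interval. It confines the sublevel sets of `sqDist` to products of small arcs. -/
theorem norm_sq_le_one_sub_re_fourier {T : ℝ} [hT : Fact (0 < T)] (y : AddCircle T) :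
    8 * (‖y‖ / T) ^ 2 ≤ 1 - (fourier 1 y : ℂ).re := by
  have hT0 := hT.out
  have hy : y ∈ QuotientAddGroup.mk '' Set.Icc (-(T / 2)) (-(T / 2) + T) := by
    rw [AddCircle.coe_image_Icc_eq]; trivial
  obtain ⟨t, ht, rfl⟩ := hy
  have hpi := Real.pi_pos
  have e : (fourier 1 (t : AddCircle T) : ℂ).re = Real.cos (2 * Real.pi * t / T) := by
    rw [fourier_coe_apply, ← Complex.exp_ofReal_mul_I_re]
    congr 2
    push_cast
    ring
  have habs : |2 * Real.pi * t / T| ≤ Real.pi := by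
    have : |t| ≤ T / 2 := abs_le.mpr ⟨ht.1, by linarith [ht.2]⟩
    rw [abs_div, abs_mul, abs_of_pos hT0, abs_of_pos (by positivity : 0 < 2 * Real.pi),
      div_le_iff₀ hT0]
    nlinarith
  have h1 := Real.cos_le_one_sub_mul_cos_sq habs
  have h2 : 2 / Real.pi ^ 2 * (2 * Real.pi * t / T) ^ 2 = 8 * (|t| / T) ^ 2 := by
    rw [div_pow |t|, sq_abs]
    field_simp
    ring
  have h3 : ‖(t : AddCircle T)‖ ≤ |t| := QuotientAddGroup.norm_mk_le_norm
  change 8 * (‖(t : AddCircle T)‖ / T) ^ 2 ≤ 1 - (fourier 1 (t : AddCircle T) : ℂ).re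
  rw [e]
  calc _ ≤ 8 * (|t| / T) ^ 2 := by gcongr
    _ ≤ _ := by linarith

variable [hFact : Fact (0 < a)]

theorem volume_sqDist_le (x₀ : Torus a) {r : ℝ} (hr : 0 ≤ r) :
    (volume : Measure (Torus a)).real {x | sqDist x₀ x ≤ 2 * r ^ 2} ≤ 4 * Real.pi ^ 2 * r ^ 2 := by
  have ha := hFact.out
  set T₁ := 2 * Real.pi / a
  set T₂ := 2 * Real.pi * a
  have hT₁ : 0 < T₁ := div_pos Real.two_pi_pos ha
  have hT₂ : 0 < T₂ := mul_pos Real.two_pi_pos ha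
  have hsub : {x : Torus a | sqDist x₀ x ≤ 2 * r ^ 2} ⊆
      Metric.closedBall x₀.1 (T₁ * r / 2) ×ˢ Metric.closedBall x₀.2 (T₂ * r / 2) := by
    intro x hx
    have hx : sqDist x₀ x ≤ 2 * r ^ 2 := hx
    have h1 := norm_sq_le_one_sub_re_fourier (x.1 - x₀.1)
    have h2 := norm_sq_le_one_sub_re_fourier (x.2 - x₀.2)
    change 8 * (_ / T₁) ^ 2 ≤ _ at h1
    change 8 * (_ / T₂) ^ 2 ≤ _ at h2
    have e : sqDist x₀ x = (1 - (fourier 1 (x.1 - x₀.1) : ℂ).re) +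
        (1 - (fourier 1 (x.2 - x₀.2) : ℂ).re) := by
      simp only [sqDist, expoAt_apply, fourier_zero, mul_one, one_mul]
      ring
    have p1 : 0 ≤ 8 * (‖x.1 - x₀.1‖ / T₁) ^ 2 := by positivity
    have p2 : 0 ≤ 8 * (‖x.2 - x₀.2‖ / T₂) ^ 2 := by positivity
    have q1 : ‖x.1 - x₀.1‖ / T₁ ≤ r / 2 := by
      refine abs_le_of_sq_le_sq' (by nlinarith) (by positivity) |>.2
    have q2 : ‖x.2 - x₀.2‖ / T₂ ≤ r / 2 := by
      refine abs_le_of_sq_le_sq' (by nlinarith) (by positivity) |>.2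
    rw [div_le_iff₀ hT₁] at q1
    rw [div_le_iff₀ hT₂] at q2
    refine ⟨?_, ?_⟩
    · rw [Metric.mem_closedBall, dist_eq_norm]; linarith
    · rw [Metric.mem_closedBall, dist_eq_norm]; linarith
  refine (measureReal_mono hsub).trans ?_
  rw [Measure.volume_eq_prod, Measure.real, Measure.prod_prod, AddCircle.volume_closedBall,
    AddCircle.volume_closedBall, ← ENNReal.ofReal_mul (by positivity),
    ENNReal.toReal_ofReal (by positivity)]
  calc _ ≤ (2 * (T₁ * r / 2)) * (2 * (T₂ * r / 2)) := by
        gcongr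
        · exact min_le_right _ _
        · exact min_le_right _ _
    _ = (T₁ * T₂) * r ^ 2 := by ring
    _ = _ := by
      congr 1
      simp only [T₁, T₂]
      field_simp
      norm_num

theorem integral_le_of_concentrated (x₀ : Torus a) {r C : ℝ} (hr : 0 ≤ r) {g : Torus a → ℝ}
    (hC : 0 ≤ C) (hgc : Continuous g) (hg : ∀ x, g x ≤ C) (hg0 : ∀ x, 2 * r ^ 2 < sqDist x₀ x → g x = 0) :
    ∫ x, g x ≤ C * (4 * Real.pi ^ 2 * r ^ 2) := by
  have hmeas : MeasurableSet {x | sqDist x₀ x ≤ 2 * r ^ 2} :=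
    (isClosed_le (continuous_sqDist x₀) continuous_const).measurableSet
  calc ∫ x, g x ≤ ∫ x, {x | sqDist x₀ x ≤ 2 * r ^ 2}.indicator (fun _ => C) x := by
        refine integral_mono (hgc.integrable_of_hasCompactSupport
          (HasCompactSupport.of_compactSpace g)) ((integrable_const C).indicator hmeas) fun x => ?_
        by_cases hx : sqDist x₀ x ≤ 2 * r ^ 2
        · rw [Set.indicator_of_mem (by exact hx)]; exact hg x
        · rw [Set.indicator_of_notMem (by exact hx), hg0 x (not_le.mp hx)]
    _ = (volume : Measure (Torus a)).real {x | sqDist x₀ x ≤ 2 * r ^ 2} * C := by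
        rw [integral_indicator_const C hmeas, smul_eq_mul]
    _ ≤ 4 * Real.pi ^ 2 * r ^ 2 * C := by gcongr; exact volume_sqDist_le x₀ hr
    _ = _ := by ring

theorem norm_classL2_sq {f : Torus a → ℂ} (hf : Continuous f) :
    ‖classL2 f hf‖ ^ 2 = ∫ x, ‖f x‖ ^ 2 := by
  have h := inner_self_eq_norm_sq_to_K (𝕜 := ℂ) (classL2 f hf)
  rw [classL2, ContinuousMap.inner_toLp] at h
  have e : ∀ x, (⟨f, hf⟩ : C(Torus a, ℂ)) x * (starRingEnd ℂ) ((⟨f, hf⟩ : C(Torus a, ℂ)) x) =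
      ((‖f x‖ ^ 2 : ℝ) : ℂ) := fun x => by
    rw [Complex.mul_conj, Complex.normSq_eq_norm_sq]; rfl
  simp only [e] at h
  rw [integral_complex_ofReal] at h
  have h2 : ((∫ x, ‖f x‖ ^ 2 : ℝ) : ℂ) = ((‖classL2 f hf‖ ^ 2 : ℝ) : ℂ) := by
    rw [h, classL2]; push_cast; rfl
  exact (Complex.ofReal_injective h2).symm

/-- A function of size `O(r⁻¹)` on a set of area `O(r²)` is bounded in `L²`, but not small there.
The next bound shows that its `L¹` norm, and so every Fourier coefficient, is `O(r)`. -/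
theorem norm_classL2_le_of_concentrated (x₀ : Torus a) {r C : ℝ} (hr : 0 < r) (hC : 0 ≤ C)
    {f : Torus a → ℂ} (hf : Continuous f) (hb : ∀ x, ‖f x‖ ≤ C * r⁻¹)
    (h0 : ∀ x, 2 * r ^ 2 < sqDist x₀ x → f x = 0) : ‖classL2 f hf‖ ≤ C * (2 * Real.pi) := by
  have hpi := Real.pi_pos
  refine (abs_le_of_sq_le_sq' ?_ (by positivity)).2
  rw [norm_classL2_sq]
  refine (integral_le_of_concentrated x₀ hr.le (C := (C * r⁻¹) ^ 2) (by positivity) (by fun_prop)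
    (fun x => ?_) (fun x hx => ?_)).trans (le_of_eq ?_)
  · exact pow_le_pow_left₀ (norm_nonneg _) (hb x) 2
  · rw [h0 x hx]; simp
  · field_simp
    norm_num

theorem norm_coeff_classL2_le_of_concentrated (x₀ : Torus a) {r C : ℝ} (hr : 0 < r) (hC : 0 ≤ C)
    {f : Torus a → ℂ} (hf : Continuous f) (hb : ∀ x, ‖f x‖ ≤ C * r⁻¹)
    (h0 : ∀ x, 2 * r ^ 2 < sqDist x₀ x → f x = 0) (k : ℤ × ℤ) :
    ‖coeff x₀ k (classL2 f hf)‖ ≤ C * (2 * Real.pi) * r := by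
  have hpi := Real.pi_pos
  rw [coeff_eq_integral x₀ k (coeFn_classL2 hf), norm_mul, norm_inv, Complex.norm_real,
    Real.norm_of_nonneg (by positivity)]
  have h1 : ‖∫ x, expoAt a x₀ (-k) x * f x‖ ≤ C * r⁻¹ * (4 * Real.pi ^ 2 * r ^ 2) := by
    refine (norm_integral_le_integral_norm _).trans ?_
    simp only [norm_mul, norm_expoAt_apply, one_mul]
    exact integral_le_of_concentrated x₀ hr.le (by positivity) (by fun_prop) hb
      (fun x hx => by rw [h0 x hx, norm_zero])
  calc _ ≤ (2 * Real.pi)⁻¹ * (C * r⁻¹ * (4 * Real.pi ^ 2 * r ^ 2)) := by gcongr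
    _ = _ := by field_simp; ring

/-- Bounded sequences in `L²` whose coefficients tend to zero tend weakly to zero. -/
theorem tendsto_clm_of_coeff {x₀ : Torus a} {w : ℕ → L2 a} {B : ℝ} (hB : ∀ n, ‖w n‖ ≤ B)
    (hw : ∀ k, Tendsto (fun n => coeff x₀ k (w n)) atTop (𝓝 0)) (ℓ : L2 a →L[ℂ] ℂ) :
    Tendsto (fun n => ℓ (w n)) atTop (𝓝 0) := by
  have hB0 : 0 ≤ B := (norm_nonneg _).trans (hB 0)
  set v := (InnerProductSpace.toDual ℂ (L2 a)).symm ℓ with hv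
  have hℓ : ∀ u, ℓ u = inner ℂ v u := fun u => by
    rw [hv, InnerProductSpace.toDual_symm_apply]
  have hspan : ∀ u ∈ Submodule.span ℂ (Set.range (unitExpo x₀)),
      Tendsto (fun n => inner ℂ u (w n)) atTop (𝓝 0) := by
    intro u hu
    induction hu using Submodule.span_induction with
    | mem u hu =>
      obtain ⟨k, rfl⟩ := hu
      exact hw k
    | zero => simp
    | add u u' _ _ h h' =>
      simp only [inner_add_left]
      simpa using h.add h'
    | smul c u _ h =>
      simp only [inner_smul_left]
      simpa using h.const_mul _
  rw [Metric.tendsto_atTop]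
  intro ε hε
  have hvcl : v ∈ closure (Submodule.span ℂ (Set.range (unitExpo x₀)) : Set (L2 a)) := by
    have := span_unitExpo_closure_eq_top x₀
    rw [← Submodule.topologicalClosure_coe, this]
    trivial
  -- Boundedness of `w` permits replacing `v` by a finite combination of exponentials; `B + 1` keeps
  -- the denominator positive when `B = 0`.
  obtain ⟨u, hu, huv⟩ := Metric.mem_closure_iff.mp hvcl (ε / (2 * (B + 1))) (by positivity)
  obtain ⟨N, hN⟩ := Metric.tendsto_atTop.mp (hspan u hu) (ε / 2) (by positivity)
  refine ⟨N, fun n hn => ?_⟩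
  have h1 := hN n hn
  rw [dist_zero_right] at h1 ⊢
  rw [hℓ]
  have e : inner ℂ v (w n) = inner ℂ (v - u) (w n) + inner ℂ u (w n) := by
    rw [inner_sub_left]; ring
  rw [e]
  have h2 : ‖inner ℂ (v - u) (w n)‖ ≤ ε / (2 * (B + 1)) * B := by
    refine (norm_inner_le_norm _ _).trans ?_
    rw [dist_eq_norm] at huv
    gcongr
    exact hB n
  have h3 : ε / (2 * (B + 1)) * B ≤ ε / 2 := by
    rw [div_mul_eq_mul_div, div_le_div_iff₀ (by positivity) (by norm_num)]
    nlinarith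
  calc _ ≤ _ := norm_add_le _ _
    _ < ε := by linarith

end Concentration

/-! ### The closure of the restricted Laplacian -/

/-- One coordinate direction of the Laplacian of `(e_ξ - 1) χ(sqDist / r²)`, uniformly in the other
coordinate, which enters through `η`. It serves both directions, with `b = a` and `b = a⁻¹`. -/
theorem norm_iteratedDeriv_two_slice_le {χ χ₁ χ₂ : ℝ → ℝ} {B : ℝ}
    (hχ : ∀ s, HasDerivAt χ (χ₁ s) s) (hχ₁ : ∀ s, HasDerivAt χ₁ (χ₂ s) s)
    (hB : ∀ s, |χ s| ≤ B ∧ |χ₁ s| ≤ B ∧ |χ₂ s| ≤ B)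
    (h0 : ∀ s, 2 < s → χ s = 0 ∧ χ₁ s = 0 ∧ χ₂ s = 0) {b : ℝ} (hb : 0 < b) (q p : ℤ) :
    ∃ C : ℝ, 0 ≤ C ∧ ∀ (y η r : ℝ), 0 < r → r ≤ 1 →
      ‖iteratedDeriv 2 (fun t : ℝ =>
        (Complex.exp (Complex.I * ((q * (b * (y + t)) + p * η : ℝ) : ℂ)) - 1) *
          ((χ ((2 - Real.cos (b * (y + t)) - Real.cos η) * (r ^ 2)⁻¹) : ℝ) : ℂ)) 0‖ ≤ C * r⁻¹ ∧
      (2 * r ^ 2 < 2 - Real.cos (b * y) - Real.cos η → iteratedDeriv 2 (fun t : ℝ =>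
        (Complex.exp (Complex.I * ((q * (b * (y + t)) + p * η : ℝ) : ℂ)) - 1) *
          ((χ ((2 - Real.cos (b * (y + t)) - Real.cos η) * (r ^ 2)⁻¹) : ℝ) : ℂ)) 0 = 0) := by
  have hB0 : 0 ≤ B := (abs_nonneg _).trans (hB 0).1
  set M : ℝ := 3 * (|(q : ℝ)| + |(p : ℝ)|) + |(q : ℝ)| * b + (|(q : ℝ)| * b) ^ 2 + 2 * b + b ^ 2
    with hM
  have hM0 : 0 ≤ M := by positivity
  have m1 : 3 * (|(q : ℝ)| + |(p : ℝ)|) ≤ M := by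
    have : 0 ≤ |(q : ℝ)| * b + (|(q : ℝ)| * b) ^ 2 + 2 * b + b ^ 2 := by positivity
    linarith
  have m2 : |(q : ℝ)| * b ≤ M := by
    have : 0 ≤ 3 * (|(q : ℝ)| + |(p : ℝ)|) + (|(q : ℝ)| * b) ^ 2 + 2 * b + b ^ 2 := by positivity
    linarith
  have m3 : (|(q : ℝ)| * b) ^ 2 ≤ M := by
    have : 0 ≤ 3 * (|(q : ℝ)| + |(p : ℝ)|) + |(q : ℝ)| * b + 2 * b + b ^ 2 := by positivity
    linarith
  have m4 : 2 * b ≤ M := by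
    have : 0 ≤ 3 * (|(q : ℝ)| + |(p : ℝ)|) + |(q : ℝ)| * b + (|(q : ℝ)| * b) ^ 2 + b ^ 2 := by
      positivity
    linarith
  have m5 : b ^ 2 ≤ M := by
    have : 0 ≤ 3 * (|(q : ℝ)| + |(p : ℝ)|) + |(q : ℝ)| * b + (|(q : ℝ)| * b) ^ 2 + 2 * b := by
      positivity
    linarith
  refine ⟨B * (M + 3 * M ^ 2 + M ^ 3), by positivity, fun y η r hr hr1 => ?_⟩
  set f₁ : ℝ → ℂ := fun t => Complex.I * (q * b) *
    Complex.exp (Complex.I * ((q * (b * (y + t)) + p * η : ℝ) : ℂ)) with hf₁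
  set δ₁ : ℝ → ℝ := fun t => b * Real.sin (b * (y + t)) with hδ₁
  have hexp : ∀ t : ℝ, HasDerivAt
      (fun t : ℝ => Complex.exp (Complex.I * ((q * (b * (y + t)) + p * η : ℝ) : ℂ))) (f₁ t) t := by
    intro t
    have h1 : HasDerivAt (fun t : ℝ => q * (b * (y + t)) + p * η) (q * (b * 1)) t :=
      ((((hasDerivAt_id t).const_add y).const_mul b).const_mul (q : ℝ)).add_const _
    refine ((h1.ofReal_comp.const_mul Complex.I).cexp).congr_deriv ?_
    simp only [hf₁]
    push_cast
    ring
  have hf : ∀ t : ℝ, HasDerivAt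
      (fun t : ℝ => Complex.exp (Complex.I * ((q * (b * (y + t)) + p * η : ℝ) : ℂ)) - 1) (f₁ t) t :=
    fun t => (hexp t).sub_const 1
  have hf₁' : HasDerivAt f₁ (Complex.I * (q * b) * f₁ 0) 0 := (hexp 0).const_mul _
  have hlin : ∀ t : ℝ, HasDerivAt (fun t : ℝ => b * (y + t)) b t := fun t => by
    simpa using ((hasDerivAt_id t).const_add y).const_mul b
  have hδ : ∀ t : ℝ, HasDerivAt (fun t : ℝ => 2 - Real.cos (b * (y + t)) - Real.cos η) (δ₁ t) t := by
    intro t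
    refine (((hlin t).cos.const_sub 2).sub_const _).congr_deriv ?_
    simp only [hδ₁]
    ring
  have hδ₁' : HasDerivAt δ₁ (b * (Real.cos (b * (y + 0)) * b)) 0 := (hlin 0).sin.const_mul b
  rw [iteratedDeriv_two_mul_comp hχ hχ₁ hf hf₁' hδ hδ₁' ((r ^ 2)⁻¹)]
  by_cases hlt : 2 * r ^ 2 < 2 - Real.cos (b * y) - Real.cos η
  · have hs : 2 < (2 - Real.cos (b * (y + 0)) - Real.cos η) * (r ^ 2)⁻¹ := by
      rw [add_zero, ← div_eq_mul_inv, lt_div_iff₀ (by positivity)]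
      exact hlt
    obtain ⟨e0, e1, e2⟩ := h0 _ hs
    have hC : 0 ≤ B * (M + 3 * M ^ 2 + M ^ 3) * r⁻¹ := by positivity
    rw [e0, e1, e2]
    simp [hC]
  · refine ⟨?_, fun h => absurd h hlt⟩
    have hle := not_lt.mp hlt
    have c1 := Real.cos_le_one (b * y)
    have c2 := Real.cos_le_one η
    have hnormexp : ‖Complex.exp (Complex.I * ((q * (b * (y + 0)) + p * η : ℝ) : ℂ))‖ = 1 := by
      rw [mul_comm]; exact Complex.norm_exp_ofReal_mul_I _
    have hnf₁ : ‖f₁ 0‖ = |(q : ℝ)| * b := by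
      simp only [hf₁]
      rw [norm_mul, hnormexp, mul_one, norm_mul, Complex.norm_I, one_mul, norm_mul,
        Complex.norm_intCast, Complex.norm_real, Real.norm_of_nonneg hb.le]
    refine norm_two_derivs_le hM0 hr hr1 (hB _).1 (hB _).2.1 (hB _).2.2 ?_ (hnf₁.trans_le m2) ?_ ?_ ?_
    · refine le_trans ?_ (mul_le_mul_of_nonneg_right m1 hr.le)
      refine (abs_le_of_sq_le_sq' ?_ (by positivity)).2
      refine (norm_cexp_sub_one_sq_le p q _ η).trans ?_
      rw [add_zero]
      have hpq : (q : ℝ) ^ 2 + (p : ℝ) ^ 2 ≤ (|(q : ℝ)| + |(p : ℝ)|) ^ 2 := by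
        have := mul_nonneg (abs_nonneg (q : ℝ)) (abs_nonneg (p : ℝ))
        nlinarith [sq_abs (q : ℝ), sq_abs (p : ℝ)]
      -- Here the constant `3` in `M` is used: `4 · 2 = 8 ≤ 9`.
      calc _ ≤ 4 * (|(q : ℝ)| + |(p : ℝ)|) ^ 2 * (2 * r ^ 2) :=
            mul_le_mul (mul_le_mul_of_nonneg_left hpq (by norm_num)) (by linarith)
              (by linarith [Real.cos_le_one (b * y), Real.cos_le_one η]) (by positivity)
        _ ≤ (3 * (|(q : ℝ)| + |(p : ℝ)|) * r) ^ 2 := by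
          nlinarith [mul_nonneg (sq_nonneg (|(q : ℝ)| + |(p : ℝ)|)) (sq_nonneg r)]
    · rw [norm_mul, hnf₁, norm_mul, Complex.norm_I, one_mul, norm_mul,
        Complex.norm_intCast, Complex.norm_real, Real.norm_of_nonneg hb.le, ← sq]
      exact m3
    · refine le_trans ?_ (mul_le_mul_of_nonneg_right m4 hr.le)
      refine abs_le_of_sq_le_sq ?_ (by positivity)
      simp only [hδ₁, add_zero]
      have hs := Real.sin_sq_add_cos_sq (b * y)
      have hc := Real.neg_one_le_cos (b * y)
      -- `sin² = (1 - cos)(1 + cos) ≤ 2 (1 - cos)`, and `1 - cos (b y) ≤ 2 r²` where the cutoff is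
      -- active.
      have h3 : Real.sin (b * y) ^ 2 ≤ 4 * r ^ 2 := by nlinarith
      calc (b * Real.sin (b * y)) ^ 2 = b ^ 2 * Real.sin (b * y) ^ 2 := by ring
        _ ≤ b ^ 2 * (4 * r ^ 2) := by gcongr
        _ = _ := by ring
    · rw [abs_mul, abs_mul, abs_of_pos hb]
      have := Real.abs_cos_le_one (b * (y + 0))
      calc b * (|Real.cos (b * (y + 0))| * b) ≤ b * (1 * b) := by gcongr
        _ = b ^ 2 := by ring
        _ ≤ M := m5

/-! ### Approximation of `e_ξ - 1` by functions vanishing near `x₀`. -/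

section Linear

variable {a : ℝ}

theorem contDiff_sliceLeft {f : Torus a → ℂ} (hf : IsSmooth f) (x : Torus a) :
    ContDiff ℝ ∞ fun t : ℝ => f (x.1 + (t : AddCircle (2 * Real.pi / a)), x.2) := by
  obtain ⟨v, rfl⟩ := exists_torusMk x
  simp only [torusMk_add_left]
  exact hf.contDiff.comp (by fun_prop : ContDiff ℝ ∞ fun t : ℝ => v + t • ((1 : ℝ), (0 : ℝ)))

theorem contDiff_sliceRight {f : Torus a → ℂ} (hf : IsSmooth f) (x : Torus a) :
    ContDiff ℝ ∞ fun t : ℝ => f (x.1, x.2 + (t : AddCircle (2 * Real.pi * a))) := by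
  obtain ⟨v, rfl⟩ := exists_torusMk x
  simp only [torusMk_add_right]
  exact hf.contDiff.comp (by fun_prop : ContDiff ℝ ∞ fun t : ℝ => v + t • ((0 : ℝ), (1 : ℝ)))

theorem laplacian_add {f g : Torus a → ℂ} (hf : IsSmooth f) (hg : IsSmooth g) (x : Torus a) :
    laplacian (fun x => f x + g x) x = laplacian f x + laplacian g x := by
  have h2 : ((2 : ℕ) : WithTop ℕ∞) ≤ ∞ := WithTop.coe_le_coe.mpr le_top
  simp only [laplacian]
  rw [iteratedDeriv_fun_add ((contDiff_sliceLeft hf x).of_le h2).contDiffAt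
    ((contDiff_sliceLeft hg x).of_le h2).contDiffAt,
    iteratedDeriv_fun_add ((contDiff_sliceRight hf x).of_le h2).contDiffAt
    ((contDiff_sliceRight hg x).of_le h2).contDiffAt]
  ring

theorem laplacian_const_mul {f : Torus a → ℂ} (hf : IsSmooth f) (c : ℂ) (x : Torus a) :
    laplacian (fun x => c * f x) x = c * laplacian f x := by
  have h2 : ((2 : ℕ) : WithTop ℕ∞) ≤ ∞ := WithTop.coe_le_coe.mpr le_top
  simp only [laplacian]
  rw [iteratedDeriv_const_mul c ((contDiff_sliceLeft hf x).of_le h2).contDiffAt,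
    iteratedDeriv_const_mul c ((contDiff_sliceRight hf x).of_le h2).contDiffAt]
  ring

theorem IsSmooth.const_mul {f : Torus a → ℂ} (hf : IsSmooth f) (c : ℂ) :
    IsSmooth fun x => c * f x :=
  ContDiff.mul contDiff_const hf

theorem isSmooth_const (c : ℂ) : IsSmooth fun _ : Torus a => c := contDiff_const

variable [hFact : Fact (0 < a)]

/-- The graph of the restricted Laplacian as a subspace. -/
noncomputable def restrictedSubmodule (x₀ : Torus a) : Submodule ℂ (L2 a × L2 a) where
  carrier := restrictedGraph a x₀
  zero_mem' := by
    refine ⟨fun _ => 0, isSmooth_const 0, Eventually.of_forall fun _ => rfl, Lp.coeFn_zero _ _ _, ?_⟩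
    refine (Lp.coeFn_zero _ _ _).trans (Eventually.of_forall fun x => ?_)
    have := laplacian_const_mul (isSmooth_const (a := a) 0) 0 x
    simp only [mul_zero, zero_mul] at this
    simp only [this]
    simp
  add_mem' := by
    rintro p q ⟨f, hf, hf0, hp1, hp2⟩ ⟨g, hg, hg0, hq1, hq2⟩
    refine ⟨fun x => f x + g x, hf.add hg, ?_, ?_, ?_⟩
    · filter_upwards [hf0, hg0] with x h1 h2
      rw [h1, h2, add_zero]
    · filter_upwards [hp1, hq1, Lp.coeFn_add p.1 q.1] with x h1 h2 h3
      rw [Prod.fst_add, h3, Pi.add_apply, h1, h2]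
    · filter_upwards [hp2, hq2, Lp.coeFn_add p.2 q.2] with x h1 h2 h3
      rw [Prod.snd_add, h3, Pi.add_apply, h1, h2, laplacian_add hf hg]
      ring
  smul_mem' := by
    rintro c p ⟨f, hf, hf0, hp1, hp2⟩
    refine ⟨fun x => c * f x, hf.const_mul c, ?_, ?_, ?_⟩
    · filter_upwards [hf0] with x h1
      rw [h1, mul_zero]
    · filter_upwards [hp1, Lp.coeFn_smul c p.1] with x h1 h3
      rw [Prod.smul_fst, h3, Pi.smul_apply, h1, smul_eq_mul]
    · filter_upwards [hp2, Lp.coeFn_smul c p.2] with x h1 h3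
      rw [Prod.smul_snd, h3, Pi.smul_apply, h1, smul_eq_mul, laplacian_const_mul hf]
      ring

/-- The part of `e_ξ - 1` to be removed near `x₀`: its product with a cutoff at scale `r`. -/
theorem exists_concentrated (x₀ : Torus a) (k : ℤ × ℤ) :
    ∃ C : ℝ, 0 ≤ C ∧ ∀ r : ℝ, 0 < r → r ≤ 1 → ∃ w : Torus a → ℂ, IsSmooth w ∧
      (∀ᶠ x in 𝓝 x₀, w x = expoAt a x₀ k x - 1) ∧
      (∀ x, ‖w x‖ ≤ C * r⁻¹) ∧ (∀ x, ‖-laplacian w x‖ ≤ C * r⁻¹) ∧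
      (∀ x, 2 * r ^ 2 < sqDist x₀ x → w x = 0) ∧
      ∀ x, 2 * r ^ 2 < sqDist x₀ x → -laplacian w x = 0 := by
  have ha := hFact.out
  obtain ⟨χ, χ₁, χ₂, B, hsm, hχ, hχ₁, hB, h0, h1⟩ := exists_cutoff
  obtain ⟨C₁, hC₁, hL⟩ := norm_iteratedDeriv_two_slice_le hχ hχ₁ hB h0 ha k.1 k.2
  obtain ⟨C₂, hC₂, hR⟩ := norm_iteratedDeriv_two_slice_le hχ hχ₁ hB h0 (inv_pos.mpr ha) k.2 k.1
  have hB0 : 0 ≤ B := (abs_nonneg _).trans (hB 0).1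
  refine ⟨C₁ + C₂ + 2 * B, by positivity, fun r hr hr1 => ?_⟩
  have hr1' : 1 ≤ r⁻¹ := one_le_inv_iff₀.mpr ⟨hr, hr1⟩
  set w : Torus a → ℂ := fun x =>
    (expoAt a x₀ k x - 1) * ((χ (sqDist x₀ x * (r ^ 2)⁻¹) : ℝ) : ℂ) with hw
  have hwsm : IsSmooth w := by
    have s1 : ContDiff ℝ ∞ fun v => expoAt a x₀ k (torusMk a v) - 1 :=
      (isSmooth_expoAt x₀ k).contDiff.sub contDiff_const
    have s2 : ContDiff ℝ ∞ fun v => ((χ (sqDist x₀ (torusMk a v) * (r ^ 2)⁻¹) : ℝ) : ℂ) :=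
      Complex.ofRealCLM.contDiff.comp (hsm.comp ((contDiff_sqDist x₀).mul contDiff_const))
    exact s1.mul s2
  have hlap : ∀ x, ‖-laplacian w x‖ ≤ (C₁ + C₂) * r⁻¹ ∧
      (2 * r ^ 2 < sqDist x₀ x → -laplacian w x = 0) := by
    intro x
    obtain ⟨s, rfl⟩ := exists_torusMk x₀
    obtain ⟨v, rfl⟩ := exists_torusMk x
    have hleft := hL (v.1 - s.1) (a⁻¹ * (v.2 - s.2)) r hr hr1
    have hright := hR (v.2 - s.2) (a * (v.1 - s.1)) r hr hr1
    have e1 : secondDerivLeft w (torusMk a v) = iteratedDeriv 2 (fun t : ℝ =>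
        (Complex.exp (Complex.I * ((k.1 * (a * (v.1 - s.1 + t)) +
          k.2 * (a⁻¹ * (v.2 - s.2)) : ℝ) : ℂ)) - 1) *
          ((χ ((2 - Real.cos (a * (v.1 - s.1 + t)) - Real.cos (a⁻¹ * (v.2 - s.2))) *
            (r ^ 2)⁻¹) : ℝ) : ℂ)) 0 := by
      simp only [secondDerivLeft, torusMk_add_left, hw, expoAt_torusMk, sqDist_torusMk]
      congr 1
      funext t
      have t1 : (v + t • ((1 : ℝ), (0 : ℝ))).1 - s.1 = v.1 - s.1 + t := by simp; ring
      have t2 : (v + t • ((1 : ℝ), (0 : ℝ))).2 - s.2 = v.2 - s.2 := by simp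
      rw [t1, t2]
      congr 5
      ring
    have e2 : secondDerivRight w (torusMk a v) = iteratedDeriv 2 (fun t : ℝ =>
        (Complex.exp (Complex.I * ((k.2 * (a⁻¹ * (v.2 - s.2 + t)) +
          k.1 * (a * (v.1 - s.1)) : ℝ) : ℂ)) - 1) *
          ((χ ((2 - Real.cos (a⁻¹ * (v.2 - s.2 + t)) - Real.cos (a * (v.1 - s.1))) *
            (r ^ 2)⁻¹) : ℝ) : ℂ)) 0 := by
      simp only [secondDerivRight, torusMk_add_right, hw, expoAt_torusMk, sqDist_torusMk]
      congr 1
      funext t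
      have t1 : (v + t • ((0 : ℝ), (1 : ℝ))).1 - s.1 = v.1 - s.1 := by simp
      have t2 : (v + t • ((0 : ℝ), (1 : ℝ))).2 - s.2 = v.2 - s.2 + t := by simp; ring
      rw [t1, t2, sub_right_comm]
      congr 5
      ring
    rw [laplacian_eq, e1, e2, norm_neg]
    refine ⟨(norm_add_le _ _).trans ((add_le_add hleft.1 hright.1).trans_eq (by ring)), fun h => ?_⟩
    rw [sqDist_torusMk] at h
    rw [hleft.2 h, hright.2 (by rw [sub_right_comm]; exact h)]
    simp
  refine ⟨w, hwsm, ?_, fun x => ?_, fun x => (hlap x).1.trans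
    (mul_le_mul_of_nonneg_right (by linarith) (by positivity)), fun x hx => ?_,
    fun x hx => (hlap x).2 hx⟩
  · have hopen : ∀ᶠ x in 𝓝 x₀, sqDist x₀ x < r ^ 2 := by
      refine (continuous_sqDist x₀).continuousAt.eventually_lt continuousAt_const ?_
      rw [sqDist_self]; positivity
    filter_upwards [hopen] with x hx
    have hn := sqDist_nonneg x₀ x
    simp only [hw]
    rw [h1 _ (by
      rw [abs_of_nonneg (by positivity), ← div_eq_mul_inv, div_le_one (by positivity)]
      exact hx.le), Complex.ofReal_one, mul_one]
  · simp only [hw]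
    rw [norm_mul, Complex.norm_real]
    have h2 : ‖expoAt a x₀ k x - 1‖ ≤ 2 := by
      refine (norm_sub_le _ _).trans ?_
      rw [norm_expoAt_apply, norm_one]; norm_num
    calc _ ≤ 2 * B := mul_le_mul h2 (hB _).1 (abs_nonneg _) (by norm_num)
      _ ≤ (C₁ + C₂ + 2 * B) * 1 := by linarith
      _ ≤ _ := by gcongr
  · have hs : 2 < sqDist x₀ x * (r ^ 2)⁻¹ := by
      rw [← div_eq_mul_inv, lt_div_iff₀ (by positivity)]
      exact hx
    simp only [hw]
    rw [(h0 _ hs).1, Complex.ofReal_zero, mul_zero]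

/-- The function `e_ξ - 1` vanishes at `x₀`. Removing its concentrated part `w` leaves an element of
the restricted domain, and as `r → 0` both `w` and `Δw` are bounded in `L²` with coefficients
tending to `0`, hence tend weakly to `0`. In dimension two `Δw` is only shown to be bounded, so weak
convergence is combined with the weak closedness of a closed subspace. -/
theorem expo_sub_one_mem_closure (x₀ : Torus a) (k : ℤ × ℤ) :
    (unitExpo x₀ k - unitExpo x₀ 0, (normSq a k : ℂ) • unitExpo x₀ k) ∈
      closure (restrictedGraph a x₀) := by
  set K := (restrictedSubmodule x₀).topologicalClosure with hK
  have hKcoe : (K : Set (L2 a × L2 a)) = closure (restrictedGraph a x₀) :=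
    Submodule.topologicalClosure_coe _
  rw [← hKcoe]
  set P : L2 a × L2 a := (toL2 (expoAt a x₀ k) - toL2 (expoAt a x₀ 0),
    (normSq a k : ℂ) • toL2 (expoAt a x₀ k)) with hP
  have hPeq : (unitExpo x₀ k - unitExpo x₀ 0, (normSq a k : ℂ) • unitExpo x₀ k) =
      ((2 * Real.pi : ℝ) : ℂ)⁻¹ • P := by
    rw [hP, Prod.smul_mk, smul_sub, smul_comm]
    rfl
  rw [hPeq]
  refine K.smul_mem _ ?_
  by_contra hnot
  have hconv : Convex ℝ (K : Set (L2 a × L2 a)) := (K.restrictScalars ℝ).convex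
  -- A point outside the closed convex set would be strictly separated from it by a continuous
  -- functional, against the weak convergence below.
  obtain ⟨ℓ, u, hℓ, hu⟩ := RCLike.geometric_hahn_banach_closed_point (𝕜 := ℂ) hconv
    (Submodule.isClosed_topologicalClosure _) hnot
  obtain ⟨C, hC, hw⟩ := exists_concentrated x₀ k
  set r : ℕ → ℝ := fun n => 1 / ((n : ℝ) + 1) with hr
  have hr0 : ∀ n, 0 < r n := fun n => by positivity
  have hr1 : ∀ n, r n ≤ 1 := fun n => by
    simp only [hr]
    rw [div_le_one (by positivity)]
    have : (0 : ℝ) ≤ n := n.cast_nonneg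
    linarith
  have hrlim : Tendsto r atTop (𝓝 0) := tendsto_one_div_add_atTop_nhds_zero_nat
  choose w hwsm hwx₀ hwb hlb hw0 hl0 using fun n => hw (r n) (hr0 n) (hr1 n)
  set W₁ : ℕ → L2 a := fun n => classL2 (w n) (hwsm n).continuous
  set W₂ : ℕ → L2 a := fun n => classL2 (fun x => -laplacian (w n) x)
    (hwsm n).laplacian.neg.continuous
  have hlim0 : Tendsto (fun n => C * (2 * Real.pi) * r n) atTop (𝓝 0) := by
    simpa using hrlim.const_mul (C * (2 * Real.pi))
  have t1 := tendsto_clm_of_coeff (x₀ := x₀) (w := W₁) (B := C * (2 * Real.pi))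
    (fun n => norm_classL2_le_of_concentrated x₀ (hr0 n) hC _ (hwb n) (hw0 n))
    (fun k => squeeze_zero_norm (fun n => norm_coeff_classL2_le_of_concentrated x₀ (hr0 n) hC _
      (hwb n) (hw0 n) k) hlim0) (ℓ.comp (ContinuousLinearMap.inl ℂ (L2 a) (L2 a)))
  have t2 := tendsto_clm_of_coeff (x₀ := x₀) (w := W₂) (B := C * (2 * Real.pi))
    (fun n => norm_classL2_le_of_concentrated x₀ (hr0 n) hC _ (hlb n) (hl0 n))
    (fun k => squeeze_zero_norm (fun n => norm_coeff_classL2_le_of_concentrated x₀ (hr0 n) hC _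
      (hlb n) (hl0 n) k) hlim0) (ℓ.comp (ContinuousLinearMap.inr ℂ (L2 a) (L2 a)))
  have t3 : Tendsto (fun n => ℓ (P - (W₁ n, W₂ n))) atTop (𝓝 (ℓ P)) := by
    have e : ∀ n, ℓ (P - (W₁ n, W₂ n)) = ℓ P - ((ℓ.comp (ContinuousLinearMap.inl ℂ _ _)) (W₁ n) +
        (ℓ.comp (ContinuousLinearMap.inr ℂ _ _)) (W₂ n)) := by
      intro n
      rw [map_sub, ContinuousLinearMap.comp_apply, ContinuousLinearMap.comp_apply, ← map_add]
      simp
    simp only [e]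
    simpa using (t1.add t2).const_sub (ℓ P)
  have hmem : ∀ n, P - (W₁ n, W₂ n) ∈ restrictedGraph a x₀ := by
    intro n
    have hf : IsSmooth fun x => expoAt a x₀ k x + -1 :=
      (isSmooth_expoAt x₀ k).add (isSmooth_const (-1))
    refine ⟨fun x => (expoAt a x₀ k x + -1) + (-1) * w n x, hf.add ((hwsm n).const_mul (-1)), ?_, ?_, ?_⟩
    · filter_upwards [hwx₀ n] with x hx
      rw [hx]; ring
    · filter_upwards [Lp.coeFn_sub P.1 (W₁ n),
        Lp.coeFn_sub (toL2 (expoAt a x₀ k)) (toL2 (expoAt a x₀ 0)),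
        ContinuousMap.coeFn_toLp (𝕜 := ℂ) (p := 2) volume (expoAt a x₀ k),
        ContinuousMap.coeFn_toLp (𝕜 := ℂ) (p := 2) volume (expoAt a x₀ 0),
        coeFn_classL2 (hwsm n).continuous] with x e1 e2 e3 e4 e5
      rw [Prod.fst_sub, e1, Pi.sub_apply, e5, hP, e2, Pi.sub_apply, e3, e4, expoAt_zero]
      ring
    · have hlap : ∀ x, -laplacian (fun x => (expoAt a x₀ k x + -1) + (-1) * w n x) x =
          normSq a k * expoAt a x₀ k x - -laplacian (w n) x := by
        intro x
        have hconst : laplacian (fun _ : Torus a => (-1 : ℂ)) x = 0 := by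
          simp [laplacian, iteratedDeriv_const]
        rw [laplacian_add hf ((hwsm n).const_mul (-1)), laplacian_const_mul (hwsm n),
          laplacian_add (isSmooth_expoAt x₀ k) (isSmooth_const (-1)), hconst, ← laplacian_expoAt]
        ring
      filter_upwards [Lp.coeFn_sub P.2 (W₂ n),
        Lp.coeFn_smul (normSq a k : ℂ) (toL2 (expoAt a x₀ k)),
        ContinuousMap.coeFn_toLp (𝕜 := ℂ) (p := 2) volume (expoAt a x₀ k),
        coeFn_classL2 (hwsm n).laplacian.neg.continuous] with x e1 e2 e3 e4
      rw [hlap, Prod.snd_sub, e1, Pi.sub_apply, e4, hP, e2, Pi.smul_apply, e3, smul_eq_mul]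
  have hlt : ∀ n, RCLike.re (ℓ (P - (W₁ n, W₂ n))) ≤ u := fun n =>
    (hℓ _ (by rw [hKcoe]; exact subset_closure (hmem n))).le
  have t4 : Tendsto (fun n => RCLike.re (ℓ (P - (W₁ n, W₂ n)))) atTop (𝓝 (RCLike.re (ℓ P))) :=
    (RCLike.continuous_re.tendsto _).comp t3
  exact absurd (le_of_tendsto t4 (Eventually.of_forall hlt)) (not_le.mpr hu)

end Linear

/-! ### Fourier description of the closure, and coefficients of the Green's functions. -/

section Closure

variable {a : ℝ} [hFact : Fact (0 < a)]

/-- On pairs with `q̂₂ = |ξ|² q̂₁`, evaluation at `x₀` (up to a constant) is the inner product of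
`q₁ + q₂` with the `L²` function of coefficients `(1 + |ξ|²)⁻¹`. It is therefore continuous in the
graph norm, and its vanishing survives closure. -/
theorem hasSum_coeff_of_mul {x₀ : Torus a} {w : L2 a}
    (hw : ∀ k, coeff x₀ k w = (((1 + normSq a k)⁻¹ : ℝ) : ℂ)) {q : L2 a × L2 a}
    (hq : ∀ k, coeff x₀ k q.2 = normSq a k * coeff x₀ k q.1) :
    HasSum (fun k => coeff x₀ k q.1) (inner ℂ w (q.1 + q.2)) := by
  have h := (expoBasis x₀).hasSum_inner_mul_inner w (q.1 + q.2)
  refine h.congr_fun ?_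
  intro k
  have hk : (0 : ℝ) < 1 + normSq a k := by linarith [normSq_nonneg a k]
  have e1 : inner ℂ w (expoBasis x₀ k) = (((1 + normSq a k)⁻¹ : ℝ) : ℂ) := by
    rw [← inner_conj_symm, expoBasis_apply, ← Complex.conj_ofReal, ← hw k]
    rfl
  have e2 : inner ℂ (expoBasis x₀ k) (q.1 + q.2) = ((1 + normSq a k : ℝ) : ℂ) * coeff x₀ k q.1 := by
    rw [expoBasis_apply]
    change coeff x₀ k (q.1 + q.2) = _
    rw [map_add, hq]
    push_cast
    ring
  rw [e1, e2, ← mul_assoc, ← Complex.ofReal_mul, inv_mul_cancel₀ hk.ne', Complex.ofReal_one, one_mul]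

theorem exists_coeff_inv_one_add (x₀ : Torus a) :
    ∃ w : L2 a, ∀ k, coeff x₀ k w = (((1 + normSq a k)⁻¹ : ℝ) : ℂ) := by
  obtain ⟨w, -, hw⟩ := exists_hasSum_coeff x₀ (c := fun k => (((1 + normSq a k)⁻¹ : ℝ) : ℂ)) (by
    refine (summable_inv_one_add_normSq_sq hFact.out).congr fun k => ?_
    rw [Complex.norm_real, Real.norm_eq_abs, sq_abs, inv_pow])
  exact ⟨w, hw⟩

/-- The closure of the restricted Laplacian in terms of Fourier coefficients. -/
theorem mem_closure_restrictedGraph_iff (x₀ : Torus a) (q : L2 a × L2 a) :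
    q ∈ closure (restrictedGraph a x₀) ↔
      (∀ k, coeff x₀ k q.2 = normSq a k * coeff x₀ k q.1) ∧
        HasSum (fun k => coeff x₀ k q.1) 0 := by
  constructor
  · intro hq
    obtain ⟨w, hw⟩ := exists_coeff_inv_one_add x₀
    set C : Set (L2 a × L2 a) := {q | (∀ k, coeff x₀ k q.2 = normSq a k * coeff x₀ k q.1) ∧
      inner ℂ w (q.1 + q.2) = 0} with hC
    have hclosed : IsClosed C := by
      refine IsClosed.inter (s₁ := {q : L2 a × L2 a | ∀ k, coeff x₀ k q.2 =
        normSq a k * coeff x₀ k q.1}) ?_ ?_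
      · have e : {q : L2 a × L2 a | ∀ k, coeff x₀ k q.2 = normSq a k * coeff x₀ k q.1} =
            ⋂ k, {q : L2 a × L2 a | coeff x₀ k q.2 = normSq a k * coeff x₀ k q.1} := by
          ext q
          simp only [Set.mem_iInter, Set.mem_ofPred_eq]
        rw [e]
        refine isClosed_iInter fun k => isClosed_eq ?_ ?_
        · exact (coeff x₀ k).continuous.comp continuous_snd
        · exact continuous_const.mul ((coeff x₀ k).continuous.comp continuous_fst)
      · exact isClosed_eq (continuous_const.inner (continuous_fst.add continuous_snd))
          continuous_const
    have hsub : restrictedGraph a x₀ ⊆ C := by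
      rintro p ⟨f, hf, hf0, h1, h2⟩
      have hrel : ∀ k, coeff x₀ k p.2 = normSq a k * coeff x₀ k p.1 :=
        coeff_neg_laplacian x₀ hf h1 h2
      refine ⟨hrel, ?_⟩
      have hs := hf.hasSum_coeff_mul_expoAt h1 (x₀ := x₀) x₀
      simp only [expoAt_self, mul_one] at hs
      rw [hf0.self_of_nhds] at hs
      have hs2 := ((hasSum_coeff_of_mul hw hrel).mul_left (((2 * Real.pi : ℝ) : ℂ)⁻¹))
      have hpi : ((2 * Real.pi : ℝ) : ℂ)⁻¹ ≠ 0 :=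
        inv_ne_zero (by exact_mod_cast Real.two_pi_pos.ne')
      have := hs2.unique hs
      exact (mul_eq_zero.mp this).resolve_left hpi
    have hqC : q ∈ C := closure_minimal hsub hclosed hq
    refine ⟨hqC.1, ?_⟩
    have := hasSum_coeff_of_mul hw hqC.1
    rwa [hqC.2] at this
  · rintro ⟨hrel, hsum⟩
    have h1 := hasSum_coeff x₀ q.1
    have h2 := hasSum_coeff x₀ q.2
    -- Because the coefficients sum to zero, a multiple of the constant mode may be subtracted from
    -- each term, which expresses `q` through the pairs already known to lie in the closure.
    have h3 : HasSum (fun k => coeff x₀ k q.1 • (unitExpo x₀ k - unitExpo x₀ 0)) q.1 := by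
      have := h1.sub (hsum.smul_const (unitExpo x₀ 0))
      simpa only [zero_smul, sub_zero, smul_sub] using this
    have h4 : HasSum (fun k => coeff x₀ k q.1 •
        (unitExpo x₀ k - unitExpo x₀ 0, (normSq a k : ℂ) • unitExpo x₀ k)) q := by
      have h5 : HasSum (fun k => coeff x₀ k q.1 • ((normSq a k : ℂ) • unitExpo x₀ k)) q.2 := by
        refine h2.congr_fun fun k => ?_
        rw [hrel, smul_smul, mul_comm (coeff x₀ k q.1)]
      exact h3.prodMk h5
    have hK : (((restrictedSubmodule x₀).topologicalClosure : Submodule ℂ (L2 a × L2 a)) :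
        Set (L2 a × L2 a)) = closure (restrictedGraph a x₀) :=
      Submodule.topologicalClosure_coe _
    rw [← hK]
    refine (Submodule.isClosed_topologicalClosure _).mem_of_tendsto h4
      (Eventually.of_forall fun s => Submodule.sum_mem _ fun k _ => Submodule.smul_mem _ _ ?_)
    have := expo_sub_one_mem_closure x₀ k
    rw [← hK] at this
    exact this

/-- The summability hypothesis makes the series in `green` converge in `L²`, so that its `tsum` is
the genuine sum and not the default value `0`. -/
theorem coeff_green (x₀ : Torus a) {z : ℂ}
    (hz : Summable fun k => ‖((normSq a k : ℂ) - z)⁻¹‖ ^ 2) (k : ℤ × ℤ) :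
    coeff x₀ k (green a x₀ z) = -((2 * Real.pi : ℝ) : ℂ)⁻¹ * ((normSq a k : ℂ) - z)⁻¹ := by
  obtain ⟨f, hf, hfk⟩ := exists_hasSum_coeff x₀ hz
  have hpi : ((2 * Real.pi : ℝ) : ℂ) ≠ 0 := by exact_mod_cast Real.two_pi_pos.ne'
  have h : HasSum (fun k => ((normSq a k : ℂ) - z)⁻¹ • toL2 (expoAt a x₀ k))
      (((2 * Real.pi : ℝ) : ℂ) • f) := by
    refine (hf.const_smul ((2 * Real.pi : ℝ) : ℂ)).congr_fun fun k => ?_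
    rw [unitExpo, smul_smul, smul_smul, mul_right_comm ((2 * Real.pi : ℝ) : ℂ),
      mul_inv_cancel₀ hpi, one_mul]
  have hg : green a x₀ z = -(((4 * Real.pi ^ 2 : ℝ) : ℂ)⁻¹ • ((2 * Real.pi : ℝ) : ℂ) • f) := by
    rw [green, ← h.tsum_eq]
  rw [hg, map_neg, map_smul, map_smul, hfk, smul_eq_mul, smul_eq_mul]
  have e : ((4 * Real.pi ^ 2 : ℝ) : ℂ) = ((2 * Real.pi : ℝ) : ℂ) * ((2 * Real.pi : ℝ) : ℂ) := by
    push_cast; ring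
  rw [e]
  field_simp

theorem summable_inv_sq_add_one : Summable fun k => (normSq a k ^ 2 + 1)⁻¹ := by
  refine Summable.of_nonneg_of_le (fun k => by positivity) (fun k => ?_)
    ((summable_inv_one_add_normSq_sq hFact.out).mul_left 2)
  have hk := normSq_nonneg a k
  rw [← div_eq_mul_inv, inv_eq_one_div, div_le_div_iff₀ (by positivity) (by positivity)]
  nlinarith [sq_nonneg (normSq a k - 1)]

theorem summable_norm_inv_sub_ofReal (t : ℝ) :
    Summable fun k => ‖((normSq a k : ℂ) - (t : ℂ))⁻¹‖ ^ 2 := by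
  refine (summable_inv_normSq_sub_sq hFact.out t).congr fun k => ?_
  rw [← Complex.ofReal_sub, ← Complex.ofReal_inv, Complex.norm_real, Real.norm_eq_abs, sq_abs,
    inv_pow]

theorem summable_norm_inv_sub_I :
    Summable fun k => ‖((normSq a k : ℂ) - Complex.I)⁻¹‖ ^ 2 := by
  refine (summable_inv_sq_add_one (a := a)).congr fun k => ?_
  rw [norm_inv, inv_pow, Complex.sq_norm, Complex.normSq_apply]
  simp [sq]

theorem summable_norm_inv_sub_neg_I :
    Summable fun k => ‖((normSq a k : ℂ) - -Complex.I)⁻¹‖ ^ 2 := by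
  refine (summable_inv_sq_add_one (a := a)).congr fun k => ?_
  rw [norm_inv, inv_pow, Complex.sq_norm, Complex.normSq_apply]
  simp [sq]

end Closure

/-! ### The spectral function: convergence, monotonicity and zeros. -/

section SpectralFunction

variable {a : ℝ}

/-- The summand at `k` of the spectral function whose zeros are the perturbed eigenvalues. -/
noncomputable def spectralTerm (a τ : ℝ) (k : ℤ × ℤ) (t : ℝ) : ℝ :=
  (normSq a k - t)⁻¹ - (normSq a k + τ) * (normSq a k ^ 2 + 1)⁻¹

/-- The spectral function, whose zeros are the perturbed eigenvalues. -/
noncomputable def spectralFn (a τ t : ℝ) : ℝ := ∑' k, spectralTerm a τ k t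

/-- Neither `(n - t)⁻¹` nor `n / (n² + 1)` is summable over the lattice; their difference is `(n -
t)⁻¹ · (1 + t n) / (n² + 1)`, a product of two square-summable factors. -/
theorem abs_spectralTerm_le (τ : ℝ) (k : ℤ × ℤ) {t : ℝ} (ht : normSq a k ≠ t) :
    |spectralTerm a τ k t| ≤ ((normSq a k - t) ^ 2)⁻¹ +
      (1 + t ^ 2 + |τ|) * (normSq a k ^ 2 + 1)⁻¹ := by
  set n := normSq a k
  have h0 : n - t ≠ 0 := sub_ne_zero.mpr ht
  have h1 : (0 : ℝ) < n ^ 2 + 1 := by positivity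
  set x := (n - t)⁻¹ with hx
  set y := (1 + t * n) * (n ^ 2 + 1)⁻¹ with hy
  have e : spectralTerm a τ k t = x * y - τ * (n ^ 2 + 1)⁻¹ := by
    change (n - t)⁻¹ - (n + τ) * (n ^ 2 + 1)⁻¹ = _
    rw [hx, hy]
    field_simp
    ring
  have hy2 : y ^ 2 ≤ (1 + t ^ 2) * (n ^ 2 + 1)⁻¹ := by
    have : (1 + t * n) ^ 2 ≤ (1 + t ^ 2) * (n ^ 2 + 1) := by nlinarith [sq_nonneg (n - t)]
    calc y ^ 2 = (1 + t * n) ^ 2 * ((n ^ 2 + 1)⁻¹ * (n ^ 2 + 1)⁻¹) := by rw [hy]; ring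
      _ ≤ ((1 + t ^ 2) * (n ^ 2 + 1)) * ((n ^ 2 + 1)⁻¹ * (n ^ 2 + 1)⁻¹) := by gcongr
      _ = _ := by field_simp
  have hx2 : x ^ 2 = ((n - t) ^ 2)⁻¹ := by rw [hx, inv_pow]
  have hxy : |x * y| ≤ x ^ 2 + y ^ 2 := by
    rw [abs_le]
    constructor <;> nlinarith [sq_nonneg (x + y), sq_nonneg (x - y)]
  rw [e]
  refine (abs_sub _ _).trans ?_
  rw [abs_mul τ, abs_of_pos (inv_pos.mpr h1)]
  linarith

theorem spectralTerm_lt {τ : ℝ} {k : ℤ × ℤ} {s t : ℝ} (hst : s < t)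
    (hk : normSq a k < s ∨ t < normSq a k) : spectralTerm a τ k s < spectralTerm a τ k t := by
  refine sub_lt_sub_right ?_ _
  rcases hk with h | h
  · rw [← neg_lt_neg_iff, ← inv_neg, ← inv_neg]
    exact inv_strictAnti₀ (by linarith) (by linarith)
  · exact inv_strictAnti₀ (by linarith) (by linarith)

variable [hFact : Fact (0 < a)]

theorem summable_spectralTerm (τ : ℝ) {t : ℝ} (ht : ∀ k, normSq a k ≠ t) :
    Summable fun k => spectralTerm a τ k t :=
  Summable.of_norm_bounded ((summable_inv_normSq_sub_sq hFact.out t).add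
    (summable_inv_sq_add_one.mul_left (1 + t ^ 2 + |τ|)))
    fun k => abs_spectralTerm_le τ k (ht k)

theorem spectralFn_lt {τ s t : ℝ} (hst : s < t) (hgap : ∀ k, normSq a k < s ∨ t < normSq a k) :
    spectralFn a τ s < spectralFn a τ t :=
  Summable.tsum_lt_tsum (i := 0) (fun k => (spectralTerm_lt hst (hgap k)).le)
    (spectralTerm_lt hst (hgap 0))
    (summable_spectralTerm τ fun k h => by rcases hgap k with h' | h' <;> linarith)
    (summable_spectralTerm τ fun k h => by rcases hgap k with h' | h' <;> linarith)

/-- Weierstrass test: on an interval free of norms, `(n - t)⁻²` is at most its value at the endpoint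
nearer to `n`. -/
theorem continuousOn_spectralFn (τ : ℝ) {α β : ℝ}
    (hgap : ∀ k, normSq a k < α ∨ β < normSq a k) :
    ContinuousOn (spectralFn a τ) (Set.Icc α β) := by
  have hne : ∀ k, ∀ t ∈ Set.Icc α β, normSq a k ≠ t := fun k t ht h => by
    rcases hgap k with h' | h' <;> linarith [ht.1, ht.2]
  refine continuousOn_tsum (u := fun k => (((normSq a k - α) ^ 2)⁻¹ + ((normSq a k - β) ^ 2)⁻¹) +
    (1 + (|α| + |β|) ^ 2 + |τ|) * (normSq a k ^ 2 + 1)⁻¹) (fun k => ?_)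
    (((summable_inv_normSq_sub_sq hFact.out α).add (summable_inv_normSq_sub_sq hFact.out β)).add
      (summable_inv_sq_add_one.mul_left _)) fun k t ht => ?_
  · unfold spectralTerm
    refine ContinuousOn.sub (ContinuousOn.inv₀ (by fun_prop) fun t ht =>
      sub_ne_zero.mpr (hne k t ht)) continuousOn_const
  · refine (abs_spectralTerm_le τ k (hne k t ht)).trans (add_le_add ?_ ?_)
    · rcases hgap k with h | h
      · refine le_trans ?_ (le_add_of_nonneg_right (by positivity))
        have : 0 < (normSq a k - α) ^ 2 := by nlinarith
        exact inv_anti₀ this (by nlinarith [ht.1, ht.2])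
      · by_cases hβ : α ≤ β
        · refine le_trans ?_ (le_add_of_nonneg_left (by positivity))
          have : 0 < (normSq a k - β) ^ 2 := by nlinarith
          exact inv_anti₀ this (by nlinarith [ht.1, ht.2])
        · exact absurd (ht.1.trans ht.2) hβ
    · have h2 : t ^ 2 ≤ (|α| + |β|) ^ 2 := by
        refine sq_le_sq' ?_ ?_
        · linarith [ht.1, neg_abs_le α, abs_nonneg β]
        · linarith [ht.2, le_abs_self β, abs_nonneg α]
      gcongr

/-- Between two consecutive norms the spectral function has a zero. -/
theorem exists_spectralFn_eq_zero (τ : ℝ) {k l : ℤ × ℤ} (hkl : normSq a k < normSq a l)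
    (hgap : ∀ j, normSq a j ≤ normSq a k ∨ normSq a l ≤ normSq a j) :
    ∃ t, normSq a k < t ∧ t < normSq a l ∧ spectralFn a τ t = 0 := by
  set A := normSq a k with hA
  set B := normSq a l with hB
  set m := (A + B) / 2 with hm
  have hgap' : ∀ s t, A < s → t < B → ∀ j, normSq a j < s ∨ t < normSq a j := fun s t hs ht j => by
    rcases hgap j with h | h
    · exact Or.inl (by linarith)
    · exact Or.inr (by linarith)
  have hsum : ∀ t, A < t → t < B → Summable fun j => spectralTerm a τ j t := fun t h1 h2 =>
    summable_spectralTerm τ fun j h => by rcases hgap' t t h1 h2 j with h' | h' <;> linarith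
  have hmA : A < m := by rw [hm]; linarith
  have hmB : m < B := by rw [hm]; linarith
  -- All summands increase on the gap, so the increment of the whole series is at least that of any
  -- single one. A single pole therefore forces the sign near each end of the gap.
  have hdiff : ∀ (i : ℤ × ℤ) (s t : ℝ), A < s → s ≤ t → t < B →
      spectralTerm a τ i t - spectralTerm a τ i s ≤ spectralFn a τ t - spectralFn a τ s := by
    intro i s t h1 h2 h3
    have hs := hsum s h1 (by linarith)
    have ht := hsum t (by linarith) h3
    rw [spectralFn, spectralFn, ← ht.tsum_sub hs]
    refine (ht.sub hs).le_tsum i fun j _ => sub_nonneg.mpr ?_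
    rcases h2.eq_or_lt with rfl | h2
    · rfl
    · exact (spectralTerm_lt h2 (hgap' s t h1 h3 j)).le
  obtain ⟨α, hα1, hα2, hα3⟩ : ∃ α, A < α ∧ α ≤ m ∧ spectralFn a τ α ≤ 0 := by
    -- Within `D⁻¹` of the pole at `A` the singular term is at most `-D`, which outweighs the values
    -- at the midpoint.
    set D := |spectralFn a τ m| + |(A - m)⁻¹| + 1 with hD
    have hD0 : 0 < D := by positivity
    refine ⟨min m (A + D⁻¹), lt_min hmA (by linarith [inv_pos.mpr hD0]), min_le_left _ _, ?_⟩
    set α := min m (A + D⁻¹)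
    have hα : A < α := lt_min hmA (by linarith [inv_pos.mpr hD0])
    have h := hdiff k α m hα (min_le_left _ _) hmB
    have h2 : D ≤ (α - A)⁻¹ := by
      rw [le_inv_comm₀ hD0 (by linarith)]
      linarith [min_le_right m (A + D⁻¹)]
    have h3 : (A - α)⁻¹ = -(α - A)⁻¹ := by rw [← inv_neg, neg_sub]
    simp only [spectralTerm, ← hA] at h
    linarith [le_abs_self (spectralFn a τ m), neg_abs_le ((A - m)⁻¹)]
  obtain ⟨β, hβ1, hβ2, hβ3⟩ : ∃ β, m ≤ β ∧ β < B ∧ 0 ≤ spectralFn a τ β := by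
    set D := |spectralFn a τ m| + |(B - m)⁻¹| + 1 with hD
    have hD0 : 0 < D := by positivity
    have hβ : max m (B - D⁻¹) < B := max_lt hmB (by linarith [inv_pos.mpr hD0])
    refine ⟨max m (B - D⁻¹), le_max_left _ _, hβ, ?_⟩
    set β := max m (B - D⁻¹)
    have h := hdiff l m β hmA (le_max_left _ _) hβ
    have h2 : D ≤ (B - β)⁻¹ := by
      rw [le_inv_comm₀ hD0 (by linarith)]
      linarith [le_max_right m (B - D⁻¹)]
    simp only [spectralTerm, ← hB] at h
    linarith [neg_abs_le (spectralFn a τ m), le_abs_self ((B - m)⁻¹)]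
  obtain ⟨t, ht, ht0⟩ := intermediate_value_Icc (hα2.trans hβ1)
    (continuousOn_spectralFn τ (hgap' α β hα1 hβ2)) ⟨hα3, hβ3⟩
  exact ⟨t, by linarith [ht.1], by linarith [ht.2], ht0⟩

/-- Strict monotonicity allows at most one zero per gap. For existence, `k` is first replaced by a
point whose norm is the largest below that of `l`, so that the two norms are consecutive. -/
theorem interlaces_of_mem_iff {Λ : Set ℝ} {τ : ℝ}
    (hΛ : ∀ t, t ∈ Λ ↔ (∀ k, normSq a k ≠ t) ∧ spectralFn a τ t = 0) : Interlaces a Λ where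
  normSq_ne t ht := ((hΛ t).mp ht).1
  exists_normSq_between t ht t' ht' hlt := by
    by_contra! hno
    have h1 := (hΛ t).mp ht
    have h2 := (hΛ t').mp ht'
    have := spectralFn_lt (a := a) (τ := τ) hlt fun k => by
      by_cases hk : normSq a k < t
      · exact Or.inl hk
      · exact Or.inr (lt_of_le_of_ne
          (hno k (lt_of_le_of_ne (not_lt.mp hk) (h1.1 k).symm)) (h2.1 k).symm)
    rw [h1.2, h2.2] at this
    exact lt_irrefl _ this
  exists_mem_between k l hkl := by
    have hfin : {j | normSq a j < normSq a l}.Finite :=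
      (finite_normSq_le hFact.out (normSq a l)).subset fun j (hj : normSq a j < _) => hj.le
    obtain ⟨k', hk', hmax⟩ := hfin.exists_maximalFor (normSq a) _ ⟨k, hkl⟩
    have hmax' : ∀ j, normSq a j < normSq a l → normSq a j ≤ normSq a k' := fun j hj => by
      by_contra! h
      exact absurd (hmax hj h.le) (not_le.mpr h)
    obtain ⟨t, h1, h2, h3⟩ := exists_spectralFn_eq_zero (a := a) τ (k := k') (l := l) hk' fun j =>
      (lt_or_ge (normSq a j) (normSq a l)).imp (hmax' j) id
    refine ⟨t, (hΛ t).mpr ⟨fun j hj => ?_, h3⟩, lt_of_le_of_lt (hmax' k hkl) h1, h2⟩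
    have := hmax' j (by linarith)
    linarith

end SpectralFunction

/-! ### New eigenvalues as zeros of the spectral function. -/

section Eigenvalues

variable {a : ℝ} [hFact : Fact (0 < a)]

/-- Explains the parameter of the spectral function: `i (1 - e^{iφ}) / (1 + e^{iφ}) = tan (φ / 2)`
is real, and `φ ∈ (-π, π)` keeps the denominator nonzero. -/
theorem one_add_exp_I_mul {φ : ℝ} (hφ : φ ∈ Set.Ioo (-Real.pi) Real.pi) :
    1 + Complex.exp (Complex.I * φ) ≠ 0 ∧
      Complex.I * (1 - Complex.exp (Complex.I * φ)) =
        (Real.tan (φ / 2) : ℂ) * (1 + Complex.exp (Complex.I * φ)) := by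
  have hc : 0 < Real.cos (φ / 2) :=
    Real.cos_pos_of_mem_Ioo ⟨by linarith [hφ.1], by linarith [hφ.2]⟩
  have hcos : Real.cos φ = 2 * Real.cos (φ / 2) ^ 2 - 1 := by
    rw [← Real.cos_two_mul]; ring_nf
  have hsin : Real.sin φ = 2 * Real.sin (φ / 2) * Real.cos (φ / 2) := by
    rw [← Real.sin_two_mul]; ring_nf
  have hexp : Complex.exp (Complex.I * φ) = Real.cos φ + Real.sin φ * Complex.I := by
    rw [mul_comm, Complex.exp_mul_I, ← Complex.ofReal_cos, ← Complex.ofReal_sin]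
  have hsq := Real.sin_sq_add_cos_sq (φ / 2)
  rw [hexp, Real.tan_eq_sin_div_cos]
  generalize Real.cos φ = C at *
  generalize Real.sin φ = S at *
  generalize Real.cos (φ / 2) = c at *
  generalize Real.sin (φ / 2) = s at *
  constructor
  · intro h
    have := congrArg Complex.re h
    simp at this
    nlinarith
  · have hc' : (c : ℂ) ≠ 0 := by exact_mod_cast hc.ne'
    have hsq' : (s : ℂ) ^ 2 + (c : ℂ) ^ 2 = 1 := by exact_mod_cast hsq
    rw [hcos, hsin]
    push_cast
    field_simp
    linear_combination (-2 * (s : ℂ) * c ^ 2) * Complex.I_sq + (-2 * Complex.I * c) * hsq'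

omit hFact in
theorem ofReal_spectralTerm_mul {φ : ℝ} (hφ : φ ∈ Set.Ioo (-Real.pi) Real.pi) {k : ℤ × ℤ} {t : ℝ} :
    (1 + Complex.exp (Complex.I * φ)) * (spectralTerm a (Real.tan (φ / 2)) k t : ℂ) =
      (1 + Complex.exp (Complex.I * φ)) * ((normSq a k : ℂ) - t)⁻¹ -
        ((normSq a k : ℂ) - Complex.I)⁻¹ -
        Complex.exp (Complex.I * φ) * ((normSq a k : ℂ) - -Complex.I)⁻¹ := by
  have h := (one_add_exp_I_mul hφ).2
  set E := Complex.exp (Complex.I * φ)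
  set n := normSq a k
  have e1 : ((n : ℂ) - Complex.I) * ((n : ℂ) + Complex.I) = (n : ℂ) ^ 2 + 1 := by
    linear_combination -Complex.I_sq
  have h1 : (n : ℂ) ^ 2 + 1 ≠ 0 := by exact_mod_cast (by positivity : n ^ 2 + 1 ≠ 0)
  have h2 : (n : ℂ) - Complex.I ≠ 0 := fun h => h1 (by rw [← e1, h, zero_mul])
  have h3 : (n : ℂ) + Complex.I ≠ 0 := fun h => h1 (by rw [← e1, h, mul_zero])
  have i2 : ((n : ℂ) - Complex.I)⁻¹ = (n + Complex.I) * ((n : ℂ) ^ 2 + 1)⁻¹ := by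
    rw [← e1]; field_simp
  have i3 : ((n : ℂ) - -Complex.I)⁻¹ = (n - Complex.I) * ((n : ℂ) ^ 2 + 1)⁻¹ := by
    rw [← e1, sub_neg_eq_add]; field_simp
  rw [i2, i3, spectralTerm]
  push_cast at h ⊢
  linear_combination ((n : ℂ) ^ 2 + 1)⁻¹ * h

/-- Comparing coefficients in the eigenvalue equation determines the regular part: its coefficients
are a multiple of `spectralTerm`. The only remaining condition for the closure is that they sum to
zero. -/
theorem mem_newEigenvalues_iff (x₀ : Torus a) {φ : ℝ} (hφ : φ ∈ Set.Ioo (-Real.pi) Real.pi) (t : ℝ) :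
    t ∈ newEigenvalues a x₀ φ ↔
      (∀ k, normSq a k ≠ t) ∧ spectralFn a (Real.tan (φ / 2)) t = 0 := by
  have hspec : t ∉ unperturbedSpectrum a ↔ ∀ k, normSq a k ≠ t := by
    rw [unperturbedSpectrum_eq, Set.mem_range, not_exists]
  set E := Complex.exp (Complex.I * φ) with hE
  have hE0 : 1 + E ≠ 0 := (one_add_exp_I_mul hφ).1
  have hgt := coeff_green x₀ (summable_norm_inv_sub_ofReal (a := a) t)
  have hgi := coeff_green x₀ (summable_norm_inv_sub_I (a := a))
  have hgni := coeff_green x₀ (summable_norm_inv_sub_neg_I (a := a))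
  have hpi : -((2 * Real.pi : ℝ) : ℂ)⁻¹ ≠ 0 :=
    neg_ne_zero.mpr (inv_ne_zero (by exact_mod_cast Real.two_pi_pos.ne'))
  set γ : ℂ := -((2 * Real.pi : ℝ) : ℂ)⁻¹ with hγ
  have hi : ∀ k, ((normSq a k : ℂ) - Complex.I) ≠ 0 := fun k h => by
    have := congrArg Complex.im h; simp at this
  have hni : ∀ k, ((normSq a k : ℂ) - -Complex.I) ≠ 0 := fun k h => by
    have := congrArg Complex.im h; simp at this
  have hterm := fun k => ofReal_spectralTerm_mul (a := a) hφ (k := k) (t := t)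
  change t ∉ unperturbedSpectrum a ∧ _ ↔ _
  rw [hspec]
  refine and_congr_right fun ht => ?_
  have hnt : ∀ k, ((normSq a k : ℂ) - t) ≠ 0 := fun k h =>
    ht k (by exact_mod_cast sub_eq_zero.mp h)
  constructor
  · rintro ⟨f, hf0, q, hq, c, h1, h2⟩
    obtain ⟨hrel, hsum⟩ := (mem_closure_restrictedGraph_iff x₀ q).mp hq
    have hc1 : ∀ k, coeff x₀ k f = coeff x₀ k q.1 + c * (γ * ((normSq a k : ℂ) - Complex.I)⁻¹) +
        c * E * (γ * ((normSq a k : ℂ) - -Complex.I)⁻¹) := fun k => by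
      have := congrArg (coeff x₀ k) h1
      simpa only [map_add, map_smul, smul_eq_mul, hgi, hgni] using this
    have hc2 : ∀ k, t * coeff x₀ k f = normSq a k * coeff x₀ k q.1 +
        Complex.I * c * (γ * ((normSq a k : ℂ) - Complex.I)⁻¹) -
        Complex.I * c * E * (γ * ((normSq a k : ℂ) - -Complex.I)⁻¹) := fun k => by
      have := congrArg (coeff x₀ k) h2
      simpa only [map_add, map_sub, map_smul, smul_eq_mul, hgi, hgni, hrel] using this
    have hq1 : ∀ k, coeff x₀ k q.1 =
        c * γ * (1 + E) * (spectralTerm a (Real.tan (φ / 2)) k t : ℂ) := fun k => by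
      rw [mul_assoc (c * γ), hterm, ← sub_eq_zero]
      have h := hc2 k
      rw [hc1 k] at h
      have k1 := mul_inv_cancel₀ (hnt k)
      have k2 := mul_inv_cancel₀ (hi k)
      have k3 := mul_inv_cancel₀ (hni k)
      refine (mul_eq_zero.mp ?_).resolve_left (hnt k)
      linear_combination -h - c * γ * (1 + E) * k1 + c * γ * k2 + c * γ * E * k3
    -- With no singular part the regular part vanishes as well, because `t` is not a norm.
    have hc : c ≠ 0 := by
      rintro rfl
      refine hf0 (ext_coeff x₀ fun k => ?_)
      rw [hc1, hq1, map_zero]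
      ring
    have hs : HasSum (fun k => c * γ * (1 + E) * (spectralTerm a (Real.tan (φ / 2)) k t : ℂ))
        (c * γ * (1 + E) * 0) := by
      rw [mul_zero]
      exact hsum.congr_fun fun k => (hq1 k).symm
    rw [hasSum_mul_left_iff (mul_ne_zero (mul_ne_zero hc hpi) hE0)] at hs
    exact (Complex.hasSum_ofReal.mp (by simpa using hs)).tsum_eq
  · intro h0
    have hs : HasSum (fun k => spectralTerm a (Real.tan (φ / 2)) k t) 0 := by
      rw [← h0]; exact (summable_spectralTerm _ ht).hasSum
    have hsC : HasSum (fun k => γ * ((1 + E) * (spectralTerm a (Real.tan (φ / 2)) k t : ℂ))) 0 := by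
      simpa using ((Complex.hasSum_ofReal.mpr hs).mul_left (1 + E)).mul_left γ
    -- The eigenfunction is a multiple of `G_t`, normalized so that `c = 1`; the regular part is
    -- what remains after subtracting `G_i` and `e^{iφ} G_{-i}`.
    refine ⟨(1 + E) • green a x₀ t, fun hz => ?_,
      ((1 + E) • green a x₀ t - green a x₀ Complex.I - E • green a x₀ (-Complex.I),
        ((t : ℂ) * (1 + E)) • green a x₀ t - Complex.I • green a x₀ Complex.I +
          (Complex.I * E) • green a x₀ (-Complex.I)), ?_, 1, ?_, ?_⟩
    · have := congrArg (coeff x₀ 0) hz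
      rw [map_smul, map_zero, hgt, smul_eq_mul] at this
      exact mul_ne_zero hE0 (mul_ne_zero hpi (inv_ne_zero (hnt 0))) this
    · rw [mem_closure_restrictedGraph_iff]
      constructor
      · intro k
        simp only [map_add, map_sub, map_smul, smul_eq_mul, hgi, hgni, hgt]
        have k1 := mul_inv_cancel₀ (hnt k)
        have k2 := mul_inv_cancel₀ (hi k)
        have k3 := mul_inv_cancel₀ (hni k)
        linear_combination -γ * (1 + E) * k1 + γ * k2 + γ * E * k3
      · refine hsC.congr_fun fun k => ?_
        rw [hterm]
        simp only [map_sub, map_smul, smul_eq_mul, hgi, hgni, hgt]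
        ring
    · simp only [one_smul, one_mul]
      abel
    · simp only [mul_one, smul_smul]
      abel

theorem interlaces_newEigenvalues (x₀ : Torus a) {φ : ℝ} (hφ : φ ∈ Set.Ioo (-Real.pi) Real.pi) :
    Interlaces a (newEigenvalues a x₀ φ) :=
  interlaces_of_mem_iff (mem_newEigenvalues_iff x₀ hφ)

end Eigenvalues

/-! ### Fourier moments of the squared normalized Green's function. -/

section Moments

variable {a : ℝ} [hFact : Fact (0 < a)]

theorem integrable_expoAt_mul_sq (x₀ : Torus a) (k : ℤ × ℤ) (g : L2 a) :
    Integrable fun x => expoAt a x₀ k x * g x ^ 2 := by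
  have hg : Integrable fun x => g x ^ 2 := by
    have h := (Lp.memLp g).integrable_mul (Lp.memLp g)
    exact h.congr (Eventually.of_forall fun x => by simp [sq])
  exact hg.bdd_mul (c := 1) (expoAt a x₀ k).continuous.aestronglyMeasurable
    (Eventually.of_forall fun x => (norm_expoAt_apply x₀ k x).le)

/-- The Fourier moments of `g²` are autocorrelations of the coefficients of `g`. -/
theorem hasSum_coeff_mul_coeff (x₀ : Torus a) (ζ : ℤ × ℤ) (g : L2 a) :
    HasSum (fun k => coeff x₀ (-(k + ζ)) g * coeff x₀ k g)
      (∫ x, expoAt a x₀ ζ x * g x ^ 2) := by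
  -- The integrand carries `g²` and not `|g|²`, so it is the inner product of `conj (e_ζ g)` with
  -- `g`; Parseval then applies.
  have hmem : MemLp (fun x => (starRingEnd ℂ) (expoAt a x₀ ζ x * g x)) 2
      (volume : Measure (Torus a)) := by
    refine (Lp.memLp g).of_le ?_ (Eventually.of_forall fun x => ?_)
    · exact Complex.continuous_conj.comp_aestronglyMeasurable
        ((expoAt a x₀ ζ).continuous.aestronglyMeasurable.mul (Lp.aestronglyMeasurable g))
    · rw [RCLike.norm_conj, norm_mul, norm_expoAt_apply, one_mul]
  set f : L2 a := hmem.toLp with hf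
  have hfae : f =ᵐ[volume] fun x => (starRingEnd ℂ) (expoAt a x₀ ζ x * g x) := hmem.coeFn_toLp
  have hcoeff : ∀ k, (starRingEnd ℂ) (coeff x₀ k f) = coeff x₀ (-(k + ζ)) g := by
    intro k
    rw [coeff_eq_integral x₀ k hfae, coeff_eq_integral x₀ (-(k + ζ)) (ae_eq_refl g), map_mul,
      ← integral_conj]
    congr 1
    · rw [map_inv₀, Complex.conj_ofReal]
    · refine integral_congr_ae (Eventually.of_forall fun x => ?_)
      simp only [expoAt_neg, expoAt_add, neg_neg, map_mul, Complex.conj_conj]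
      ring
  have hinner : inner ℂ f g = ∫ x, expoAt a x₀ ζ x * g x ^ 2 := by
    rw [L2.inner_def]
    refine integral_congr_ae ?_
    filter_upwards [hfae] with x hx
    rw [hx, RCLike.inner_apply, RCLike.conj_conj]
    ring
  rw [← hinner]
  refine ((expoBasis x₀).hasSum_inner_mul_inner f g).congr_fun fun k => ?_
  rw [← hcoeff, ← inner_conj_symm f, expoBasis_apply]
  rfl

theorem exists_coeff_normalizedGreen (x₀ : Torus a) {t : ℝ} (ht : ∀ k, normSq a k ≠ t) :
    ∃ ρ : ℝ, (∀ k, coeff x₀ k (normalizedGreen a x₀ t) = ((ρ * (normSq a k - t)⁻¹ : ℝ) : ℂ)) ∧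
      ρ ^ 2 * ∑' k, ((normSq a k - t) ^ 2)⁻¹ = 1 := by
  set G := green a x₀ (t : ℂ) with hG
  have hc := coeff_green x₀ (summable_norm_inv_sub_ofReal (a := a) t)
  set ρ : ℝ := ‖G‖⁻¹ * -(2 * Real.pi)⁻¹ with hρ
  have hcoeff : ∀ k, coeff x₀ k (normalizedGreen a x₀ t) = ((ρ * (normSq a k - t)⁻¹ : ℝ) : ℂ) := by
    intro k
    rw [normalizedGreen, map_smul, hc, hρ, smul_eq_mul, ← hG]
    push_cast
    ring
  have hG0 : G ≠ 0 := by
    intro h0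
    have := hc 0
    rw [← hG, h0, map_zero, eq_comm, mul_eq_zero] at this
    rcases this with h | h
    · exact neg_ne_zero.mpr (inv_ne_zero (by exact_mod_cast Real.two_pi_pos.ne')) h
    · exact inv_ne_zero (sub_ne_zero.mpr (by exact_mod_cast ht 0)) h
  have hnorm : ‖normalizedGreen a x₀ t‖ = 1 := by
    rw [normalizedGreen, norm_smul, Complex.norm_real, norm_inv, norm_norm, ← hG,
      inv_mul_cancel₀ (norm_ne_zero_iff.mpr hG0)]
  refine ⟨ρ, hcoeff, ?_⟩
  have h := hasSum_norm_coeff_sq x₀ (normalizedGreen a x₀ t)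
  rw [hnorm, one_pow] at h
  rw [← tsum_mul_left, ← h.tsum_eq]
  refine tsum_congr fun k => ?_
  rw [hcoeff, Complex.norm_real, Real.norm_eq_abs, sq_abs, mul_pow ρ, inv_pow (normSq a k - t)]

/-- By the arithmetic–geometric mean inequality and shift invariance; it yields the bound `1` on all
moments used for domination. -/
theorem summable_abs_mul_shift (t : ℝ) (ζ : ℤ × ℤ) :
    Summable (fun k => |(normSq a k - t)⁻¹ * (normSq a (k + ζ) - t)⁻¹|) ∧
      ∑' k, |(normSq a k - t)⁻¹ * (normSq a (k + ζ) - t)⁻¹| ≤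
        ∑' k, ((normSq a k - t) ^ 2)⁻¹ := by
  have hs := summable_inv_normSq_sub_sq hFact.out t
  have hs2 := summable_shift hs ζ
  have hle : ∀ k, |(normSq a k - t)⁻¹ * (normSq a (k + ζ) - t)⁻¹| ≤
      2⁻¹ * (((normSq a k - t) ^ 2)⁻¹ + ((normSq a (k + ζ) - t) ^ 2)⁻¹) := fun k => by
    rw [← inv_pow, ← inv_pow, abs_le]
    constructor <;> nlinarith [sq_nonneg ((normSq a k - t)⁻¹ + (normSq a (k + ζ) - t)⁻¹),
      sq_nonneg ((normSq a k - t)⁻¹ - (normSq a (k + ζ) - t)⁻¹)]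
  have hsum := (hs.add hs2).mul_left 2⁻¹
  have h1 := Summable.of_nonneg_of_le (fun k => abs_nonneg _) hle hsum
  refine ⟨h1, (h1.tsum_le_tsum hle hsum).trans ?_⟩
  rw [tsum_mul_left, hs.tsum_add hs2, tsum_shift (fun k => ((normSq a k - t) ^ 2)⁻¹) ζ]
  linarith

theorem norm_moment_le (x₀ : Torus a) {t : ℝ} (ht : ∀ k, normSq a k ≠ t) (ζ : ℤ × ℤ) {B : ℝ}
    (hB : ∑' k, |(normSq a k - t)⁻¹ * (normSq a (k + ζ) - t)⁻¹| ≤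
      B * ∑' k, ((normSq a k - t) ^ 2)⁻¹) :
    ‖∫ x, expoAt a x₀ ζ x * normalizedGreen a x₀ t x ^ 2‖ ≤ B := by
  obtain ⟨ρ, hc, hρ⟩ := exists_coeff_normalizedGreen x₀ ht
  have hnorm : ∀ k, ‖coeff x₀ (-(k + ζ)) (normalizedGreen a x₀ t) *
      coeff x₀ k (normalizedGreen a x₀ t)‖ =
      ρ ^ 2 * |(normSq a k - t)⁻¹ * (normSq a (k + ζ) - t)⁻¹| := fun k => by
    rw [hc, hc, ← Complex.ofReal_mul, Complex.norm_real, Real.norm_eq_abs, normSq_neg,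
      show ρ * (normSq a (k + ζ) - t)⁻¹ * (ρ * (normSq a k - t)⁻¹) =
        ρ ^ 2 * ((normSq a k - t)⁻¹ * (normSq a (k + ζ) - t)⁻¹) by ring,
      abs_mul (ρ ^ 2), abs_of_nonneg (sq_nonneg ρ)]
  have hs := (summable_abs_mul_shift (a := a) t ζ).1.mul_left (ρ ^ 2)
  rw [← (hasSum_coeff_mul_coeff x₀ ζ (normalizedGreen a x₀ t)).tsum_eq]
  calc _ ≤ ∑' k, ρ ^ 2 * |(normSq a k - t)⁻¹ * (normSq a (k + ζ) - t)⁻¹| :=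
        tsum_of_norm_bounded hs.hasSum fun k => (hnorm k).le
    _ = ρ ^ 2 * ∑' k, |(normSq a k - t)⁻¹ * (normSq a (k + ζ) - t)⁻¹| := tsum_mul_left
    _ ≤ ρ ^ 2 * (B * ∑' k, ((normSq a k - t) ^ 2)⁻¹) := by gcongr
    _ = B := by rw [mul_left_comm, hρ, mul_one]

/-- The coefficients are real and even in `ξ`, so `∫ g²` is the sum of their squares, which is `‖g‖²
= 1`. -/
theorem moment_zero (x₀ : Torus a) {t : ℝ} (ht : ∀ k, normSq a k ≠ t) :
    ∫ x, expoAt a x₀ 0 x * normalizedGreen a x₀ t x ^ 2 = 1 := by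
  obtain ⟨ρ, hc, hρ⟩ := exists_coeff_normalizedGreen x₀ ht
  rw [← (hasSum_coeff_mul_coeff x₀ 0 (normalizedGreen a x₀ t)).tsum_eq, ← Complex.ofReal_one, ← hρ,
    ← tsum_mul_left, Complex.ofReal_tsum]
  refine tsum_congr fun k => ?_
  rw [hc, hc, add_zero, normSq_neg, ← Complex.ofReal_mul, ← inv_pow]
  congr 1
  ring

theorem IsSmooth.integral_mul_sq_eq_tsum {x₀ : Torus a} {b : Torus a → ℂ} (hb : IsSmooth b)
    (g : L2 a) :
    ∫ x, b x * g x ^ 2 = ∑' ζ, (((2 * Real.pi : ℝ) : ℂ)⁻¹ *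
      coeff x₀ ζ (classL2 b hb.continuous)) * ∫ x, expoAt a x₀ ζ x * g x ^ 2 := by
  have hae := coeFn_classL2 hb.continuous
  set β : ℤ × ℤ → ℂ := fun ζ => ((2 * Real.pi : ℝ) : ℂ)⁻¹ * coeff x₀ ζ (classL2 b hb.continuous)
    with hβ
  have hβs : Summable fun ζ => ‖β ζ‖ := by
    simp only [hβ, norm_mul]
    exact (hb.summable_norm_coeff (x₀ := x₀) hae).mul_left _
  have hint := fun ζ => integrable_expoAt_mul_sq x₀ ζ g
  have h := hasSum_integral_of_summable_integral_norm (μ := (volume : Measure (Torus a)))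
    (F := fun ζ x => β ζ * (expoAt a x₀ ζ x * g x ^ 2)) (fun ζ => (hint ζ).const_mul _) (by
      have e : ∀ ζ, ∫ x, ‖β ζ * (expoAt a x₀ ζ x * g x ^ 2)‖ = ‖β ζ‖ * ∫ x, ‖g x ^ 2‖ := fun ζ => by
        rw [← integral_const_mul]
        refine integral_congr_ae (Eventually.of_forall fun x => ?_)
        simp only [norm_mul, norm_expoAt_apply, one_mul]
      simp only [e]
      exact hβs.mul_right _)
  have e2 : ∀ x, ∑' ζ, β ζ * (expoAt a x₀ ζ x * g x ^ 2) = b x * g x ^ 2 := fun x => by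
    refine HasSum.tsum_eq ?_
    refine ((hb.hasSum_coeff_mul_expoAt (x₀ := x₀) hae x).mul_right (g x ^ 2)).congr_fun fun ζ => ?_
    rw [hβ]; ring
  simp only [e2] at h
  rw [← h.tsum_eq]
  exact tsum_congr fun ζ => integral_const_mul _ _

end Moments

/-- Dominated convergence in the frequency `ζ`: the coefficients of `b` are absolutely summable, the
moments are at most `1`, and only `ζ = 0` survives in the limit, which gives the mean of `b`. -/
theorem tendsto_integral_mul_normalizedGreen_sq {a : ℝ} [hFact : Fact (0 < a)] (x₀ : Torus a)
    {Λ : Set ℝ} (hΛ : Interlaces a Λ) {b : Torus a → ℂ} (hb : IsSmooth b) :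
    Tendsto (fun t : ℝ => ∫ x, b x * (normalizedGreen a x₀ t x) ^ 2)
      (atTop ⊓ 𝓟 (uncorrelatedSet a Λ))
      (𝓝 ((((volume : Measure (Torus a)).real Set.univ)⁻¹ : ℝ) * ∫ x, b x)) := by
  have hae := coeFn_classL2 hb.continuous
  have hS : ∀ᶠ t in atTop ⊓ 𝓟 (uncorrelatedSet a Λ), t ∈ uncorrelatedSet a Λ :=
    mem_inf_of_right (mem_principal_self _)
  have hne : ∀ t ∈ uncorrelatedSet a Λ, ∀ k, normSq a k ≠ t := fun t ht =>
    hΛ.normSq_ne t ht.1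
  set β : ℤ × ℤ → ℂ := fun ζ => ((2 * Real.pi : ℝ) : ℂ)⁻¹ * coeff x₀ ζ (classL2 b hb.continuous)
    with hβ
  have hlim : (((volume : Measure (Torus a)).real Set.univ)⁻¹ : ℝ) * ∫ x, b x =
      ∑' ζ : ℤ × ℤ, if ζ = 0 then β 0 else 0 := by
    rw [tsum_ite_eq, volume_real_univ, hβ]
    simp only
    rw [coeff_eq_integral x₀ 0 hae, neg_zero, ← mul_assoc]
    simp only [expoAt_zero, one_mul]
    congr 1
    push_cast
    rw [← mul_inv]
    congr 1
    ring
  rw [hlim]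
  simp only [hb.integral_mul_sq_eq_tsum (x₀ := x₀)]
  refine tendsto_tsum_of_dominated_convergence (G := ℂ) (bound := fun ζ => ‖β ζ‖) ?_ (fun ζ => ?_) ?_
  · simp only [hβ, norm_mul]
    exact (hb.summable_norm_coeff (x₀ := x₀) hae).mul_left _
  · split_ifs with hζ
    · subst hζ
      refine tendsto_const_nhds.congr' ?_
      filter_upwards [hS] with t ht
      rw [moment_zero x₀ (hne t ht), mul_one]
    · rw [← mul_zero (β ζ)]
      refine Tendsto.const_mul _ (squeeze_zero_norm' (a := fun t : ℝ =>
        6 * (t ^ (1 / 128 : ℝ))⁻¹) ?_ ?_)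
      · have hbig : ∀ᶠ t : ℝ in atTop ⊓ 𝓟 (uncorrelatedSet a Λ), normSq a ζ ≤ t ^ (1 / 128 : ℝ) :=
          ((tendsto_rpow_atTop (by norm_num)).eventually_ge_atTop _).filter_mono inf_le_left
        filter_upwards [hS, hbig] with t ht hζt
        exact norm_moment_le x₀ (hne t ht) ζ (ht.2.2 ζ hζ hζt)
      · have h : Tendsto (fun t : ℝ => 6 * (t ^ (1 / 128 : ℝ))⁻¹) atTop (𝓝 (6 * 0)) :=
          (tendsto_inv_atTop_zero.comp (tendsto_rpow_atTop (by norm_num))).const_mul 6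
        rw [mul_zero] at h
        exact h.mono_left inf_le_left
  · filter_upwards [hS] with t ht ζ
    rw [norm_mul]
    refine mul_le_of_le_one_right (norm_nonneg _) (norm_moment_le x₀ (hne t ht) ζ ?_)
    rw [one_mul]
    exact (summable_abs_mul_shift t ζ).2

end PointScatterer

theorem theorem1p1 (a : ℝ) [Fact (0 < a)] (x₀ : PointScatterer.Torus a) (φ : ℝ)
    (hφ : φ ∈ Set.Ioo (-Real.pi) Real.pi) :
    ∃ S : Set ℝ,
      PointScatterer.IsDensityOneSubset S (PointScatterer.newEigenvalues a x₀ φ) ∧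
      ∀ b : PointScatterer.Torus a → ℂ, PointScatterer.IsSmooth b →
        Tendsto
          (fun t : ℝ => ∫ x, b x * (PointScatterer.normalizedGreen a x₀ t x) ^ 2)
          (atTop ⊓ 𝓟 S)
          (𝓝 ((((volume : Measure (PointScatterer.Torus a)).real Set.univ)⁻¹ : ℝ) *
            ∫ x, b x)) :=
  have hΛ := PointScatterer.interlaces_newEigenvalues x₀ hφ
  ⟨PointScatterer.uncorrelatedSet a (PointScatterer.newEigenvalues a x₀ φ),
    hΛ.isDensityOneSubset Fact.out,
    fun _ hb => PointScatterer.tendsto_integral_mul_normalizedGreen_sq x₀ hΛ hb⟩
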